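/- **Setting.** Let $L>0$, $s>0$, and write $\langle\cdot,\cdot\rangle$ for the inner product of $L^2_{per}([0,L])\times L^2_{per}([0,L])$ (real, $L$-periodic functions) and $X=H^{s/2}_{per}([0,L])\times H^{s/2}_{per}([0,L])$, with norm $\|u\|_X^2=\sum_{\kappa\in\mathbb Z}(1+\kappa^2)^{s/2}|\widehat u(\kappa)|^2$, where $\widehat u(\kappa)=\frac1L\int_0^L u(x)e^{-2\pi i\kappa x/L}\,dx$. Consider the system $$\partial_t u+\partial_x\big(\nabla R(u)-\mathcal M u\big)=0,\qquad u=(u_1,u_2),\tag{1}$$ where $R:\mathbb R^2\to\mathbb R$ is of class $C^2$ and $\widehat{\mathcal M u}(\kappa)=m(\kappa)\widehat u(\kappa)$, $\kappa\in\mathbb Z$, with real symmetric $2\times2$ matrices $m(\kappa)$ such that $m(-\kappa)=m(\kappa)$ and, for some $c_1,c_2>0$, $c_1|\kappa|^s\le\langle m(\kappa)w,w\rangle_{\mathbb R^2}\le c_2|\kappa|^s$ for all $\kappa\in\mathbb Z$ and all unit vectors $w\in\mathbb R^2$. If $s\le1$, assume moreover that $R(u)$ is integrable over a period for every $u\in X$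 and that $u\mapsto\int_0^LR(u)\,dx$ is of class $C^2$ near the function $\phi$ below, as a functional on $X$ (if $s>1$ this is automatic). Let $E(u)=\int_0^L\{\frac12\langle\mathcal Mu,u\rangle_{\mathbb R^2}-R(u)\}\,dx$ (with $\int_0^L\langle\mathcal Mu,u\rangle_{\mathbb R^2}dx$ understood as the quadratic form of $\mathcal M$ on $X$) and $F(u)=\frac12\int_0^L\langle u,u\rangle_{\mathbb R^2}\,dx$. Assume that (1) is globally well-posed in $X$. Of this, only the following is used: to every $u_0\in X$ there is assigned a global solution $u(t)=S(t)u_0$, $u\in C([0,\infty);X)$, $u(0)=u_0$, for which $\nabla R(u(t))$ is integrable over a period for every $t\ge0$ and, for all smooth $L$-periodic $\eta:\mathbb R\to\mathbb R^2$ and all $t\ge0$, $\langle u(t),\eta\rangle-\langle u_0,\eta\rangle=\int_0^t\langle\nabla R(u(\tau))-\mathcal Mu(\tau),\eta'\rangle\,d\tau$ (the integrand being integrable on $[0,t]$). Assume that $E$ and $F$ are conserved. A functional $Q:X\to\mathbb R$ is called conserved if $Q(S(t)u_0)=Q(u_0)$ for all $u_0\in X$ and $t\ge0$. **Assumptions.**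 $(H_1)$ $\phi=(\phi_1,\phi_2)\in C^\infty_{per}([0,L])\times C^\infty_{per}([0,L])$ has minimal period $L$ and satisfies $\mathcal M\phi+c\phi-\nabla R(\phi)+A=0$ for some $c\in\mathbb R$ and $A\in\mathbb R^2$. The self-adjoint operator $$\mathcal L=\mathcal M+c\,\mathrm{Id}_2-\mathrm{Hess}\,R(\phi)$$ in $L^2_{per}\times L^2_{per}$ with domain $H^s_{per}\times H^s_{per}$ has exactly one negative eigenvalue, which is simple, and zero is a simple eigenvalue with eigenfunction $\phi'$. $(H_2)$ There is $\Phi\in X$ with $\langle\mathcal L\Phi,\Phi\rangle<0$ and $\langle\mathcal L\Phi,\phi'\rangle=0$ (where $\langle\mathcal L\cdot,\cdot\rangle$ is the bilinear form of $\mathcal L$ on $X$), and there is a conserved functional $Q:X\to\mathbb R$, invariant under translations, $Q(u(\cdot+y))=Q(u)$ for all $y\in\mathbb R$ and $u\in X$, that is Fréchet differentiable at $\phi$ with $Q'(\phi)=\mathcal L\Phi$, that is, $Q'(\phi)v=\langle\mathcal L\Phi,v\rangle$ for all $v\in X$. **Theorem.** Under these assumptions $\phi$ is orbitally stable in $X$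 by the flow of (1): for every $\varepsilon>0$ there is $\delta>0$ such that for every $u_0\in X$ with $\|u_0-\phi\|_X<\delta$ the solution $u(t)=S(t)u_0$ exists globally and satisfies $$\rho(u(t),\phi):=\inf_{y\in\mathbb R}\|u(t)-\phi(\cdot+y)\|_X<\varepsilon\qquad\text{for all }t\ge0.$$ -/

import Mathlib

open MeasureTheory Set Filter Topology
open scoped ContDiff

noncomputable section

namespace DispersiveSystem

/-- The plane `ℝ²` with its Euclidean inner product; the systems below are for `ℝ²`-valued
unknowns. -/
abbrev Plane := EuclideanSpace ℝ (Fin 2)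

/-! ### Fourier coefficients of `L`-periodic `ℝ²`-valued functions

`L`-periodic functions of a real variable are functions on `AddCircle L = ℝ/Lℤ`. Integrals over
`AddCircle L` are integrals over one period (total mass `L`). -/

section Fourier

variable {L : ℝ} [Fact (0 < L)]

/-- The Fourier coefficient `(1/L) ∫₀ᴸ fᵢ(x) e^{-2πiκx/L} dx` of the `i`-th component of `f`. -/
def fcoef (f : AddCircle L → Plane) (κ : ℤ) (i : Fin 2) : ℂ :=
  fourierCoeff (fun x => ((f x i : ℝ) : ℂ)) κ

lemma integrable_haar {f : AddCircle L → Plane} (hf : Integrable f) (i : Fin 2) :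
    Integrable (fun x => ((f x i : ℝ) : ℂ)) AddCircle.haarAddCircle := by
  have h1 : Integrable (fun x => ((f x i : ℝ) : ℂ)) :=
    ((EuclideanSpace.proj (𝕜 := ℝ) i).integrable_comp hf).ofReal
  rw [← memLp_one_iff_integrable] at h1 ⊢
  exact memLp_haarAddCircle_iff.2 h1

lemma ae_haar {p : AddCircle L → Prop} (h : ∀ᵐ x, p x) :
    ∀ᵐ x ∂(AddCircle.haarAddCircle : Measure (AddCircle L)), p x := by
  rw [AddCircle.volume_eq_smul_haarAddCircle] at h
  have hL : (0 : ℝ) < L := Fact.out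
  rwa [Measure.ae_ennreal_smul_measure_eq (by simpa using hL)] at h

lemma fcoef_congr {f g : AddCircle L → Plane} (h : f =ᵐ[volume] g) : fcoef f = fcoef g := by
  funext κ i
  refine congrFun (fourierCoeff_congr_ae ?_) κ
  filter_upwards [ae_haar h] with x hx
  simp [hx]

lemma fcoef_add {f g : AddCircle L → Plane} (hf : Integrable f) (hg : Integrable g) (κ : ℤ)
    (i : Fin 2) : fcoef (f + g) κ i = fcoef f κ i + fcoef g κ i := by
  have h := congrFun (fourierCoeff.add (integrable_haar hf i) (integrable_haar hg i)) κ
  rw [Pi.add_apply] at h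
  rw [fcoef, fcoef, fcoef, ← h]
  congr 1
  funext x
  simp

lemma fcoef_smul (a : ℝ) (f : AddCircle L → Plane) (κ : ℤ) (i : Fin 2) :
    fcoef (a • f) κ i = a * fcoef f κ i := by
  rw [fcoef, fcoef, ← fourierCoeff.const_mul]
  congr 1
  funext x
  simp

lemma fcoef_translate (f : AddCircle L → Plane) (y : AddCircle L) (κ : ℤ) (i : Fin 2) :
    fcoef (fun x => f (x + y)) κ i = fourier κ y * fcoef f κ i := by
  unfold fcoef fourierCoeff
  rw [← integral_const_mul, ← integral_add_right_eq_self (μ := AddCircle.haarAddCircle)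
    (fun t => fourier κ y * (fourier (-κ) t • ((f t i : ℝ) : ℂ))) y]
  congr 1
  funext x
  have h : fourier κ y * fourier (-κ) (x + y) = fourier (-κ) x := by
    rw [fourier_apply, fourier_apply, fourier_apply, ← Circle.coe_mul, ← AddCircle.toCircle_add]
    congr 2
    module
  rw [smul_eq_mul, smul_eq_mul, ← mul_assoc, h]

end Fourier

/-! ### The Sobolev spaces `H^r_per([0,L]) × H^r_per([0,L])` -/

section Sobolev

variable (L : ℝ) [Fact (0 < L)] (r : ℝ)

/-- `L²_per([0,L]) × L²_per([0,L])`. -/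
abbrev L2per := Lp Plane 2 (volume : Measure (AddCircle L))

variable {L}

lemma integrable_L2 (f : L2per L) : Integrable (f : AddCircle L → Plane) :=
  (Lp.memLp f).integrable (by norm_num)

/-- Membership of `f` in `H^r × H^r`, for a square integrable `f`:
`∑_κ (1 + κ²)^r |f̂(κ)|² < ∞`. -/
def InSobolev (f : AddCircle L → Plane) : Prop :=
  Summable fun κ : ℤ => (1 + (κ : ℝ) ^ 2) ^ r * ∑ i, ‖fcoef f κ i‖ ^ 2

/-- The weighted Fourier coefficients `(1 + κ²)^{r/2} f̂(κ) ∈ ℂ²`. -/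
def wcoef (f : AddCircle L → Plane) (κ : ℤ) : EuclideanSpace ℂ (Fin 2) :=
  ((1 + (κ : ℝ) ^ 2) ^ (r / 2) : ℝ) • WithLp.toLp 2 (fcoef f κ)

lemma norm_wcoef_sq (f : AddCircle L → Plane) (κ : ℤ) :
    ‖wcoef r f κ‖ ^ 2 = (1 + (κ : ℝ) ^ 2) ^ r * ∑ i, ‖fcoef f κ i‖ ^ 2 := by
  have h0 : (0 : ℝ) ≤ 1 + (κ : ℝ) ^ 2 := by positivity
  rw [wcoef, norm_smul, mul_pow, EuclideanSpace.norm_sq_eq, Real.norm_eq_abs, sq_abs,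
    ← Real.rpow_natCast, ← Real.rpow_mul h0]
  norm_num

lemma inSobolev_iff (f : AddCircle L → Plane) :
    InSobolev r f ↔ Memℓp (wcoef r f) 2 := by
  rw [memℓp_gen_iff (by norm_num)]
  simp only [ENNReal.toReal_ofNat, Real.rpow_ofNat, norm_wcoef_sq]
  rfl

lemma wcoef_add (f g : L2per L) : wcoef r (f + g : L2per L) = wcoef r f + wcoef r g := by
  funext κ
  have h : fcoef (f + g : L2per L) κ = fcoef f κ + fcoef g κ := by
    rw [fcoef_congr (Lp.coeFn_add f g)]
    exact funext (fcoef_add (integrable_L2 f) (integrable_L2 g) κ)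
  rw [wcoef, h, Pi.add_apply, wcoef, wcoef, WithLp.toLp_add, smul_add]

lemma wcoef_smul (a : ℝ) (f : L2per L) : wcoef r (a • f : L2per L) = a • wcoef r f := by
  funext κ
  have h : fcoef (a • f : L2per L) κ = a • fcoef f κ := by
    rw [fcoef_congr (Lp.coeFn_smul a f)]
    funext i
    simpa using fcoef_smul a f κ i
  rw [wcoef, h, Pi.smul_apply, wcoef, WithLp.toLp_smul, smul_comm]

variable (L)

/-- `H^r × H^r` as a subspace of `L² × L²`. -/
def sobolevSubmodule : Submodule ℝ (L2per L) where
  carrier := {f | InSobolev r (f : AddCircle L → Plane)}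
  add_mem' {f g} hf hg := by
    simp only [mem_ofPred_eq, inSobolev_iff] at *
    rw [wcoef_add]
    exact hf.add hg
  zero_mem' := by
    simp only [mem_ofPred_eq, inSobolev_iff]
    have h := wcoef_smul r (0 : ℝ) (0 : L2per L)
    rw [smul_zero, zero_smul] at h
    rw [h]
    exact zero_memℓp
  smul_mem' a f hf := by
    simp only [mem_ofPred_eq, inSobolev_iff] at *
    rw [wcoef_smul]
    exact hf.const_smul a

/-- The Sobolev space `H^r_per([0,L]) × H^r_per([0,L])` of real functions, with norm
`‖u‖² = ∑_κ (1 + κ²)^r |û(κ)|²` (see `Hper.norm_sq`). -/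
def Hper : Type := sobolevSubmodule L r

instance : AddCommGroup (Hper L r) := inferInstanceAs (AddCommGroup (sobolevSubmodule L r))

instance : Module ℝ (Hper L r) := inferInstanceAs (Module ℝ (sobolevSubmodule L r))

variable {L r}

/-- The underlying `L²` function. -/
def Hper.toL2 (u : Hper L r) : L2per L := Subtype.val (p := (· ∈ sobolevSubmodule L r)) u

instance : CoeFun (Hper L r) (fun _ => AddCircle L → Plane) := ⟨fun u => (u.toL2 : _ → Plane)⟩

variable (L r)

/-- `u ↦ ((1 + κ²)^{r/2} û(κ))_κ`, a linear map into `ℓ²(ℤ, ℂ²)`. -/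
def Hper.toEll2 : Hper L r →ₗ[ℝ] lp (fun _ : ℤ => EuclideanSpace ℂ (Fin 2)) 2 where
  toFun u := ⟨wcoef r u, (inSobolev_iff r u).1 u.2⟩
  map_add' u v := Subtype.ext (wcoef_add r u.toL2 v.toL2)
  map_smul' a u := Subtype.ext (wcoef_smul r a u.toL2)

variable {L}

/-- An `L²` function all of whose Fourier coefficients vanish is zero. -/
lemma eq_zero_of_fcoef (f : L2per L) (h : ∀ κ i, fcoef f κ i = 0) : f = 0 := by
  have key : ∀ i : Fin 2, ∀ᵐ x, (f x i : ℝ) = 0 := by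
    intro i
    have hm : MemLp (fun x => ((f x i : ℝ) : ℂ)) 2 (volume : Measure (AddCircle L)) :=
      ((EuclideanSpace.proj (𝕜 := ℝ) i).comp_memLp' (Lp.memLp f)).ofReal
    have hm' := memLp_haarAddCircle_iff.2 hm
    have hz : hm'.toLp _ = 0 := by
      apply fourierBasis.repr.injective
      rw [map_zero]
      ext κ
      rw [fourierBasis_repr, fourierCoeff_congr_ae hm'.coeFn_toLp]
      exact h κ i
    have h0 := (Lp.eq_zero_iff_ae_eq_zero).1 hz
    have h1 : ∀ᵐ x ∂(AddCircle.haarAddCircle : Measure (AddCircle L)), (f x i : ℝ) = 0 := by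
      filter_upwards [h0, hm'.coeFn_toLp] with x hx hx'
      rw [hx'] at hx
      simpa using hx
    exact Measure.ae_smul_measure h1 (ENNReal.ofReal L)
  rw [Lp.eq_zero_iff_ae_eq_zero]
  filter_upwards [key 0, key 1] with x h0 h1
  ext i
  fin_cases i
  · simpa using h0
  · simpa using h1

variable (L)

lemma Hper.toEll2_injective : Function.Injective (Hper.toEll2 L r) := by
  rw [← LinearMap.ker_eq_bot, LinearMap.ker_eq_bot']
  intro u hu
  refine Subtype.ext (eq_zero_of_fcoef u.toL2 fun κ i => ?_)
  have h1 : wcoef r u κ = 0 := congrFun (congrArg Subtype.val hu) κ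
  have h0 : (0 : ℝ) < (1 + (κ : ℝ) ^ 2) ^ (r / 2) := by positivity
  rw [wcoef, smul_eq_zero_iff_right h0.ne'] at h1
  simpa using congrArg (fun w : EuclideanSpace ℂ (Fin 2) => w i) h1

instance : NormedAddCommGroup (Hper L r) :=
  NormedAddCommGroup.induced (Hper L r) _ (Hper.toEll2 L r) (Hper.toEll2_injective L r)

instance : NormedSpace ℝ (Hper L r) := NormedSpace.induced ℝ (Hper L r) _ (Hper.toEll2 L r)

variable {L r}

lemma Hper.norm_sq (u : Hper L r) :
    ‖u‖ ^ 2 = ∑' κ : ℤ, (1 + (κ : ℝ) ^ 2) ^ r * ∑ i, ‖fcoef u κ i‖ ^ 2 := by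
  have h := lp.norm_rpow_eq_tsum (p := 2) (by norm_num) (Hper.toEll2 L r u)
  simp only [ENNReal.toReal_ofNat, Real.rpow_ofNat] at h
  change ‖Hper.toEll2 L r u‖ ^ 2 = _
  rw [h]
  exact tsum_congr fun κ => norm_wcoef_sq r u κ

/-- The translate `u(· + y)` of an element of `L² × L²`. -/
def translateL2 (y : ℝ) (f : L2per L) : L2per L :=
  Lp.compMeasurePreserving (fun x => x + (y : AddCircle L))
    (measurePreserving_add_right volume (y : AddCircle L)) f

/-- The translate `u(· + y)` of an element of `H^r × H^r`. -/
def translate (y : ℝ) (u : Hper L r) : Hper L r :=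
  ⟨translateL2 y u.toL2, by
    have h1 : InSobolev r (u : AddCircle L → Plane) := u.2
    change InSobolev r (translateL2 y u.toL2 : AddCircle L → Plane)
    have h2 := fcoef_congr (Lp.coeFn_compMeasurePreserving u.toL2
      (measurePreserving_add_right volume (y : AddCircle L)))
    unfold InSobolev at h1 ⊢
    rw [translateL2, h2]
    convert h1 using 5 with κ i
    change ‖fcoef (fun x => u (x + (y : AddCircle L))) κ _‖ = _
    rw [fcoef_translate, norm_mul, fourier_apply, Circle.norm_coe, one_mul]⟩

/-- `ρ(u,v) = inf_{y ∈ ℝ} ‖u - v(· + y)‖`. -/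
def rho (u v : Hper L r) : ℝ := ⨅ y : ℝ, ‖u - translate y v‖

end Sobolev

/-! ### Smooth periodic functions -/

section Smooth

/-- `C^∞` functions `ℝ → ℝ²` of period `L`, as functions on `ℝ/Lℤ`. -/
structure SmoothPer (L : ℝ) where
  toFun : AddCircle L → Plane
  smooth : ContDiff ℝ ∞ fun x : ℝ => toFun (x : AddCircle L)

instance (L : ℝ) : CoeFun (SmoothPer L) (fun _ => AddCircle L → Plane) := ⟨SmoothPer.toFun⟩

variable {L : ℝ}

lemma SmoothPer.deriv_aux (f : SmoothPer L) (a : ℝ) :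
    deriv (fun t : ℝ => f ((a : AddCircle L) + (t : AddCircle L))) 0 =
      deriv (fun t : ℝ => f (t : AddCircle L)) a := by
  have h := deriv_comp_const_add (f := fun t : ℝ => f (t : AddCircle L)) a 0
  rw [add_zero] at h
  rw [← h]
  rfl

/-- The derivative `f'`. -/
def SmoothPer.deriv (f : SmoothPer L) : SmoothPer L where
  toFun x := _root_.deriv (fun t : ℝ => f (x + (t : AddCircle L))) 0
  smooth := by
    simp only [SmoothPer.deriv_aux]
    exact (contDiff_infty_iff_deriv.1 f.smooth).2

lemma SmoothPer.hasDerivAt (f : SmoothPer L) (a : ℝ) :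
    HasDerivAt (fun t : ℝ => f (t : AddCircle L)) (f.deriv (a : AddCircle L)) a := by
  have h : f.deriv (a : AddCircle L) = _ := f.deriv_aux a
  rw [h]
  exact (f.smooth.differentiable (by simp) a).hasDerivAt

lemma SmoothPer.continuous (f : SmoothPer L) : Continuous (f : AddCircle L → Plane) :=
  (QuotientAddGroup.isQuotientMap_mk (N := AddSubgroup.zmultiples L)).continuous_iff.2
    f.smooth.continuous

variable [Fact (0 < L)]

lemma SmoothPer.fcoef_deriv (f : SmoothPer L) {κ : ℤ} (hκ : κ ≠ 0) (i : Fin 2) :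
    ‖fcoef f κ i‖ = L / (2 * Real.pi * |(κ : ℝ)|) * ‖fcoef f.deriv κ i‖ := by
  have hL : (0 : ℝ) < L := Fact.out
  have hlift : ∀ g : SmoothPer L, fcoef g κ i =
      fourierCoeffOn (lt_add_of_pos_right (0 : ℝ) hL)
        (fun x : ℝ => ((g (x : AddCircle L) i : ℝ) : ℂ)) κ := by
    intro g
    rw [← fourierCoeff_liftIoc_eq, fcoef]
    congr 1
    funext x
    obtain ⟨a, ha, rfl⟩ : ∃ a ∈ Ioc (0 : ℝ) (0 + L), (a : AddCircle L) = x :=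
      ⟨_, ((AddCircle.equivIoc L 0) x).2, (AddCircle.equivIoc L 0).symm_apply_apply x⟩
    rw [AddCircle.liftIoc_coe_apply ha]
  have hd : ∀ x : ℝ, HasDerivAt (fun x : ℝ => ((f (x : AddCircle L) i : ℝ) : ℂ))
      ((f.deriv (x : AddCircle L) i : ℝ) : ℂ) x := fun x =>
    ((EuclideanSpace.proj (𝕜 := ℝ) i).hasFDerivAt.comp_hasDerivAt x (f.hasDerivAt x)).ofReal_comp
  have hc : Continuous fun x : ℝ => ((f.deriv (x : AddCircle L) i : ℝ) : ℂ) :=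
    Complex.continuous_ofReal.comp
      ((EuclideanSpace.proj (𝕜 := ℝ) i).continuous.comp f.deriv.smooth.continuous)
  have h := fourierCoeffOn_of_hasDerivAt (lt_add_of_pos_right (0 : ℝ) hL) hκ
    (fun x _ => hd x) (hc.intervalIntegrable _ _)
  have hp : ((0 + L : ℝ) : AddCircle L) = ((0 : ℝ) : AddCircle L) := by
    rw [zero_add, AddCircle.coe_period, QuotientAddGroup.mk_zero]
  rw [hlift f, h, hlift f.deriv]
  simp only [hp, sub_self, mul_zero, zero_sub, norm_mul, norm_neg, norm_div, norm_one,
    Complex.norm_real, Complex.norm_I, Complex.norm_intCast, Complex.norm_ofNat]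
  have e : ‖((0 + L : ℝ) : ℂ) - ((0 : ℝ) : ℂ)‖ = L := by
    rw [zero_add, Complex.ofReal_zero, sub_zero, Complex.norm_real, Real.norm_of_nonneg hL.le]
  rw [e, Real.norm_of_nonneg Real.pi_pos.le]
  field_simp

lemma SmoothPer.fcoef_bound (f : SmoothPer L) : ∃ C : ℝ, ∀ κ i, ‖fcoef f κ i‖ ≤ C := by
  obtain ⟨C, hC⟩ := isCompact_univ.exists_bound_of_continuousOn f.continuous.continuousOn
  refine ⟨C, fun κ i => ?_⟩
  have h := norm_integral_le_of_norm_le_const (μ := (AddCircle.haarAddCircle : Measure (AddCircle L)))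
    (f := fun t : AddCircle L => fourier (-κ) t • ((f t i : ℝ) : ℂ)) (C := C)
    (Eventually.of_forall fun x => by
      rw [norm_smul, fourier_apply, Circle.norm_coe, one_mul, Complex.norm_real]
      exact (PiLp.norm_apply_le (f x) i).trans (hC x (mem_univ x)))
  simpa [fcoef, fourierCoeff] using h

lemma SmoothPer.fcoef_decay (n : ℕ) : ∀ f : SmoothPer L,
    ∃ C : ℝ, ∀ κ : ℤ, κ ≠ 0 → ∀ i, ‖fcoef f κ i‖ ≤ C / |(κ : ℝ)| ^ n := by
  have hL : (0 : ℝ) < L := Fact.out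
  induction n with
  | zero =>
    intro f
    obtain ⟨C, hC⟩ := f.fcoef_bound
    exact ⟨C, fun κ _ i => by simpa using hC κ i⟩
  | succ n ih =>
    intro f
    obtain ⟨C, hC⟩ := ih f.deriv
    refine ⟨L / (2 * Real.pi) * C, fun κ hκ i => ?_⟩
    have h0 : (0 : ℝ) < |(κ : ℝ)| := by positivity
    rw [f.fcoef_deriv hκ i]
    calc L / (2 * Real.pi * |(κ : ℝ)|) * ‖fcoef f.deriv κ i‖
        ≤ L / (2 * Real.pi * |(κ : ℝ)|) * (C / |(κ : ℝ)| ^ n) := by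
          gcongr
          exact hC κ hκ i
      _ = L / (2 * Real.pi) * C / |(κ : ℝ)| ^ (n + 1) := by
          rw [pow_succ]
          field_simp

lemma SmoothPer.inSobolev (f : SmoothPer L) (r : ℝ) : InSobolev r (f : AddCircle L → Plane) := by
  obtain ⟨k, hk⟩ := exists_nat_ge |r|
  obtain ⟨C, hC⟩ := SmoothPer.fcoef_decay (k + 1) f
  have hs : Summable fun κ : ℤ => 2 ^ k * (2 * C ^ 2) * (1 / (κ : ℝ) ^ 2) :=
    (Real.summable_one_div_int_pow.2 (by norm_num)).mul_left _
  refine Summable.of_norm_bounded_eventually hs ?_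
  have hf : ∀ᶠ κ : ℤ in cofinite, κ ≠ 0 := by
    rw [eventually_cofinite]
    simp
  filter_upwards [hf] with κ hκ
  have h1 : (1 : ℝ) ≤ (κ : ℝ) ^ 2 := by
    have : (1 : ℤ) ≤ κ ^ 2 := by
      have := sq_nonneg κ
      have h2 : κ ^ 2 ≠ 0 := pow_ne_zero 2 hκ
      omega
    exact_mod_cast this
  have hpos : (0 : ℝ) ≤ 1 + (κ : ℝ) ^ 2 := by positivity
  have hw : (1 + (κ : ℝ) ^ 2) ^ r ≤ 2 ^ k * ((κ : ℝ) ^ 2) ^ k := by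
    calc (1 + (κ : ℝ) ^ 2) ^ r ≤ (1 + (κ : ℝ) ^ 2) ^ (k : ℝ) :=
          Real.rpow_le_rpow_of_exponent_le (by linarith) ((le_abs_self r).trans hk)
      _ = (1 + (κ : ℝ) ^ 2) ^ k := Real.rpow_natCast _ _
      _ ≤ (2 * (κ : ℝ) ^ 2) ^ k := by gcongr; linarith
      _ = 2 ^ k * ((κ : ℝ) ^ 2) ^ k := mul_pow _ _ _
  have hc : ∑ i, ‖fcoef f κ i‖ ^ 2 ≤ 2 * C ^ 2 / ((κ : ℝ) ^ 2) ^ (k + 1) := by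
    have hi : ∀ i, ‖fcoef f κ i‖ ^ 2 ≤ C ^ 2 / ((κ : ℝ) ^ 2) ^ (k + 1) := by
      intro i
      calc ‖fcoef f κ i‖ ^ 2 ≤ (C / |(κ : ℝ)| ^ (k + 1)) ^ 2 := by
            gcongr
            exact hC κ hκ i
        _ = C ^ 2 / ((κ : ℝ) ^ 2) ^ (k + 1) := by
            rw [div_pow, ← pow_mul, mul_comm (k + 1) 2, pow_mul, sq_abs]
    rw [Fin.sum_univ_two]
    have := hi 0
    have := hi 1
    linarith [show 2 * C ^ 2 / ((κ : ℝ) ^ 2) ^ (k + 1) = C ^ 2 / ((κ : ℝ) ^ 2) ^ (k + 1)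
      + C ^ 2 / ((κ : ℝ) ^ 2) ^ (k + 1) by ring]
  have hk0 : (0 : ℝ) < (κ : ℝ) ^ 2 := by linarith
  rw [Real.norm_of_nonneg (by positivity)]
  calc (1 + (κ : ℝ) ^ 2) ^ r * ∑ i, ‖fcoef f κ i‖ ^ 2
      ≤ (2 ^ k * ((κ : ℝ) ^ 2) ^ k) * (2 * C ^ 2 / ((κ : ℝ) ^ 2) ^ (k + 1)) := by gcongr
    _ = 2 ^ k * (2 * C ^ 2) * (1 / (κ : ℝ) ^ 2) := by
        rw [pow_succ]
        field_simp
        ring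

lemma SmoothPer.memLp (f : SmoothPer L) :
    MemLp (f : AddCircle L → Plane) 2 (volume : Measure (AddCircle L)) := by
  obtain ⟨C, hC⟩ := isCompact_univ.exists_bound_of_continuousOn f.continuous.continuousOn
  exact MemLp.of_bound f.continuous.aestronglyMeasurable C
    (Eventually.of_forall fun x => hC x (mem_univ x))

/-- A smooth periodic function as an element of `L² × L²`. -/
def SmoothPer.toL2 (f : SmoothPer L) : L2per L := f.memLp.toLp f

/-- A smooth periodic function as an element of `H^r × H^r`. -/
def SmoothPer.toHper (r : ℝ) (f : SmoothPer L) : Hper L r :=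
  ⟨f.toL2, by
    change InSobolev r (f.toL2 : AddCircle L → Plane)
    have h := f.inSobolev r
    unfold InSobolev at h ⊢
    rwa [SmoothPer.toL2, fcoef_congr f.memLp.coeFn_toLp]⟩

end Smooth

/-! ### The dispersion operator, the energy and the linearized operator -/

section Operators

/-- The conditions on the symbol `m` of the dispersion operator: `m(κ)` is a real symmetric
matrix, even in `κ`, and `c₁|κ|^s ≤ ⟨m(κ)w,w⟩ ≤ c₂|κ|^s` for all unit vectors `w`. -/
structure IsSymbol (m : ℤ → Matrix (Fin 2) (Fin 2) ℝ) (s : ℝ) : Prop where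
  symm : ∀ κ, (m κ).IsSymm
  even : ∀ κ, m (-κ) = m κ
  elliptic : ∃ c₁ c₂ : ℝ, 0 < c₁ ∧ 0 < c₂ ∧ ∀ (κ : ℤ) (w : Plane), ‖w‖ = 1 →
    c₁ * |(κ : ℝ)| ^ s ≤ ∑ i, ∑ j, m κ i j * w j * w i ∧
      ∑ i, ∑ j, m κ i j * w j * w i ≤ c₂ * |(κ : ℝ)| ^ s

variable {L : ℝ} [Fact (0 < L)]

/-- `𝓜 f = g`, where `𝓜` is the matrix Fourier multiplier with symbol `m`:
`ĝᵢ(κ) = ∑ⱼ mᵢⱼ(κ) f̂ⱼ(κ)` for all `κ ∈ ℤ`. -/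
def IsDispersion (m : ℤ → Matrix (Fin 2) (Fin 2) ℝ) (f g : AddCircle L → Plane) : Prop :=
  ∀ (κ : ℤ) (i : Fin 2), fcoef g κ i = ∑ j, (m κ i j : ℂ) * fcoef f κ j

/-- The bilinear form `⟨𝓜f, g⟩ = ∫₀ᴸ ⟨𝓜f, g⟩ dx` on the energy space, written through Parseval's
identity: `L ∑_κ Re ⟨m(κ) f̂(κ), ĝ(κ)⟩`. -/
def dispersionForm (m : ℤ → Matrix (Fin 2) (Fin 2) ℝ) (f g : AddCircle L → Plane) : ℝ :=
  L * ∑' κ : ℤ, ∑ i, ∑ j, m κ i j * (fcoef f κ j * starRingEnd ℂ (fcoef g κ i)).re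

/-- The energy `E(u) = ∫₀ᴸ (½⟨𝓜u,u⟩ - R(u)) dx`. -/
def energy (R : Plane → ℝ) (m : ℤ → Matrix (Fin 2) (Fin 2) ℝ) (u : AddCircle L → Plane) : ℝ :=
  1 / 2 * dispersionForm m u u - ∫ x, R (u x)

/-- The momentum `F(u) = ½ ∫₀ᴸ ⟨u,u⟩ dx`. -/
def momentum (u : AddCircle L → Plane) : ℝ := 1 / 2 * ∫ x, inner ℝ (u x) (u x)

/-- The Hessian of `R` at `p`, as a linear map of `ℝ²`. -/
def hessian (R : Plane → ℝ) (p : Plane) : Plane →L[ℝ] Plane := fderiv ℝ (gradient R) p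

/-- `𝓜φ + cφ - ∇R(φ) + A = 0`. -/
def IsTravellingWave (R : Plane → ℝ) (m : ℤ → Matrix (Fin 2) (Fin 2) ℝ) (c : ℝ) (A : Plane)
    (φ : SmoothPer L) : Prop :=
  IsDispersion m φ fun x => gradient R (φ x) - c • φ x - A

/-- `f` lies in the domain `H^s × H^s` of `𝓛 = 𝓜 + c Id - Hess R(φ)` and `𝓛 f = μ f`. -/
def SatisfiesEigen (R : Plane → ℝ) (m : ℤ → Matrix (Fin 2) (Fin 2) ℝ) (s c : ℝ) (φ : SmoothPer L)
    (μ : ℝ) (f : L2per L) : Prop :=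
  InSobolev s (f : AddCircle L → Plane) ∧
    IsDispersion m f fun x => μ • f x - c • f x + hessian R (φ x) (f x)

/-- `μ` is a simple eigenvalue of `𝓛` with eigenfunction `χ`. -/
def IsSimpleEigen (R : Plane → ℝ) (m : ℤ → Matrix (Fin 2) (Fin 2) ℝ) (s c : ℝ) (φ : SmoothPer L)
    (μ : ℝ) (χ : L2per L) : Prop :=
  χ ≠ 0 ∧ SatisfiesEigen R m s c φ μ χ ∧
    ∀ f, SatisfiesEigen R m s c φ μ f → ∃ a : ℝ, f = a • χ

/-- `𝓛` has exactly one negative eigenvalue, which is simple, and zero is a simple eigenvalue with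
eigenfunction `φ'`. -/
def SpectralCondition (R : Plane → ℝ) (m : ℤ → Matrix (Fin 2) (Fin 2) ℝ) (s c : ℝ)
    (φ : SmoothPer L) : Prop :=
  (∃ μ₀ : ℝ, μ₀ < 0 ∧ (∃ χ, IsSimpleEigen R m s c φ μ₀ χ) ∧
    ∀ μ : ℝ, μ < 0 → ∀ f, f ≠ 0 → SatisfiesEigen R m s c φ μ f → μ = μ₀) ∧
  IsSimpleEigen R m s c φ 0 φ.deriv.toL2

/-- The form `⟨𝓛f, g⟩` of the linearized operator `𝓛 = 𝓜 + c Id - Hess R(φ)` on the energy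
space. -/
def linForm (R : Plane → ℝ) (m : ℤ → Matrix (Fin 2) (Fin 2) ℝ) (c : ℝ) (φ : SmoothPer L)
    (f g : AddCircle L → Plane) : ℝ :=
  dispersionForm m f g + c * (∫ x, inner ℝ (f x) (g x))
    - ∫ x, inner ℝ (hessian R (φ x) (f x)) (g x)

end Operators

/-! ### The flow and orbital stability -/

section Flow

variable {L : ℝ} [Fact (0 < L)]

/-- `u ∈ C([0,∞); H^{s/2} × H^{s/2})` is a global solution of `∂ₜu + ∂ₓ(∇R(u) - 𝓜u) = 0`, in the
weak form
`⟨u(t),η⟩ - ⟨u(0),η⟩ = ∫₀ᵗ ⟨∇R(u(τ)) - 𝓜u(τ), η'⟩ dτ` for all `t ≥ 0` and smooth periodic `η`. -/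
structure IsGlobalSolution (R : Plane → ℝ) (m : ℤ → Matrix (Fin 2) (Fin 2) ℝ) {s : ℝ}
    (u : ℝ → Hper L (s / 2)) : Prop where
  continuousOn : ContinuousOn u (Ici 0)
  integrable : ∀ t, 0 ≤ t → Integrable fun x => gradient R (u t x)
  intervalIntegrable : ∀ (η : SmoothPer L) (t : ℝ), 0 ≤ t → IntervalIntegrable
    (fun τ => (∫ x, inner ℝ (gradient R (u τ x)) (η.deriv x)) - dispersionForm m (u τ) η.deriv)
    volume 0 t
  weak : ∀ (η : SmoothPer L) (t : ℝ), 0 ≤ t →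
    (∫ x, inner ℝ (u t x) (η x)) - (∫ x, inner ℝ (u 0 x) (η x)) =
      ∫ τ in (0 : ℝ)..t,
        ((∫ x, inner ℝ (gradient R (u τ x)) (η.deriv x)) - dispersionForm m (u τ) η.deriv)

/-- A flow of the Cauchy problem on the energy space: it assigns to every initial datum `u₀` a
global solution `t ↦ S t u₀`. When the Cauchy problem is globally well-posed, `S t u₀` is the
value at time `t` of the solution with initial datum `u₀`. -/
structure GlobalFlow (R : Plane → ℝ) (m : ℤ → Matrix (Fin 2) (Fin 2) ℝ) (L : ℝ) [Fact (0 < L)]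
    (s : ℝ) where
  toFun : ℝ → Hper L (s / 2) → Hper L (s / 2)
  initial : ∀ u₀, toFun 0 u₀ = u₀
  solution : ∀ u₀, IsGlobalSolution R m fun t => toFun t u₀

variable {R : Plane → ℝ} {m : ℤ → Matrix (Fin 2) (Fin 2) ℝ} {s : ℝ}

/-- The functional `Q` is constant along the flow. -/
def GlobalFlow.Conserves (S : GlobalFlow R m L s) (Q : Hper L (s / 2) → ℝ) : Prop :=
  ∀ u₀ t, 0 ≤ t → Q (S.toFun t u₀) = Q u₀

/-- Orbital stability of `φ` in the energy space by the flow: for data close to `φ` the solution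
exists globally and stays close to the orbit of `φ` under translations. -/
def GlobalFlow.OrbitallyStable (S : GlobalFlow R m L s) (φ : Hper L (s / 2)) : Prop :=
  ∀ ε > 0, ∃ δ > 0, ∀ u₀ : Hper L (s / 2), ‖u₀ - φ‖ < δ →
    IsGlobalSolution R m (fun t => S.toFun t u₀) ∧ S.toFun 0 u₀ = u₀ ∧
      ∀ t, 0 ≤ t → rho (S.toFun t u₀) φ < ε

end Flow

end DispersiveSystem

end

/-!
The action `Λ = E + cF + ∫ ⟨u, A⟩` is conserved (the mean is, as one sees by testing the equation
against constants), and `φ` is a critical point of it whose second variation is `𝓛`. This form has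
a single negative direction, and `⟨𝓛Φ, Φ⟩ < 0` means that `⟨𝓛Φ, ·⟩` detects it: for large `N` the
form `𝓛 + N ⟨𝓛Φ, ·⟩²` is coercive on the orthogonal complement of `φ'` in the energy space. Since
`Q'(φ) = 𝓛Φ`, it is the second variation at `φ` of `Λ + (N / 2) (Q - Q(φ))²`, a conserved and
translation invariant functional, which therefore serves as a Lyapunov function: the translate of
`u(t)` nearest to `φ` differs from `φ` by a function orthogonal to `φ'`, so that `ρ(u(t), φ)` cannot
cross small values.

For `s ≤ 1` functions of the energy space need not be bounded, and the second derivative of `∫ R(u)`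
is identified on the dense subspace of bounded functions only.
-/

noncomputable section

namespace DispersiveSystem

section QuadraticForms

section Algebra

variable {V : Type*} [AddCommGroup V] [Module ℝ V] {B : LinearMap.BilinForm ℝ V}

lemma apply_eq_zero_of_apply_self_eq_zero (hB : ∀ u v, B u v = B v u) (hnn : ∀ v, 0 ≤ B v v)
    {v : V} (hv : B v v = 0) (w : V) : B v w = 0 := by
  have h := B.apply_mul_apply_le_of_forall_zero_le hnn v w
  rw [hB w v, hv, zero_mul] at h
  exact mul_self_eq_zero.1 (le_antisymm h (mul_self_nonneg _))

lemma apply_self_nonneg_of_orthogonal_of_neg (hB : ∀ u v, B u v = B v u) {l : V →ₗ[ℝ] ℝ}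
    (hnn : ∀ v, l v = 0 → 0 ≤ B v v) {Φ : V} (hΦ : B Φ Φ < 0) {w : V} (hw : B Φ w = 0) :
    0 ≤ B w w := by
  have hlΦ : l Φ ≠ 0 := fun h => (hnn Φ h).not_gt hΦ
  have h := hnn (w - (l w / l Φ) • Φ) (by simp [div_mul_cancel₀ _ hlΦ])
  simp only [map_sub, map_smul, LinearMap.sub_apply, LinearMap.smul_apply, smul_eq_mul, hB w Φ,
    hw] at h
  nlinarith [sq_nonneg (l w / l Φ)]

lemma apply_self_mul_apply_self_le_sq (hB : ∀ u v, B u v = B v u) {Φ : V} (hΦ : B Φ Φ < 0)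
    (hnn : ∀ w, B Φ w = 0 → 0 ≤ B w w) (v : V) : B Φ Φ * B v v ≤ B Φ v ^ 2 := by
  set t := B Φ v / B Φ Φ
  have ht : t * B Φ Φ = B Φ v := div_mul_cancel₀ _ hΦ.ne
  have h := hnn (v - t • Φ) (by rw [map_sub, map_smul, smul_eq_mul, ht, sub_self])
  simp only [map_sub, map_smul, LinearMap.sub_apply, LinearMap.smul_apply, smul_eq_mul, hB v Φ,
    ht, sub_self, mul_zero, sub_zero] at h
  calc B Φ Φ * B v v ≤ B Φ Φ * (t * B Φ v) := mul_le_mul_of_nonpos_left (by linarith) hΦ.le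
    _ = B Φ v ^ 2 := by rw [← mul_assoc, mul_comm _ t, ht, sq]

end Algebra

variable {X W : Type*} [NormedAddCommGroup X] [NormedSpace ℝ X] [NormedAddCommGroup W]
  [NormedSpace ℝ W] {B J P : X →L[ℝ] X →L[ℝ] ℝ} {π : X →L[ℝ] W}

/-- Gårding's inequality for the form `P`: it is coercive up to a multiple of `‖π v‖²`. For `π` of
finite rank this replaces the compactness of lower order terms. -/
def SatisfiesGarding (P : X →L[ℝ] X →L[ℝ] ℝ) (π : X →L[ℝ] W) : Prop :=
  ∃ α > 0, ∃ C, ∀ v, α * ‖v‖ ^ 2 ≤ P v v + C * ‖π v‖ ^ 2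

lemma SatisfiesGarding.mono (hG : SatisfiesGarding B π) (hle : ∀ v, B v v ≤ P v v) :
    SatisfiesGarding P π := by
  obtain ⟨α, hα, C, h⟩ := hG
  exact ⟨α, hα, C, fun v => (h v).trans (by linarith [hle v])⟩

lemma SatisfiesGarding.restrict (hG : SatisfiesGarding P π) (Y : Submodule ℝ X) :
    SatisfiesGarding (P.bilinearComp Y.subtypeL Y.subtypeL) (π ∘L Y.subtypeL) := by
  obtain ⟨α, hα, C, h⟩ := hG
  exact ⟨α, hα, C, fun v => h v⟩

lemma SatisfiesGarding.cauchySeq (hG : SatisfiesGarding P π) (hnn : ∀ v, 0 ≤ P v v) {x : ℕ → X}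
    (hx : Tendsto (fun n => P (x n) (x n)) atTop (𝓝 0)) (hπ : CauchySeq fun n => π (x n)) :
    CauchySeq x := by
  obtain ⟨α, hα, C, hG⟩ := hG
  rw [cauchySeq_iff_tendsto_dist_atTop_0] at hπ ⊢
  have hbound (n : ℕ × ℕ) : α * dist (x n.1) (x n.2) ^ 2 ≤ 2 * P (x n.1) (x n.1) +
      2 * P (x n.2) (x n.2) + C * dist (π (x n.1)) (π (x n.2)) ^ 2 := by
    have hadd := hnn (x n.1 + x n.2)
    have hsub := hG (x n.1 - x n.2)
    rw [map_sub π] at hsub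
    simp only [map_add, map_sub, add_apply, sub_apply] at hadd hsub
    rw [dist_eq_norm, dist_eq_norm]
    linarith
  have hfst : Tendsto (fun n : ℕ × ℕ => P (x n.1) (x n.1)) atTop (𝓝 0) :=
    hx.comp (prod_atTop_atTop_eq (α := ℕ) (β := ℕ) ▸ tendsto_fst)
  have hsnd : Tendsto (fun n : ℕ × ℕ => P (x n.2) (x n.2)) atTop (𝓝 0) :=
    hx.comp (prod_atTop_atTop_eq (α := ℕ) (β := ℕ) ▸ tendsto_snd)
  have hsq : Tendsto (fun n : ℕ × ℕ => α * dist (x n.1) (x n.2) ^ 2) atTop (𝓝 0) :=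
    squeeze_zero (fun _ => by positivity) hbound <| by
      simpa using ((hfst.const_mul 2).add (hsnd.const_mul 2)).add ((hπ.pow 2).const_mul C)
  have hdist := (hsq.const_mul α⁻¹).sqrt
  simpa only [inv_mul_cancel_left₀ hα.ne', Real.sqrt_sq dist_nonneg, mul_zero, Real.sqrt_zero]
    using hdist

lemma exists_unit_seq_tendsto_zero (hnn : ∀ v, 0 ≤ P v v)
    (h : ¬∃ δ > 0, ∀ v, δ * ‖v‖ ^ 2 ≤ P v v) :
    ∃ x : ℕ → X, (∀ n, ‖x n‖ = 1) ∧ Tendsto (fun n => P (x n) (x n)) atTop (𝓝 0) := by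
  push Not at h
  have hunit (n : ℕ) : ∃ v, ‖v‖ = 1 ∧ P v v ≤ 1 / ((n : ℝ) + 1) := by
    obtain ⟨v, hlt⟩ := h (1 / ((n : ℝ) + 1)) (by positivity)
    have hv : 0 < ‖v‖ := norm_pos_iff.2 (by rintro rfl; simp at hlt)
    refine ⟨‖v‖⁻¹ • v, by rw [norm_smul, norm_inv, norm_norm, inv_mul_cancel₀ hv.ne'], ?_⟩
    simp only [map_smul, smul_apply, smul_eq_mul]
    rw [← mul_assoc, ← pow_two, inv_pow, inv_mul_le_iff₀ (by positivity), mul_comm]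
    exact hlt.le
  choose x hx1 hxP using hunit
  exact ⟨x, hx1, squeeze_zero (fun n => hnn _) hxP tendsto_one_div_add_atTop_nhds_zero_nat⟩

lemma SatisfiesGarding.exists_coercive_of_nonneg [CompleteSpace X] [FiniteDimensional ℝ W]
    (hG : SatisfiesGarding P π) (hP : ∀ u v, P u v = P v u) (hnn : ∀ v, 0 ≤ P v v)
    (hker : ∀ v, (∀ w, P v w = 0) → v = 0) : ∃ δ > 0, ∀ v, δ * ‖v‖ ^ 2 ≤ P v v := by
  by_contra hcon
  obtain ⟨x, hx1, hxP⟩ := exists_unit_seq_tendsto_zero hnn hcon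
  have : ProperSpace W := FiniteDimensional.proper ℝ W
  have hπ (n : ℕ) : π (x n) ∈ Metric.closedBall (0 : W) ‖π‖ := by
    simpa [hx1] using π.le_opNorm (x n)
  obtain ⟨a, -, σ, hσ, hlim⟩ := (isCompact_closedBall (0 : W) ‖π‖).tendsto_subseq hπ
  have hPσ := hxP.comp hσ.tendsto_atTop
  obtain ⟨v, hv⟩ := cauchySeq_tendsto_of_complete
    (hG.cauchySeq (x := x ∘ σ) hnn hPσ hlim.cauchySeq)
  have hv1 : ‖v‖ = 1 := tendsto_nhds_unique hv.norm (by simp [hx1])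
  have hPcont : Continuous fun v => P v v := P.continuous.clm_apply continuous_id
  have hPv : P v v = 0 := tendsto_nhds_unique ((hPcont.tendsto v).comp hv) hPσ
  have hv0 : v = 0 := hker v (apply_eq_zero_of_apply_self_eq_zero (B := P.toBilinForm) hP hnn hPv)
  simp [hv0] at hv1

/-- `z` is an eigenvector, with eigenvalue `μ`, of the form `B` relative to the form `J`. For the
quadratic form of an operator and the `L²` product, this is the weak eigenvalue equation. -/
def IsRelEigenvector (B J : X →L[ℝ] X →L[ℝ] ℝ) (μ : ℝ) (z : X) : Prop :=
  z ≠ 0 ∧ ∀ w, B z w = μ * J z w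

lemma exists_neg_isRelEigenvector [CompleteSpace X] [FiniteDimensional ℝ W]
    (hG : SatisfiesGarding B π) (hB : ∀ u v, B u v = B v u) (hJ : ∀ u v, J u v = J v u)
    (hJpos : ∀ v ≠ 0, 0 < J v v) {K : ℝ} (hK : ∀ v, -K * J v v ≤ B v v) {v : X}
    (hneg : B v v < 0) : ∃ μ < 0, ∃ z, IsRelEigenvector B J μ z := by
  have hv0 : v ≠ 0 := by
    rintro rfl
    simp at hneg
  have : Nonempty {w : X // w ≠ 0} := ⟨⟨v, hv0⟩⟩
  have hJnn (w : X) : 0 ≤ J w w := by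
    rcases eq_or_ne w 0 with rfl | hw
    · simp
    · exact (hJpos w hw).le
  have hbdd : BddBelow (range fun w : {w : X // w ≠ 0} => B w w / J w w) :=
    ⟨-K, forall_mem_range.2 fun w => (le_div_iff₀ (hJpos w w.2)).2 (hK w)⟩
  set μ := ⨅ w : {w : X // w ≠ 0}, B w w / J w w
  have hμ : μ < 0 := (ciInf_le hbdd ⟨v, hv0⟩).trans_lt (div_neg_of_neg_of_pos hneg (hJpos v hv0))
  have hμle (w : X) : μ * J w w ≤ B w w := by
    rcases eq_or_ne w 0 with rfl | hw
    · simp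
    · exact (le_div_iff₀ (hJpos w hw)).1 (ciInf_le hbdd ⟨w, hw⟩)
  refine ⟨μ, hμ, ?_⟩
  by_contra! hnone
  -- If `μ` is not attained, `B - μJ` is coercive, and `μ` could be increased.
  obtain ⟨δ, hδ, hco⟩ := (hG.mono (P := B - μ • J) fun w => by
      simp only [sub_apply, smul_apply, smul_eq_mul]
      nlinarith [hJnn w]).exists_coercive_of_nonneg
    (fun u w => by simp only [sub_apply, smul_apply, hB u w, hJ u w])
    (fun w => by simpa using hμle w)
    (fun z hz => by_contra fun hz0 => hnone z ⟨hz0, fun w => by simpa [sub_eq_zero] using hz w⟩)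
  have hincr : μ + δ / (‖J‖ + 1) ≤ μ := le_ciInf fun w => by
    rw [le_div_iff₀ (hJpos w w.2), add_mul, div_mul_eq_mul_div]
    have hJle : J w w ≤ (‖J‖ + 1) * ‖(w : X)‖ ^ 2 := by
      have := (le_abs_self _).trans (J.le_opNorm₂ w w)
      nlinarith [sq_nonneg ‖(w : X)‖]
    have hδJ : δ * J w w / (‖J‖ + 1) ≤ δ * ‖(w : X)‖ ^ 2 := by
      rw [div_le_iff₀ (by positivity), mul_assoc, mul_comm (‖(w : X)‖ ^ 2)]
      gcongr
    have hw := hco w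
    simp only [sub_apply, smul_apply, smul_eq_mul] at hw
    linarith
  have : 0 < δ / (‖J‖ + 1) := by positivity
  linarith

lemma apply_self_nonneg_of_orthogonal_ground_state [CompleteSpace X] [FiniteDimensional ℝ W]
    (hG : SatisfiesGarding B π) (hB : ∀ u v, B u v = B v u) (hJ : ∀ u v, J u v = J v u)
    (hJpos : ∀ v ≠ 0, 0 < J v v) {K : ℝ} (hK : ∀ v, -K * J v v ≤ B v v) {μ₀ : ℝ} {χ : X}
    (hχ : IsRelEigenvector B J μ₀ χ)
    (hsimple : ∀ μ < 0, ∀ z, IsRelEigenvector B J μ z → ∃ a : ℝ, z = a • χ) {v : X}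
    (hv : J χ v = 0) : 0 ≤ B v v := by
  by_contra! hneg
  have hJχ := hJpos χ hχ.1
  set Y := (J χ).ker
  have : CompleteSpace Y := (J χ).isClosed_ker.completeSpace_coe
  obtain ⟨μ, hμ, ⟨z, hzY⟩, hz0, hz⟩ := exists_neg_isRelEigenvector (hG.restrict Y)
    (J := J.bilinearComp Y.subtypeL Y.subtypeL) (fun u w => hB u w) (fun u w => hJ u w)
    (fun w hw => hJpos w (by simpa using hw)) (fun w => hK w) (v := ⟨v, hv⟩) hneg
  have hzχ : J χ z = 0 := hzY
  have hzeq (w : X) : B z w = μ * J z w := by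
    have hproj : J χ (w - (J χ w / J χ χ) • χ) = 0 := by
      rw [map_sub, map_smul, smul_eq_mul, div_mul_cancel₀ _ hJχ.ne', sub_self]
    have hBχ : B z χ = 0 := by rw [hB, hχ.2, hzχ, mul_zero]
    have hJχ : J z χ = 0 := by rw [hJ, hzχ]
    simpa [hBχ, hJχ] using hz ⟨_, hproj⟩
  obtain ⟨a, rfl⟩ := hsimple μ hμ z ⟨by simpa using hz0, hzeq⟩
  rw [map_smul, smul_eq_mul] at hzχ
  rcases mul_eq_zero.1 hzχ with rfl | h
  · simp at hz0
  · exact hJχ.ne' h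

lemma exists_coercive_penalization [CompleteSpace X] [FiniteDimensional ℝ W]
    (hG : SatisfiesGarding B π) (hB : ∀ u v, B u v = B v u) {Φ : X} (hΦ : B Φ Φ < 0)
    (hnn : ∀ w, B Φ w = 0 → 0 ≤ B w w) {ψ : X} (hker : ∀ v, (∀ w, B v w = 0) → ∃ a : ℝ, v = a • ψ)
    {l : X →L[ℝ] ℝ} (hl : l ψ ≠ 0) :
    ∃ N δ : ℝ, 0 < δ ∧ ∀ v, l v = 0 → δ * ‖v‖ ^ 2 ≤ B v v + N * B Φ v ^ 2 := by
  -- Reverse Cauchy–Schwarz gives `B v v ≥ -B(Φ,v)² / d`, so `N = 2 / d` leaves room to spare.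
  set d := -B Φ Φ with hd
  have hd0 : 0 < d := neg_pos.2 hΦ
  set P : X →L[ℝ] X →L[ℝ] ℝ := B + (2 / d) • (B Φ).smulRight (B Φ)
  have hPapply (u w : X) : P u w = B u w + 2 / d * (B Φ u * B Φ w) := rfl
  have hPsymm (u w : X) : P u w = P w u := by rw [hPapply, hPapply, hB u w, mul_comm (B Φ u)]
  have hPlow (v : X) : B Φ v ^ 2 ≤ d * P v v := by
    have h := apply_self_mul_apply_self_le_sq (B := B.toBilinForm) hB hΦ hnn v
    have h' : B Φ Φ * B v v ≤ B Φ v ^ 2 := h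
    have e : d * P v v = 2 * B Φ v ^ 2 - B Φ Φ * B v v := by
      rw [hPapply]
      field_simp
      rw [hd]
      ring
    linarith
  have hPnn (v : X) : 0 ≤ P v v := nonneg_of_mul_nonneg_right ((sq_nonneg _).trans (hPlow v)) hd0
  have hGP : SatisfiesGarding P π := hG.mono fun v => by
    have : 0 ≤ 2 / d * (B Φ v * B Φ v) := mul_nonneg (by positivity) (mul_self_nonneg _)
    linarith [hPapply v v]
  have hPker (v : X) (hlv : l v = 0) (hPv : P v v = 0) : v = 0 := by
    have hBΦ : B Φ v = 0 := by
      have h := hPlow v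
      rw [hPv, mul_zero] at h
      exact pow_eq_zero_iff two_ne_zero |>.1 (le_antisymm h (sq_nonneg _))
    have hall := apply_eq_zero_of_apply_self_eq_zero (B := P.toBilinForm) hPsymm hPnn hPv
    obtain ⟨a, rfl⟩ := hker v fun w => by
      have hw : P v w = 0 := hall w
      simpa [hPapply, hBΦ] using hw
    have ha : a = 0 := by simpa [hl] using hlv
    rw [ha, zero_smul]
  have : CompleteSpace l.ker := l.isClosed_ker.completeSpace_coe
  obtain ⟨δ, hδ, hco⟩ := (hGP.restrict l.ker).exists_coercive_of_nonneg
    (fun u w => hPsymm u w) (fun v => hPnn v)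
    (fun v hv => Subtype.ext (hPker v v.2 (hv v)))
  refine ⟨2 / d, δ, hδ, fun v hv => ?_⟩
  have h : δ * ‖v‖ ^ 2 ≤ P v v := hco ⟨v, hv⟩
  simpa only [hPapply, ← pow_two] using h

end QuadraticForms

section Taylor

variable {E : Type*} [NormedAddCommGroup E] [NormedSpace ℝ E]

/-- Second-order Taylor expansion `f (p + v) = f p + A v + ½ B(v, v) + o(‖v‖²)`. The point `p` is
critical when `A = 0`, and `B` is then the second variation of `f`. -/
def HasTaylorTwo (f : E → ℝ) (A : E →L[ℝ] ℝ) (B : E →L[ℝ] E →L[ℝ] ℝ) (p : E) : Prop :=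
  (fun v => f (p + v) - f p - A v - 1 / 2 * B v v) =o[𝓝 0] fun v => ‖v‖ ^ 2

lemma HasTaylorTwo.continuousAt {f : E → ℝ} {A : E →L[ℝ] ℝ} {B : E →L[ℝ] E →L[ℝ] ℝ} {p : E}
    (h : HasTaylorTwo f A B p) : ContinuousAt f p := by
  have hsq : Tendsto (fun v : E => ‖v‖ ^ 2) (𝓝 0) (𝓝 0) := by
    have : Continuous fun v : E => ‖v‖ ^ 2 := by fun_prop
    simpa using this.tendsto 0
  have hpoly : Tendsto (fun v => f p + A v + 1 / 2 * B v v) (𝓝 0) (𝓝 (f p)) := by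
    have : Continuous fun v => f p + A v + 1 / 2 * B v v := by fun_prop
    simpa using this.tendsto 0
  rw [ContinuousAt, ← map_add_left_nhds_zero, tendsto_map'_iff]
  simpa [Function.comp_def] using (h.trans_tendsto hsq).add hpoly

lemma HasTaylorTwo.quadratic_sub {f : E → ℝ} {A : E →L[ℝ] ℝ} {B : E →L[ℝ] E →L[ℝ] ℝ} {p : E}
    (h : HasTaylorTwo f A B p) {K : E →L[ℝ] E →L[ℝ] ℝ} (hK : ∀ v w, K v w = K w v)
    (ℓ : E →L[ℝ] ℝ) :
    HasTaylorTwo (fun u => 1 / 2 * K u u + ℓ u - f u) (K p + ℓ - A) (K - B) p := by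
  refine h.neg_left.congr_left fun v => ?_
  simp only [map_add, add_apply, sub_apply, hK v p]
  ring

lemma HasTaylorTwo.add_sq {f Q : E → ℝ} {A q : E →L[ℝ] ℝ} {B : E →L[ℝ] E →L[ℝ] ℝ} {p : E}
    (h : HasTaylorTwo f A B p) (hQ : HasFDerivAt Q q p) (N : ℝ) :
    HasTaylorTwo (fun u => f u + N / 2 * (Q u - Q p) ^ 2) A (B + N • q.smulRight q) p := by
  have hdiff : (fun v => Q (p + v) - Q p - q v) =o[𝓝 0] fun v => ‖v‖ :=
    (hasFDerivAt_iff_isLittleO_nhds_zero.1 hQ).norm_right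
  have hlin : (fun v => q v) =O[𝓝 0] fun v => ‖v‖ := (q.isBigO_id _).norm_right
  have hsum : (fun v => Q (p + v) - Q p + q v) =O[𝓝 0] fun v => ‖v‖ :=
    (hdiff.isBigO.add (hlin.const_mul_left 2)).congr_left fun v => by ring
  have hprod := (hdiff.mul_isBigO hsum).const_mul_left (N / 2)
  refine (h.add (hprod.congr_right fun v => (sq _).symm)).congr_left fun v => ?_
  simp only [add_apply, smul_apply, ContinuousLinearMap.smulRight_apply, smul_eq_mul, sub_self]
  ring

lemma HasTaylorTwo.exists_quadratic_lower_bound {f : E → ℝ} {B : E →L[ℝ] E →L[ℝ] ℝ} {p : E}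
    (h : HasTaylorTwo f 0 B p) {S : Set E} {δ : ℝ} (hδ : 0 < δ)
    (hB : ∀ v ∈ S, δ * ‖v‖ ^ 2 ≤ B v v) :
    ∃ η > 0, ∀ v ∈ S, ‖v‖ < η → δ / 4 * ‖v‖ ^ 2 ≤ f (p + v) - f p := by
  obtain ⟨η, hη, hrem⟩ := Metric.eventually_nhds_iff.1 (h.def (c := δ / 4) (by positivity))
  refine ⟨η, hη, fun v hv hvη => ?_⟩
  have hv' := hrem (y := v) (by simpa using hvη)
  rw [norm_pow, norm_norm, Real.norm_eq_abs, zero_apply, sub_zero] at hv'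
  linarith [(abs_le.1 hv').1, hB v hv]

lemma eq_zero_of_linear_add_quadratic_isLittleO {a b : ℝ}
    (h : (fun t : ℝ => t * a + t ^ 2 * b) =o[𝓝 0] fun t : ℝ => t ^ 2) : a = 0 ∧ b = 0 := by
  have hne {n : ℕ} : ∃ᶠ t : ℝ in 𝓝 0, t ^ n ≠ 0 :=
    (eventually_mem_nhdsWithin.frequently.filter_mono
      (nhdsWithin_le_nhds (s := {(0 : ℝ)}ᶜ))).mono fun t ht => pow_ne_zero n ht
  have eq_zero {n : ℕ} {c : ℝ} (hc : (fun t : ℝ => c * t ^ n) =o[𝓝 0] fun t : ℝ => t ^ n) :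
      c = 0 := by
    by_contra hc0
    exact Asymptotics.isLittleO_irrefl hne ((Asymptotics.isLittleO_const_mul_left_iff hc0).1 hc)
  have hsq : (fun t : ℝ => t ^ 2) =o[𝓝 0] fun t : ℝ => t ^ 1 :=
    Asymptotics.isLittleO_pow_pow one_lt_two
  have ha : a = 0 := eq_zero (n := 1) <|
    ((h.trans hsq).sub (hsq.const_mul_left b)).congr_left fun t => by ring
  refine ⟨ha, eq_zero (n := 2) (h.congr_left fun t => ?_)⟩
  rw [ha]
  ring

lemma HasTaylorTwo.of_dense {f : E → ℝ} {A A' : E →L[ℝ] ℝ} {B B' : E →L[ℝ] E →L[ℝ] ℝ} {p : E}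
    (h : HasTaylorTwo f A B p) {D : Set E} (hD : Dense D)
    (h' : ∀ v ∈ D, (fun t : ℝ => f (p + t • v) - f p - A' (t • v) - 1 / 2 * B' (t • v) (t • v))
      =o[𝓝 0] fun t : ℝ => t ^ 2) : HasTaylorTwo f A' B' p := by
  have hjet (v : E) (hv : v ∈ D) : A' v = A v ∧ B' v v = B v v := by
    have htend : Tendsto (fun t : ℝ => t • v) (𝓝 0) (𝓝 0) := by
      simpa using (continuous_id.smul continuous_const).tendsto (0 : ℝ) (f := fun t : ℝ => t • v)
    have hline : (fun t : ℝ => f (p + t • v) - f p - A (t • v) - 1 / 2 * B (t • v) (t • v))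
        =o[𝓝 0] fun t : ℝ => t ^ 2 := by
      refine (h.comp_tendsto htend).trans_isBigO ?_
      refine (Asymptotics.isBigO_refl (fun t : ℝ => t ^ 2) _).const_mul_left (‖v‖ ^ 2) |>.congr_left
        fun t => ?_
      simp [norm_smul, mul_pow, mul_comm]
    obtain ⟨hA, hB⟩ := eq_zero_of_linear_add_quadratic_isLittleO (a := A' v - A v)
      (b := 1 / 2 * (B' v v - B v v)) ((hline.sub (h' v hv)).congr_left fun t => by
        simp only [map_smul, smul_apply, smul_eq_mul]
        ring)
    constructor <;> linarith
  have hA : (fun v => A' v) = fun v => A v :=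
    Continuous.ext_on hD A'.continuous A.continuous fun v hv => (hjet v hv).1
  have hB : (fun v => B' v v) = fun v => B v v :=
    Continuous.ext_on hD (by fun_prop) (by fun_prop) fun v hv => (hjet v hv).2
  exact h.congr_left fun v => by rw [congrFun hA v, congrFun hB v]

lemma taylor_two_of_norm_fderiv_sub_le {f : E → ℝ} {f' : E → E →L[ℝ] ℝ} {H : E →L[ℝ] E →L[ℝ] ℝ}
    {p : E} {δ ε : ℝ}
    (hf : ∀ w, ‖w‖ < δ → HasFDerivAt f (f' (p + w)) (p + w))
    (hf' : ∀ w, ‖w‖ < δ → ‖f' (p + w) - f' p - H w‖ ≤ ε * ‖w‖) {w : E} (hw : ‖w‖ < δ) :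
    |f (p + w) - f p - f' p w - 1 / 2 * H w w| ≤ ε * ‖w‖ ^ 2 := by
  have hlt (t : ℝ) (ht : t ∈ Icc (0 : ℝ) 1) : ‖t • w‖ < δ := by
    rw [norm_smul, Real.norm_of_nonneg ht.1]
    exact (mul_le_of_le_one_left (norm_nonneg _) ht.2).trans_lt hw
  have hd : ∀ t ∈ Icc (0 : ℝ) 1, HasDerivWithinAt
      (fun t : ℝ => f (p + t • w) - t * f' p w - t ^ 2 * (1 / 2 * H w w))
      ((f' (p + t • w) - f' p - H (t • w)) w) (Icc 0 1) t := by
    intro t ht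
    have hline : HasDerivAt (fun t : ℝ => p + t • w) w t := by
      simpa using ((hasDerivAt_id t).smul_const w).const_add p
    have hcomp := (hf _ (hlt t ht)).comp_hasDerivAt t hline
    have hderiv := (hcomp.sub ((hasDerivAt_id t).mul_const (f' p w))).sub
      (((hasDerivAt_id t).pow 2).mul_const (1 / 2 * H w w))
    refine (hderiv.congr_deriv ?_).hasDerivWithinAt
    simp
    ring
  have hb : ∀ t ∈ Icc (0 : ℝ) 1, ‖(f' (p + t • w) - f' p - H (t • w)) w‖ ≤ ε * ‖w‖ ^ 2 := by
    intro t ht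
    have hop : ‖f' (p + t • w) - f' p - H (t • w)‖ ≤ ε * ‖w‖ := by
      refine (hf' _ (hlt t ht)).trans ?_
      have hε : 0 ≤ ε * ‖w‖ := (norm_nonneg _).trans (hf' w hw)
      rw [norm_smul, Real.norm_of_nonneg ht.1]
      nlinarith [ht.2, ht.1]
    calc _ ≤ ‖f' (p + t • w) - f' p - H (t • w)‖ * ‖w‖ := ContinuousLinearMap.le_opNorm _ _
      _ ≤ ε * ‖w‖ * ‖w‖ := by gcongr
      _ = _ := by ring
  have h := (convex_Icc (0 : ℝ) 1).norm_image_sub_le_of_norm_hasDerivWithin_le hd hb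
    (left_mem_Icc.2 zero_le_one) (right_mem_Icc.2 zero_le_one)
  simp only [one_smul, zero_smul, add_zero, sub_zero, norm_one, mul_one, Real.norm_eq_abs] at h
  convert h using 2
  ring

lemma hasTaylorTwo_fderiv {f : E → ℝ} {p : E} (hf : ContDiffAt ℝ 2 f p) :
    HasTaylorTwo f (fderiv ℝ f p) (fderiv ℝ (fderiv ℝ f) p) p := by
  have hdiff : ∀ᶠ x in 𝓝 p, DifferentiableAt ℝ f x :=
    (hf.eventually (by simp)).mono fun x hx => hx.differentiableAt (by simp)
  have hdiff2 : DifferentiableAt ℝ (fderiv ℝ f) p :=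
    (hf.fderiv_right (m := 1) (by norm_num)).differentiableAt (by simp)
  refine Asymptotics.isLittleO_iff.2 fun ε hε => ?_
  obtain ⟨δ, hδ, hball⟩ :=
    Metric.eventually_nhds_iff.1 (hdiff.and (hdiff2.hasFDerivAt.isLittleO.def hε))
  have hin (w : E) (hw : ‖w‖ < δ) : dist (p + w) p < δ := by simpa [dist_eq_norm] using hw
  filter_upwards [Metric.ball_mem_nhds 0 hδ] with w hw
  rw [norm_pow, norm_norm, Real.norm_eq_abs]
  refine taylor_two_of_norm_fderiv_sub_le (δ := δ) (fun w hw => (hball (hin w hw)).1.hasFDerivAt)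
    (fun w hw => ?_) (by simpa using hw)
  simpa using (hball (hin w hw)).2

lemma taylor_two_uniform_of_contDiff [ProperSpace E] {f : E → ℝ} (hf : ContDiff ℝ 2 f) {K : Set E}
    (hK : IsCompact K) {ε : ℝ} (hε : 0 < ε) :
    ∃ δ > 0, ∀ p ∈ K, ∀ w, ‖w‖ < δ →
      |f (p + w) - f p - fderiv ℝ f p w - 1 / 2 * fderiv ℝ (fderiv ℝ f) p w w| ≤ ε * ‖w‖ ^ 2 := by
  have hdf : ContDiff ℝ 1 (fderiv ℝ f) := hf.fderiv_right (by norm_num)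
  have hddf : Continuous (fderiv ℝ (fderiv ℝ f)) := hdf.continuous_fderiv (by simp)
  have hK' : IsCompact (Metric.cthickening 1 K) := hK.cthickening
  have huc := hK'.uniformContinuousOn_of_continuous hddf.continuousOn
  obtain ⟨δ, hδ, hb⟩ := (@Metric.uniformContinuousOn_iff E (E →L[ℝ] E →L[ℝ] ℝ) _ _ _ _).1 huc ε hε
  refine ⟨min δ 1, by positivity, fun p hp w hw => ?_⟩
  refine taylor_two_of_norm_fderiv_sub_le (f' := fderiv ℝ f) (H := fderiv ℝ (fderiv ℝ f) p)
    (fun w _ => (hf.differentiable (by simp) _).hasFDerivAt) (fun w hw => ?_) hw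
  have hball : ∀ x ∈ Metric.ball p (min δ 1),
      ‖fderiv ℝ (fderiv ℝ f) x - fderiv ℝ (fderiv ℝ f) p‖ ≤ ε := by
    intro x hx
    have hxp := lt_min_iff.1 (Metric.mem_ball.1 hx)
    exact (dist_eq_norm (fderiv ℝ (fderiv ℝ f) x) _).ge.trans
      (hb x (Metric.mem_cthickening_of_dist_le x p 1 K hp hxp.2.le) p
        (Metric.self_subset_cthickening K hp) hxp.1).le
  have h := (convex_ball p (min δ 1)).norm_image_sub_le_of_norm_hasFDerivWithin_le'
    (f := fderiv ℝ f) (φ := fderiv ℝ (fderiv ℝ f) p)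
    (fun x _ => ((hdf.differentiable (by simp)) x).hasFDerivAt.hasFDerivWithinAt) hball
    (x := p) (y := p + w) (Metric.mem_ball_self (by positivity)) (by simpa [dist_eq_norm] using hw)
  simpa using h

end Taylor

section Mode

variable {L : ℝ}

/-- The real trigonometric monomial `x ↦ Re (b e^{2πiκx/L})`. -/
def mode (L : ℝ) (κ : ℤ) (b : Fin 2 → ℂ) : SmoothPer L where
  toFun x := WithLp.toLp 2 fun i => (b i * fourier κ x).re
  smooth := by
    rw [contDiff_euclidean]
    intro i
    have h : ContDiff ℝ ∞ fun x : ℝ => b i * fourier κ (x : AddCircle L) := by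
      simp only [fourier_coe_apply]
      refine contDiff_const.mul (Complex.contDiff_exp.comp ?_)
      exact (contDiff_const.mul Complex.ofRealCLM.contDiff).div_const _
    exact Complex.reCLM.contDiff.comp h

lemma mode_apply (κ : ℤ) (b : Fin 2 → ℂ) (x : AddCircle L) (i : Fin 2) :
    mode L κ b x i = (b i * fourier κ x).re := rfl

end Mode

section FourierSide

variable {L : ℝ} [Fact (0 < L)]

lemma fcoef_neg_index (f : AddCircle L → Plane) (κ : ℤ) (i : Fin 2) :
    fcoef f (-κ) i = starRingEnd ℂ (fcoef f κ i) := by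
  unfold fcoef fourierCoeff
  rw [← integral_conj]
  congr 1
  funext x
  rw [smul_eq_mul, smul_eq_mul, map_mul, ← fourier_neg, Complex.conj_ofReal]

lemma memLp_ofReal_apply {f : AddCircle L → Plane} (hf : MemLp f 2) (i : Fin 2) :
    MemLp (fun x => ((f x i : ℝ) : ℂ)) 2 AddCircle.haarAddCircle :=
  memLp_haarAddCircle_iff.2 ((EuclideanSpace.proj (𝕜 := ℝ) i).comp_memLp' hf).ofReal

lemma hasSum_fcoef_apply_mul_conj {f g : AddCircle L → Plane} (hf : MemLp f 2) (hg : MemLp g 2)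
    (i : Fin 2) :
    HasSum (fun κ : ℤ => (fcoef f κ i * starRingEnd ℂ (fcoef g κ i)).re)
      (L⁻¹ * ∫ x, f x i * g x i) := by
  have hfi := memLp_ofReal_apply hf i
  have hgi := memLp_ofReal_apply hg i
  have h := fourierBasis.hasSum_inner_mul_inner (hgi.toLp _) (hfi.toLp _)
  have hint : ∫ x, inner ℂ (hgi.toLp _ x) (hfi.toLp _ x) ∂AddCircle.haarAddCircle =
      ((L⁻¹ * ∫ x, f x i * g x i : ℝ) : ℂ) := by
    rw [Complex.ofReal_mul, ← integral_complex_ofReal, ← Complex.real_smul,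
      ← AddCircle.integral_haarAddCircle]
    refine integral_congr_ae ?_
    filter_upwards [hgi.coeFn_toLp, hfi.coeFn_toLp] with x h1 h2
    rw [h1, h2]
    simp
  rw [L2.inner_def, hint] at h
  have hre := Complex.hasSum_re h
  rw [Complex.ofReal_re] at hre
  convert hre using 2 with κ
  rw [← fourierBasis.repr_apply_apply, fourierBasis_repr, ← inner_conj_symm,
    ← fourierBasis.repr_apply_apply, fourierBasis_repr, fourierCoeff_congr_ae hgi.coeFn_toLp,
    fourierCoeff_congr_ae hfi.coeFn_toLp, mul_comm]
  rfl

lemma hasSum_fcoef_mul_conj {f g : AddCircle L → Plane} (hf : MemLp f 2) (hg : MemLp g 2) :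
    HasSum (fun κ : ℤ => ∑ i, (fcoef f κ i * starRingEnd ℂ (fcoef g κ i)).re)
      (L⁻¹ * ∫ x, inner ℝ (f x) (g x)) := by
  convert hasSum_sum (s := Finset.univ) fun i _ => hasSum_fcoef_apply_mul_conj hf hg i using 1
  have hint (i : Fin 2) : Integrable fun x => f x i * g x i :=
    ((EuclideanSpace.proj (𝕜 := ℝ) i).comp_memLp' hf).integrable_mul
      ((EuclideanSpace.proj (𝕜 := ℝ) i).comp_memLp' hg)
  rw [← Finset.mul_sum, ← integral_finsetSum _ fun i _ => hint i]
  simp only [PiLp.inner_apply, RCLike.inner_apply, conj_trivial, mul_comm]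

lemma hasSum_norm_fcoef_sq {f : AddCircle L → Plane} (hf : MemLp f 2) :
    HasSum (fun κ : ℤ => ∑ i, ‖fcoef f κ i‖ ^ 2) (L⁻¹ * ∫ x, inner ℝ (f x) (f x)) := by
  convert hasSum_fcoef_mul_conj hf hf using 4 with κ i
  rw [Complex.mul_conj, Complex.ofReal_re, Complex.normSq_eq_norm_sq]

lemma fcoef_mode (κ₀ : ℤ) (b : Fin 2 → ℂ) (κ : ℤ) (i : Fin 2) :
    fcoef (mode L κ₀ b) κ i = (if κ = κ₀ then b i / 2 else 0) +
      (if κ = -κ₀ then starRingEnd ℂ (b i) / 2 else 0) := by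
  have h : (fun x : AddCircle L => ((mode L κ₀ b x i : ℝ) : ℂ)) =
      (fun x => b i / 2 * fourier κ₀ x) + fun x => starRingEnd ℂ (b i) / 2 * fourier (-κ₀) x := by
    funext x
    rw [mode_apply, Pi.add_apply, fourier_neg, Complex.re_eq_add_conj, map_mul]
    ring
  have hint : ∀ (n : ℤ) (z : ℂ), Integrable (fun x : AddCircle L => z * fourier n x)
      AddCircle.haarAddCircle := fun n z =>
    (continuous_const.mul (fourier n).continuous).integrable_of_hasCompactSupport
      (HasCompactSupport.of_compactSpace _)
  rw [fcoef, h, fourierCoeff.add (hint _ _) (hint _ _), Pi.add_apply, fourierCoeff.const_mul,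
    fourierCoeff.const_mul, fourierCoeff_fourier, fourierCoeff_fourier, Pi.single_apply,
    Pi.single_apply]
  simp

/-- The `κ`-th term `Re ⟨a(κ) f̂(κ), ĝ(κ)⟩` of the bilinear form with matrix symbol `a`. -/
def symbolTerm (a : ℤ → Matrix (Fin 2) (Fin 2) ℝ) (f g : AddCircle L → Plane) (κ : ℤ) : ℝ :=
  ∑ i, ∑ j, a κ i j * (fcoef f κ j * starRingEnd ℂ (fcoef g κ i)).re

lemma hasSum_symbolTerm_mode {a : ℤ → Matrix (Fin 2) (Fin 2) ℝ} (ha : ∀ κ, a (-κ) = a κ)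
    (f : AddCircle L → Plane) (κ₀ : ℤ) (b : Fin 2 → ℂ) :
    HasSum (symbolTerm a f (mode L κ₀ b))
      (∑ i, ∑ j, a κ₀ i j * (fcoef f κ₀ j * starRingEnd ℂ (b i)).re) := by
  set S := ∑ i, ∑ j, a κ₀ i j * (fcoef f κ₀ j * starRingEnd ℂ (b i)).re / 2 with hS
  have hpos (κ : ℤ) (hκ : κ = κ₀) :
      ∑ i, ∑ j, a κ i j * (fcoef f κ j * starRingEnd ℂ (b i / 2)).re = S := by
    subst hκ
    simp only [hS, map_div₀, ← mul_div_assoc, Complex.conj_ofNat, Complex.div_ofNat_re]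
  have hneg (κ : ℤ) (hκ : κ = -κ₀) :
      ∑ i, ∑ j, a κ i j * (fcoef f κ j * starRingEnd ℂ (starRingEnd ℂ (b i) / 2)).re = S := by
    subst hκ
    simp only [hS, ha, fcoef_neg_index, ← map_mul, Complex.conj_re, ← mul_div_assoc,
      map_div₀, Complex.conj_ofNat, Complex.div_ofNat_re]
  have hterm : symbolTerm a f (mode L κ₀ b) =
      fun κ => (if κ = κ₀ then S else 0) + if κ = -κ₀ then S else 0 := by
    funext κ
    simp only [symbolTerm, fcoef_mode, map_add, mul_add, Complex.add_re, Finset.sum_add_distrib]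
    congr 1
    · split_ifs with h
      · exact hpos κ h
      · simp
    · split_ifs with h
      · exact hneg κ h
      · simp
  have hsum : S + S = ∑ i, ∑ j, a κ₀ i j * (fcoef f κ₀ j * starRingEnd ℂ (b i)).re := by
    simp only [hS, ← Finset.sum_add_distrib, add_halves]
  rw [hterm, ← hsum]
  exact (hasSum_ite_eq κ₀ S).add (hasSum_ite_eq (-κ₀) S)

end FourierSide

section SobolevSpace

variable {L : ℝ} [Fact (0 < L)] {r : ℝ}

namespace Hper

lemma memLp (u : Hper L r) : MemLp (u : AddCircle L → Plane) 2 := Lp.memLp u.toL2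

lemma coeFn_add (u v : Hper L r) : ((u + v : Hper L r) : AddCircle L → Plane) =ᵐ[volume] u + v :=
  Lp.coeFn_add u.toL2 v.toL2

lemma coeFn_smul (t : ℝ) (u : Hper L r) :
    ((t • u : Hper L r) : AddCircle L → Plane) =ᵐ[volume] t • (u : AddCircle L → Plane) :=
  Lp.coeFn_smul t u.toL2

lemma fcoef_add (u v : Hper L r) (κ : ℤ) (i : Fin 2) :
    fcoef (u + v : Hper L r) κ i = fcoef u κ i + fcoef v κ i := by
  rw [fcoef_congr (coeFn_add u v)]
  exact DispersiveSystem.fcoef_add (integrable_L2 _) (integrable_L2 _) κ i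

lemma fcoef_smul (t : ℝ) (u : Hper L r) (κ : ℤ) (i : Fin 2) :
    fcoef (t • u : Hper L r) κ i = t * fcoef u κ i := by
  rw [fcoef_congr (coeFn_smul t u)]
  exact DispersiveSystem.fcoef_smul t _ κ i

lemma fcoef_sub (u v : Hper L r) (κ : ℤ) (i : Fin 2) :
    fcoef (u - v : Hper L r) κ i = fcoef u κ i - fcoef v κ i := by
  rw [eq_sub_iff_add_eq, ← fcoef_add, sub_add_cancel]

lemma ext_fcoef {u v : Hper L r} (h : ∀ κ i, fcoef u κ i = fcoef v κ i) : u = v := by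
  rw [← sub_eq_zero]
  refine Subtype.ext (eq_zero_of_fcoef (u - v).toL2 fun κ i => ?_)
  have := fcoef_sub u v κ i
  rw [h, sub_self] at this
  exact this

lemma toEll2_apply (u : Hper L r) (κ : ℤ) (i : Fin 2) :
    toEll2 L r u κ i = ((1 + (κ : ℝ) ^ 2) ^ (r / 2) : ℝ) * fcoef u κ i := by
  change wcoef r u κ i = _
  simp [wcoef]

lemma weight_mul_norm_fcoef_le (u : Hper L r) (κ : ℤ) (i : Fin 2) :
    (1 + (κ : ℝ) ^ 2) ^ (r / 2) * ‖fcoef u κ i‖ ≤ ‖toEll2 L r u κ‖ := by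
  have h := PiLp.norm_apply_le (toEll2 L r u κ) i
  rw [toEll2_apply, norm_mul, Complex.norm_real, Real.norm_of_nonneg (by positivity)] at h
  exact h

lemma summable_norm_sq (u : Hper L r) :
    Summable fun κ : ℤ => (1 + (κ : ℝ) ^ 2) ^ r * ∑ i, ‖fcoef u κ i‖ ^ 2 := u.2

end Hper

/-- The entries of the matrix symbol `a` are `O((1 + κ²)^r)`. -/
def SymbolBound (r : ℝ) (a : ℤ → Matrix (Fin 2) (Fin 2) ℝ) (C : ℝ) : Prop :=
  ∀ κ i j, |a κ i j| ≤ C * (1 + (κ : ℝ) ^ 2) ^ r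

variable {a : ℤ → Matrix (Fin 2) (Fin 2) ℝ} {C : ℝ}

lemma SymbolBound.nonneg (ha : SymbolBound r a C) : 0 ≤ C := by
  have h := (abs_nonneg _).trans (ha 0 0 0)
  simpa using h

lemma SymbolBound.norm_symbolTerm_le (ha : SymbolBound r a C) (u v : Hper L r) (κ : ℤ) :
    ‖symbolTerm a u v κ‖ ≤ 4 * C * (‖Hper.toEll2 L r u κ‖ * ‖Hper.toEll2 L r v κ‖) := by
  have hC := ha.nonneg
  have hw : (1 + (κ : ℝ) ^ 2) ^ r = (1 + (κ : ℝ) ^ 2) ^ (r / 2) * (1 + (κ : ℝ) ^ 2) ^ (r / 2) := by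
    rw [← Real.rpow_add (by positivity), add_halves]
  have h : ∀ i j, ‖a κ i j * (fcoef u κ j * starRingEnd ℂ (fcoef v κ i)).re‖ ≤
      C * (‖Hper.toEll2 L r u κ‖ * ‖Hper.toEll2 L r v κ‖) := by
    intro i j
    rw [norm_mul, Real.norm_eq_abs, Real.norm_eq_abs]
    have hre : |(fcoef u κ j * starRingEnd ℂ (fcoef v κ i)).re| ≤
        ‖fcoef u κ j‖ * ‖fcoef v κ i‖ := by
      refine (Complex.abs_re_le_norm _).trans ?_
      rw [norm_mul, RCLike.norm_conj]
    calc _ ≤ (C * (1 + (κ : ℝ) ^ 2) ^ r) * (‖fcoef u κ j‖ * ‖fcoef v κ i‖) := by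
          gcongr
          exact ha κ i j
      _ = C * (((1 + (κ : ℝ) ^ 2) ^ (r / 2) * ‖fcoef u κ j‖) *
          ((1 + (κ : ℝ) ^ 2) ^ (r / 2) * ‖fcoef v κ i‖)) := by rw [hw]; ring
      _ ≤ _ := by
          gcongr
          · exact u.weight_mul_norm_fcoef_le κ j
          · exact v.weight_mul_norm_fcoef_le κ i
  unfold symbolTerm
  simp only [Fin.sum_univ_two]
  refine (norm_add_le _ _).trans ?_
  have := (norm_add_le (a κ 0 0 * (fcoef u κ 0 * starRingEnd ℂ (fcoef v κ 0)).re)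
    (a κ 0 1 * (fcoef u κ 1 * starRingEnd ℂ (fcoef v κ 0)).re))
  have := (norm_add_le (a κ 1 0 * (fcoef u κ 0 * starRingEnd ℂ (fcoef v κ 1)).re)
    (a κ 1 1 * (fcoef u κ 1 * starRingEnd ℂ (fcoef v κ 1)).re))
  linarith [h 0 0, h 0 1, h 1 0, h 1 1]

lemma SymbolBound.summable_symbolTerm (ha : SymbolBound r a C) (u v : Hper L r) :
    Summable (symbolTerm a u v) :=
  Summable.of_norm_bounded ((lp.tsum_mul_le_mul_norm (by norm_num; exact .two_two)
    (Hper.toEll2 L r u) (Hper.toEll2 L r v)).1.mul_left _) (ha.norm_symbolTerm_le u v)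

lemma SymbolBound.abs_tsum_symbolTerm_le (ha : SymbolBound r a C) (u v : Hper L r) :
    |∑' κ, symbolTerm a u v κ| ≤ 4 * C * (‖u‖ * ‖v‖) := by
  have h := lp.tsum_mul_le_mul_norm (by norm_num; exact .two_two)
    (Hper.toEll2 L r u) (Hper.toEll2 L r v)
  refine (tsum_of_norm_bounded (h.1.mul_left (4 * C)).hasSum (ha.norm_symbolTerm_le u v)).trans ?_
  rw [tsum_mul_left]
  have := ha.nonneg
  gcongr
  exact h.2

lemma symbolTerm_add_left (a : ℤ → Matrix (Fin 2) (Fin 2) ℝ) (u u' v : Hper L r) (κ : ℤ) :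
    symbolTerm a (u + u' : Hper L r) v κ = symbolTerm a u v κ + symbolTerm a u' v κ := by
  simp only [symbolTerm, Hper.fcoef_add, add_mul, Complex.add_re, mul_add, Finset.sum_add_distrib]

lemma symbolTerm_add_right (a : ℤ → Matrix (Fin 2) (Fin 2) ℝ) (u v v' : Hper L r) (κ : ℤ) :
    symbolTerm a u (v + v' : Hper L r) κ = symbolTerm a u v κ + symbolTerm a u v' κ := by
  simp only [symbolTerm, Hper.fcoef_add, map_add, Complex.add_re, mul_add, Finset.sum_add_distrib]

lemma symbolTerm_smul_left (a : ℤ → Matrix (Fin 2) (Fin 2) ℝ) (t : ℝ) (u v : Hper L r) (κ : ℤ) :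
    symbolTerm a (t • u : Hper L r) v κ = t * symbolTerm a u v κ := by
  simp only [symbolTerm, Hper.fcoef_smul, mul_assoc, Complex.re_ofReal_mul, Finset.mul_sum]
  exact Finset.sum_congr rfl fun i _ => Finset.sum_congr rfl fun j _ => by ring

lemma symbolTerm_smul_right (a : ℤ → Matrix (Fin 2) (Fin 2) ℝ) (t : ℝ) (u v : Hper L r) (κ : ℤ) :
    symbolTerm a u (t • v : Hper L r) κ = t * symbolTerm a u v κ := by
  simp only [symbolTerm, Hper.fcoef_smul, map_mul, Complex.conj_ofReal, Finset.mul_sum]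
  refine Finset.sum_congr rfl fun i _ => Finset.sum_congr rfl fun j _ => ?_
  rw [mul_left_comm, Complex.re_ofReal_mul]
  ring

/-- The bounded bilinear form `(u,v) ↦ ∑_κ Re ⟨a(κ) û(κ), v̂(κ)⟩` on `H^r × H^r`. -/
def symbolForm (L : ℝ) [Fact (0 < L)] (ha : SymbolBound r a C) :
    Hper L r →L[ℝ] Hper L r →L[ℝ] ℝ :=
  LinearMap.mkContinuous₂ (LinearMap.mk₂ ℝ (fun u v => ∑' κ, symbolTerm a u v κ)
    (fun u u' v => by
      simp only [symbolTerm_add_left]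
      exact (ha.summable_symbolTerm u v).tsum_add (ha.summable_symbolTerm u' v))
    (fun t u v => by simp only [symbolTerm_smul_left, tsum_mul_left, smul_eq_mul])
    (fun u v v' => by
      simp only [symbolTerm_add_right]
      exact (ha.summable_symbolTerm u v).tsum_add (ha.summable_symbolTerm u v'))
    (fun t u v => by simp only [symbolTerm_smul_right, tsum_mul_left, smul_eq_mul]))
    (4 * C) (fun u v => by
      rw [mul_assoc]
      exact ha.abs_tsum_symbolTerm_le u v)

lemma symbolForm_apply (ha : SymbolBound r a C) (u v : Hper L r) :
    symbolForm L ha u v = ∑' κ, symbolTerm a u v κ := rfl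

lemma symbolTerm_comm (hs : ∀ κ, (a κ).IsSymm) (f g : AddCircle L → Plane) (κ : ℤ) :
    symbolTerm a f g κ = symbolTerm a g f κ := by
  unfold symbolTerm
  rw [Finset.sum_comm]
  refine Finset.sum_congr rfl fun i _ => Finset.sum_congr rfl fun j _ => ?_
  rw [(hs κ).apply, ← Complex.conj_re, map_mul, Complex.conj_conj, mul_comm (starRingEnd ℂ _)]

lemma symbolForm_comm (ha : SymbolBound r a C) (hs : ∀ κ, (a κ).IsSymm) (u v : Hper L r) :
    symbolForm L ha u v = symbolForm L ha v u := by
  simp only [symbolForm_apply, symbolTerm_comm hs u v]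

lemma SmoothPer.coeFn_toHper (r : ℝ) (f : SmoothPer L) :
    (f.toHper r : AddCircle L → Plane) =ᵐ[volume] f := f.memLp.coeFn_toLp

lemma symbolTerm_congr {f f' g g' : AddCircle L → Plane} (hf : f =ᵐ[volume] f')
    (hg : g =ᵐ[volume] g') (a : ℤ → Matrix (Fin 2) (Fin 2) ℝ) :
    symbolTerm a f g = symbolTerm a f' g' := by
  funext κ
  rw [symbolTerm, symbolTerm, fcoef_congr hf, fcoef_congr hg]

lemma symbolForm_mode (ha : SymbolBound r a C) (he : ∀ κ, a (-κ) = a κ) (u : Hper L r) (κ₀ : ℤ)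
    (b : Fin 2 → ℂ) : symbolForm L ha u ((mode L κ₀ b).toHper r) =
      ∑ i, ∑ j, a κ₀ i j * (fcoef u κ₀ j * starRingEnd ℂ (b i)).re := by
  rw [symbolForm_apply, symbolTerm_congr EventuallyEq.rfl (SmoothPer.coeFn_toHper r _)]
  exact (hasSum_symbolTerm_mode he u κ₀ b).tsum_eq

instance : InnerProductSpace ℝ (Hper L r) where
  inner u v := (inner ℂ (Hper.toEll2 L r u) (Hper.toEll2 L r v)).re
  norm_sq_eq_re_inner u := by
    change ‖Hper.toEll2 L r u‖ ^ 2 = _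
    rw [← inner_self_eq_norm_sq (𝕜 := ℂ)]
    rfl
  conj_inner_symm u v := by
    rw [conj_trivial, ← Complex.conj_re, inner_conj_symm]
  add_left u v w := by rw [map_add, inner_add_left, Complex.add_re]
  smul_left u v t := by
    rw [map_smul, conj_trivial, inner_smul_left_eq_smul, Complex.smul_re, smul_eq_mul]

/-- The symbol `(1 + κ²)^ρ Id`. -/
def weight (ρ : ℝ) (κ : ℤ) : Matrix (Fin 2) (Fin 2) ℝ := (1 + (κ : ℝ) ^ 2) ^ ρ • 1

lemma weight_neg (ρ : ℝ) (κ : ℤ) : weight ρ (-κ) = weight ρ κ := by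
  simp [weight]

lemma weight_symbolBound {ρ : ℝ} (h : ρ ≤ r) : SymbolBound r (weight ρ) 1 := by
  intro κ i j
  have hle : (1 + (κ : ℝ) ^ 2) ^ ρ ≤ (1 + (κ : ℝ) ^ 2) ^ r :=
    Real.rpow_le_rpow_of_exponent_le (by nlinarith [sq_nonneg (κ : ℝ)]) h
  have hnonneg : (0 : ℝ) ≤ (1 + (κ : ℝ) ^ 2) ^ ρ := by positivity
  rw [weight, Matrix.smul_apply, Matrix.one_apply, one_mul]
  split_ifs
  · simpa [abs_of_nonneg hnonneg] using hle
  · simpa using hnonneg.trans hle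

lemma symbolTerm_weight (ρ : ℝ) (f g : AddCircle L → Plane) (κ : ℤ) :
    symbolTerm (weight ρ) f g κ =
      (1 + (κ : ℝ) ^ 2) ^ ρ * ∑ i, (fcoef f κ i * starRingEnd ℂ (fcoef g κ i)).re := by
  simp [symbolTerm, weight, Matrix.one_apply, Fin.sum_univ_two]
  ring

lemma symbolTerm_weight_self (ρ : ℝ) (f : AddCircle L → Plane) (κ : ℤ) :
    symbolTerm (weight ρ) f f κ = (1 + (κ : ℝ) ^ 2) ^ ρ * ∑ i, ‖fcoef f κ i‖ ^ 2 := by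
  rw [symbolTerm_weight]
  simp only [Complex.mul_conj, Complex.ofReal_re, Complex.normSq_eq_norm_sq]

lemma Hper.inner_eq (u v : Hper L r) :
    inner ℝ u v = symbolForm L (weight_symbolBound le_rfl) u v := by
  have h := Complex.hasSum_re (lp.hasSum_inner (𝕜 := ℂ) (Hper.toEll2 L r u) (Hper.toEll2 L r v))
  refine h.tsum_eq.symm.trans (tsum_congr fun κ => ?_)
  have hw : (1 + (κ : ℝ) ^ 2) ^ r = (1 + (κ : ℝ) ^ 2) ^ (r / 2) * (1 + (κ : ℝ) ^ 2) ^ (r / 2) := by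
    rw [← Real.rpow_add (by positivity), add_halves]
  rw [symbolTerm_weight, hw, PiLp.inner_apply, Complex.re_sum, Finset.mul_sum]
  refine Finset.sum_congr rfl fun i _ => ?_
  rw [RCLike.inner_apply, toEll2_apply, toEll2_apply, map_mul, Complex.conj_ofReal,
    mul_mul_mul_comm, ← Complex.ofReal_mul, Complex.re_ofReal_mul]
  congr 1
  rw [← Complex.conj_re, map_mul, Complex.conj_conj, mul_comm]

lemma Hper.inner_toL2 (hr : 0 ≤ r) (u v : Hper L r) :
    inner ℝ u.toL2 v.toL2 = L * symbolForm L (weight_symbolBound hr) u v := by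
  have hL : (0 : ℝ) < L := Fact.out
  have h := hasSum_fcoef_mul_conj u.memLp v.memLp
  rw [L2.inner_def, symbolForm_apply]
  simp only [symbolTerm_weight, Real.rpow_zero, one_mul]
  rw [h.tsum_eq, mul_inv_cancel_left₀ hL.ne']

lemma Hper.norm_toL2_le (hr : 0 ≤ r) (u : Hper L r) : ‖u.toL2‖ ≤ √ L * ‖u‖ := by
  have hL : (0 : ℝ) < L := Fact.out
  have hweight : symbolForm L (weight_symbolBound hr) u u ≤ ‖u‖ ^ 2 := by
    rw [← real_inner_self_eq_norm_sq, Hper.inner_eq, symbolForm_apply, symbolForm_apply]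
    refine Summable.tsum_le_tsum (fun κ => ?_) ((weight_symbolBound hr).summable_symbolTerm u u)
      ((weight_symbolBound le_rfl).summable_symbolTerm u u)
    rw [symbolTerm_weight_self, symbolTerm_weight_self]
    gcongr
    nlinarith [sq_nonneg (κ : ℝ)]
  refine le_of_sq_le_sq ?_ (by positivity)
  rw [mul_pow, Real.sq_sqrt hL.le, ← real_inner_self_eq_norm_sq, Hper.inner_toL2 hr]
  gcongr

/-- The inclusion `H^r × H^r → L² × L²` as a bounded operator, for `0 ≤ r`. -/
def Hper.toL2L (L : ℝ) [Fact (0 < L)] (hr : 0 ≤ r) : Hper L r →L[ℝ] L2per L :=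
  LinearMap.mkContinuous
    { toFun := Hper.toL2
      map_add' := fun _ _ => rfl
      map_smul' := fun _ _ => rfl } (√ L) (Hper.norm_toL2_le hr)

lemma norm_fcoef_le_L2 (f : L2per L) (κ : ℤ) (i : Fin 2) :
    ‖fcoef f κ i‖ ≤ √(L⁻¹) * ‖f‖ := by
  have hL : (0 : ℝ) < L := Fact.out
  have h := hasSum_norm_fcoef_sq (Lp.memLp f)
  have hterm := h.summable.le_tsum κ (fun _ _ => Finset.sum_nonneg fun _ _ => sq_nonneg _)
  rw [h.tsum_eq, ← L2.inner_def, real_inner_self_eq_norm_sq] at hterm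
  have hcomp : ‖fcoef f κ i‖ ^ 2 ≤ L⁻¹ * ‖f‖ ^ 2 :=
    (Finset.single_le_sum (f := fun i => ‖fcoef f κ i‖ ^ 2) (fun _ _ => sq_nonneg _)
      (Finset.mem_univ i)).trans hterm
  refine le_of_sq_le_sq ?_ (by positivity)
  rwa [mul_pow, Real.sq_sqrt (by positivity)]

lemma fcoef_sub_L2 (f g : L2per L) (κ : ℤ) (i : Fin 2) :
    fcoef (f - g : L2per L) κ i = fcoef f κ i - fcoef g κ i := by
  rw [eq_sub_iff_add_eq, ← fcoef_add (integrable_L2 _) (integrable_L2 _),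
    ← fcoef_congr (Lp.coeFn_add (f - g) g), sub_add_cancel]

lemma tendsto_fcoef {f : ℕ → L2per L} {g : L2per L} (h : Tendsto f atTop (𝓝 g)) (κ : ℤ)
    (i : Fin 2) : Tendsto (fun n => fcoef (f n) κ i) atTop (𝓝 (fcoef g κ i)) := by
  rw [tendsto_iff_norm_sub_tendsto_zero] at h ⊢
  refine squeeze_zero (fun _ => norm_nonneg _) (fun n => ?_)
    (by simpa only [mul_zero] using h.const_mul (√(L⁻¹)))
  rw [← fcoef_sub_L2 (f n) g κ i]
  exact norm_fcoef_le_L2 (f n - g) κ i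

lemma Hper.isometry_toEll2 : Isometry (Hper.toEll2 L r) :=
  AddMonoidHomClass.isometry_of_norm _ fun _ => rfl

lemma Hper.wcoef_eq_of_tendsto {u : ℕ → Hper L r}
    {U : lp (fun _ : ℤ => EuclideanSpace ℂ (Fin 2)) 2} {f : L2per L}
    (hU : Tendsto (fun n => Hper.toEll2 L r (u n)) atTop (𝓝 U))
    (hf : Tendsto (fun n => (u n).toL2) atTop (𝓝 f)) : wcoef r f = U := by
  funext κ
  ext i
  have hUκ : Tendsto (fun n => Hper.toEll2 L r (u n) κ i) atTop (𝓝 (U κ i)) := by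
    rw [tendsto_iff_norm_sub_tendsto_zero] at hU ⊢
    refine squeeze_zero (fun _ => norm_nonneg _) (fun n => ?_) hU
    exact (PiLp.norm_apply_le ((Hper.toEll2 L r (u n) - U) κ) i).trans
      (lp.norm_apply_le_norm (by norm_num) _ κ)
  have hfκ : Tendsto (fun n => Hper.toEll2 L r (u n) κ i) atTop (𝓝 (wcoef r f κ i)) := by
    have h : wcoef r f κ i = ((1 + (κ : ℝ) ^ 2) ^ (r / 2) : ℝ) * fcoef f κ i := by simp [wcoef]
    simp only [Hper.toEll2_apply, h]
    exact (tendsto_fcoef hf κ i).const_mul _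
  exact tendsto_nhds_unique hfκ hUκ

lemma Hper.completeSpace (hr : 0 ≤ r) : CompleteSpace (Hper L r) := by
  refine Metric.complete_of_cauchySeq_tendsto fun u hu => ?_
  obtain ⟨U, hU⟩ := cauchySeq_tendsto_of_complete
    (Hper.isometry_toEll2.uniformContinuous.comp_cauchySeq hu)
  obtain ⟨f, hf⟩ := cauchySeq_tendsto_of_complete
    ((Hper.toL2L L hr).uniformContinuous.comp_cauchySeq hu)
  have hcoef : wcoef r f = U := Hper.wcoef_eq_of_tendsto hU hf
  let v : Hper L r := ⟨f, (inSobolev_iff r f).2 (hcoef ▸ U.2)⟩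
  have hv : Hper.toEll2 L r v = U := Subtype.ext hcoef
  refine ⟨v, Hper.isometry_toEll2.isUniformInducing.isInducing.tendsto_nhds_iff.2 ?_⟩
  rwa [hv]

/-- The essentially bounded elements of `H^r × H^r`. -/
def essBounded (L : ℝ) [Fact (0 < L)] (r : ℝ) : Submodule ℝ (Hper L r) where
  carrier := {v | ∃ M : ℝ, ∀ᵐ x, ‖v x‖ ≤ M}
  zero_mem' := by
    refine ⟨0, ?_⟩
    filter_upwards [Lp.coeFn_zero Plane 2 (volume : Measure (AddCircle L))] with x hx
    change ‖((0 : L2per L) : AddCircle L → Plane) x‖ ≤ 0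
    rw [hx]
    simp
  add_mem' := by
    rintro u v ⟨M, hM⟩ ⟨M', hM'⟩
    refine ⟨M + M', ?_⟩
    filter_upwards [hM, hM', Hper.coeFn_add u v] with x h1 h2 h3
    rw [h3]
    exact norm_add_le_of_le h1 h2
  smul_mem' := by
    rintro t u ⟨M, hM⟩
    refine ⟨|t| * M, ?_⟩
    filter_upwards [hM, Hper.coeFn_smul t u] with x h1 h3
    rw [h3, Pi.smul_apply, norm_smul, Real.norm_eq_abs]
    gcongr

lemma SmoothPer.exists_bound (f : SmoothPer L) : ∃ M : ℝ, ∀ x, ‖f x‖ ≤ M := by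
  obtain ⟨M, hM⟩ := isCompact_univ.exists_bound_of_continuousOn f.continuous.continuousOn
  exact ⟨M, fun x => hM x (mem_univ x)⟩

lemma SmoothPer.toHper_mem_essBounded (f : SmoothPer L) : f.toHper r ∈ essBounded L r := by
  obtain ⟨M, hM⟩ := f.exists_bound
  refine ⟨M, ?_⟩
  filter_upwards [f.coeFn_toHper r] with x hx
  rw [hx]
  exact hM x

lemma Hper.eq_zero_of_inner_mode {u : Hper L r}
    (h : ∀ κ b, inner ℝ u ((mode L κ b).toHper r) = 0) : u = 0 := by
  have hcoef : ∀ κ i, fcoef u κ i = 0 := by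
    intro κ i
    have hinner := h κ (fcoef u κ)
    rw [Hper.inner_eq, symbolForm_mode _ (weight_neg r)] at hinner
    have hterm : symbolTerm (weight r) u u κ = 0 := hinner
    rw [symbolTerm_weight_self, mul_eq_zero_iff_left (by positivity),
      Finset.sum_eq_zero_iff_of_nonneg fun _ _ => sq_nonneg _] at hterm
    simpa using hterm i (Finset.mem_univ i)
  refine Hper.ext_fcoef fun κ i => ?_
  have hz := Hper.fcoef_sub u u κ i
  rw [sub_self, sub_self] at hz
  rw [hcoef, hz]

lemma dense_essBounded (hr : 0 ≤ r) : Dense (essBounded L r : Set (Hper L r)) := by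
  have := Hper.completeSpace (L := L) hr
  rw [Submodule.dense_iff_topologicalClosure_eq_top, Submodule.topologicalClosure_eq_top_iff,
    Submodule.eq_bot_iff]
  intro u hu
  refine Hper.eq_zero_of_inner_mode fun κ b => ?_
  exact (Submodule.mem_orthogonal' _ _).1 hu _ (SmoothPer.toHper_mem_essBounded _)

lemma summable_weight_neg (hr : 1 < 2 * r) : Summable fun κ : ℤ => (1 + (κ : ℝ) ^ 2) ^ (-r) := by
  refine Summable.of_norm_bounded_eventually (Real.summable_abs_int_rpow hr) ?_
  have hf : ∀ᶠ κ : ℤ in cofinite, κ ≠ 0 := by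
    rw [eventually_cofinite]
    simp
  filter_upwards [hf] with κ hκ
  have hpos : (0 : ℝ) < |(κ : ℝ)| := by positivity
  rw [Real.norm_of_nonneg (by positivity)]
  have hexp : |(κ : ℝ)| ^ (-(2 * r)) = (|(κ : ℝ)| ^ 2) ^ (-r) := by
    rw [← Real.rpow_natCast, ← Real.rpow_mul hpos.le]
    congr 1
    push_cast
    ring
  rw [hexp]
  refine Real.rpow_le_rpow_of_nonpos (by positivity) ?_ (by linarith)
  rw [sq_abs]
  linarith

lemma summable_norm_fcoef_and_tsum_le (hr : 1 < 2 * r) (u : Hper L r) (i : Fin 2) :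
    (Summable fun κ => ‖fcoef u κ i‖) ∧
      ∑' κ, ‖fcoef u κ i‖ ≤ √(∑' κ : ℤ, (1 + (κ : ℝ) ^ 2) ^ (-r)) * ‖u‖ := by
  have hw (κ : ℤ) : ((1 + (κ : ℝ) ^ 2) ^ (-(r / 2))) ^ (2 : ℝ) = (1 + (κ : ℝ) ^ 2) ^ (-r) := by
    rw [← Real.rpow_mul (by positivity)]
    congr 1
    ring
  have hu : ‖u‖ = (∑' κ, ‖Hper.toEll2 L r u κ‖ ^ (2 : ℝ)) ^ (1 / (2 : ℝ)) := by
    rw [← Hper.isometry_toEll2.norm_map_of_map_zero (map_zero _)]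
    simpa using lp.norm_eq_tsum_rpow (p := 2) (by norm_num) (Hper.toEll2 L r u)
  have hsq : Summable fun κ => ‖Hper.toEll2 L r u κ‖ ^ (2 : ℝ) := by
    simpa using (lp.memℓp (Hper.toEll2 L r u)).summable (by norm_num)
  have hCS := Real.summable_and_inner_le_Lp_mul_Lq_tsum_of_nonneg .two_two
    (f := fun κ : ℤ => (1 + (κ : ℝ) ^ 2) ^ (-(r / 2))) (fun κ => by positivity)
    (fun κ => norm_nonneg (Hper.toEll2 L r u κ))
    (by simpa only [hw] using summable_weight_neg hr) hsq
  simp only [hw, ← hu, ← Real.sqrt_eq_rpow] at hCS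
  have hle (κ : ℤ) :
      ‖fcoef u κ i‖ ≤ (1 + (κ : ℝ) ^ 2) ^ (-(r / 2)) * ‖Hper.toEll2 L r u κ‖ := by
    rw [Real.rpow_neg (by positivity), ← div_eq_inv_mul, le_div_iff₀' (by positivity)]
    exact u.weight_mul_norm_fcoef_le κ i
  have hs := Summable.of_nonneg_of_le (fun _ => norm_nonneg _) hle hCS.1
  exact ⟨hs, (hs.tsum_le_tsum hle hCS.1).trans hCS.2⟩

lemma ae_norm_apply_le_tsum_norm_fcoef {f : AddCircle L → Plane} (hf : MemLp f 2) {i : Fin 2}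
    (hs : Summable fun κ => ‖fcoef f κ i‖) : ∀ᵐ x, ‖f x i‖ ≤ ∑' κ, ‖fcoef f κ i‖ := by
  have hfi := memLp_ofReal_apply hf i
  have hnorm (κ : ℤ) : ‖fcoef f κ i • fourier (T := L) κ‖ = ‖fcoef f κ i‖ := by
    rw [norm_smul, fourier_norm, mul_one]
  have hs' : Summable fun κ : ℤ => ‖fcoef f κ i • fourier (T := L) κ‖ := by
    simpa only [hnorm] using hs
  obtain ⟨g, hg⟩ := hs'.of_norm
  have hgn : ‖g‖ ≤ ∑' κ, ‖fcoef f κ i‖ := by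
    rw [← hg.tsum_eq]
    simpa only [hnorm] using norm_tsum_le_tsum_norm hs'
  have hgf : ContinuousMap.toLp 2 AddCircle.haarAddCircle ℂ g = hfi.toLp _ := by
    refine (hg.mapL (ContinuousMap.toLp 2 AddCircle.haarAddCircle ℂ)).unique ?_
    convert hasSum_fourier_series_L2 (hfi.toLp _) using 2 with κ
    rw [map_smul, fourierCoeff_congr_ae hfi.coeFn_toLp]
    rfl
  have hae : ∀ᵐ x ∂(AddCircle.haarAddCircle : Measure (AddCircle L)),
      ‖f x i‖ ≤ ∑' κ, ‖fcoef f κ i‖ := by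
    filter_upwards [hfi.coeFn_toLp, ContinuousMap.coeFn_toLp (p := 2) (𝕜 := ℂ)
      AddCircle.haarAddCircle g] with x hx hx'
    rw [hgf, hx] at hx'
    simpa only [← hx', Complex.norm_real] using (g.norm_coe_le_norm x).trans hgn
  exact Measure.ae_smul_measure hae (ENNReal.ofReal L)

lemma exists_sup_norm_le (hr : 1 < 2 * r) :
    ∃ M : ℝ, ∀ u : Hper L r, ∀ᵐ x, ‖u x‖ ≤ M * ‖u‖ := by
  set M := √(∑' κ : ℤ, (1 + (κ : ℝ) ^ 2) ^ (-r))
  have hcomp (u : Hper L r) (i : Fin 2) : ∀ᵐ x, ‖u x i‖ ≤ M * ‖u‖ := by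
    obtain ⟨hs, hle⟩ := summable_norm_fcoef_and_tsum_le hr u i
    filter_upwards [ae_norm_apply_le_tsum_norm_fcoef u.memLp hs] with x hx
    exact hx.trans hle
  refine ⟨2 * M, fun u => ?_⟩
  filter_upwards [hcomp u 0, hcomp u 1] with x h0 h1
  refine le_of_sq_le_sq ?_ (by positivity)
  rw [EuclideanSpace.norm_sq_eq, Fin.sum_univ_two]
  have hsq₀ : ‖u x 0‖ ^ 2 ≤ (M * ‖u‖) ^ 2 := by gcongr
  have hsq₁ : ‖u x 1‖ ^ 2 ≤ (M * ‖u‖) ^ 2 := by gcongr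
  nlinarith [sq_nonneg (M * ‖u‖)]

end SobolevSpace

section Translation

lemma fourier_eval_add {L : ℝ} (κ : ℤ) (x y : AddCircle L) :
    fourier κ (x + y) = fourier κ x * fourier κ y := by
  rw [fourier_apply, fourier_apply, fourier_apply, ← Circle.coe_mul, ← AddCircle.toCircle_add,
    zsmul_add]

variable {L : ℝ} [Fact (0 < L)] {r : ℝ}

lemma translate_coeFn (y : ℝ) (u : Hper L r) :
    (translate y u : AddCircle L → Plane) =ᵐ[volume] fun x => u (x + (y : AddCircle L)) :=
  Lp.coeFn_compMeasurePreserving u.toL2 (measurePreserving_add_right volume (y : AddCircle L))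

lemma fcoef_translate_Hper (y : ℝ) (u : Hper L r) (κ : ℤ) (i : Fin 2) :
    fcoef (translate y u) κ i = fourier κ (y : AddCircle L) * fcoef u κ i := by
  rw [fcoef_congr (translate_coeFn y u), fcoef_translate]

lemma translate_sub (y : ℝ) (u v : Hper L r) :
    translate y (u - v) = translate y u - translate y v := by
  refine Hper.ext_fcoef fun κ i => ?_
  rw [Hper.fcoef_sub, fcoef_translate_Hper, fcoef_translate_Hper, fcoef_translate_Hper,
    Hper.fcoef_sub, mul_sub]

lemma translate_translate (y z : ℝ) (u : Hper L r) :
    translate y (translate z u) = translate (y + z) u := by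
  refine Hper.ext_fcoef fun κ i => ?_
  rw [fcoef_translate_Hper, fcoef_translate_Hper, fcoef_translate_Hper, AddCircle.coe_add,
    fourier_eval_add, mul_assoc]

lemma translate_zero (u : Hper L r) : translate 0 u = u := by
  refine Hper.ext_fcoef fun κ i => ?_
  rw [fcoef_translate_Hper, AddCircle.coe_zero, fourier_eval_zero, one_mul]

lemma translate_add_period (y : ℝ) (u : Hper L r) : translate (y + L) u = translate y u := by
  refine Hper.ext_fcoef fun κ i => ?_
  rw [fcoef_translate_Hper, fcoef_translate_Hper, AddCircle.coe_add_period]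

lemma Hper.norm_le_of_fcoef_le {u v : Hper L r} {C : ℝ} (hC : 0 ≤ C)
    (h : ∀ κ i, ‖fcoef u κ i‖ ≤ C * ‖fcoef v κ i‖) : ‖u‖ ≤ C * ‖v‖ := by
  refine le_of_sq_le_sq ?_ (by positivity)
  rw [mul_pow, Hper.norm_sq, Hper.norm_sq, ← tsum_mul_left]
  refine u.summable_norm_sq.tsum_le_tsum (fun κ => ?_) (v.summable_norm_sq.mul_left _)
  rw [mul_left_comm]
  gcongr
  rw [Finset.mul_sum]
  refine Finset.sum_le_sum fun i _ => ?_
  rw [← mul_pow]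
  gcongr
  exact h κ i

lemma norm_translate (y : ℝ) (u : Hper L r) : ‖translate y u‖ = ‖u‖ := by
  have hle : ∀ (y : ℝ) (u : Hper L r), ‖translate y u‖ ≤ ‖u‖ := fun y u => by
    simpa using Hper.norm_le_of_fcoef_le zero_le_one (u := translate y u) (v := u) fun κ i => by
      rw [fcoef_translate_Hper, norm_mul, fourier_apply, Circle.norm_coe]
  refine le_antisymm (hle y u) ?_
  have h := hle (-y) (translate y u)
  rwa [translate_translate, neg_add_cancel, translate_zero] at h

lemma norm_sub_translate (y : ℝ) (u v : Hper L r) :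
    ‖u - translate y v‖ = ‖translate (-y) u - v‖ := by
  rw [← norm_translate (-y) (u - translate y v), translate_sub, translate_translate,
    neg_add_cancel, translate_zero]

lemma SmoothPer.fcoef_deriv_eq (f : SmoothPer L) (κ : ℤ) (i : Fin 2) :
    fcoef f.deriv κ i = 2 * Real.pi * Complex.I * κ / L * fcoef f κ i := by
  have hd : ∀ x : ℝ, HasDerivAt (fun x : ℝ => ((f (x : AddCircle L) i : ℝ) : ℂ))
      ((f.deriv (x : AddCircle L) i : ℝ) : ℂ) x := fun x =>
    ((EuclideanSpace.proj (𝕜 := ℝ) i).hasFDerivAt.comp_hasDerivAt x (f.hasDerivAt x)).ofReal_comp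
  have hcont : ∀ g : SmoothPer L, Continuous fun x : ℝ => ((g (x : AddCircle L) i : ℝ) : ℂ) :=
    fun g => Complex.continuous_ofReal.comp
      ((EuclideanSpace.proj (𝕜 := ℝ) i).continuous.comp g.smooth.continuous)
  have hfc : Continuous fun x : ℝ => fourier (-κ) (x : AddCircle L) :=
    (fourier (-κ)).continuous.comp (AddCircle.continuous_mk' L)
  have hprod : ∀ x : ℝ, HasDerivAt
      (fun x : ℝ => fourier (-κ) (x : AddCircle L) * ((f (x : AddCircle L) i : ℝ) : ℂ))
      (-2 * Real.pi * Complex.I * κ / L * (fourier (-κ) (x : AddCircle L) •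
          ((f (x : AddCircle L) i : ℝ) : ℂ)) +
        fourier (-κ) (x : AddCircle L) • ((f.deriv (x : AddCircle L) i : ℝ) : ℂ)) x := fun x => by
    refine ((hasDerivAt_fourier_neg L κ x).mul (hd x)).congr_deriv ?_
    simp only [smul_eq_mul]
    ring
  have hint : IntervalIntegrable (fun x : ℝ => fourier (-κ) (x : AddCircle L) •
      ((f (x : AddCircle L) i : ℝ) : ℂ)) volume 0 (0 + L) :=
    (hfc.smul (hcont f)).intervalIntegrable _ _
  have hint_deriv : IntervalIntegrable (fun x : ℝ => fourier (-κ) (x : AddCircle L) •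
      ((f.deriv (x : AddCircle L) i : ℝ) : ℂ)) volume 0 (0 + L) :=
    (hfc.smul (hcont f.deriv)).intervalIntegrable _ _
  have h := intervalIntegral.integral_eq_sub_of_hasDerivAt (fun x _ => hprod x)
    ((hint.const_mul _).add hint_deriv)
  rw [intervalIntegral.integral_add (hint.const_mul _) hint_deriv,
    intervalIntegral.integral_const_mul, AddCircle.coe_add_period, sub_self] at h
  rw [fcoef, fcoef, fourierCoeff_eq_intervalIntegral _ _ 0, fourierCoeff_eq_intervalIntegral _ _ 0,
    eq_neg_of_add_eq_zero_right h, Complex.real_smul, Complex.real_smul]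
  ring

lemma norm_exp_mul_I_sub_le (t : ℝ) :
    ‖Complex.exp (t * Complex.I) - 1 - t * Complex.I‖ ≤ 3 * t ^ 2 := by
  have hn : ‖(t : ℂ) * Complex.I‖ = |t| := by simp
  rcases le_total |t| 1 with h | h
  · have := Complex.norm_exp_sub_one_sub_id_le (x := t * Complex.I) (by rw [hn]; exact h)
    rw [hn, sq_abs] at this
    nlinarith [sq_nonneg t]
  · have hexp : ‖Complex.exp (t * Complex.I)‖ = 1 := Complex.norm_exp_ofReal_mul_I t
    have htri := norm_sub_le (Complex.exp (t * Complex.I) - 1) (t * Complex.I)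
    have htri_one := norm_sub_le (Complex.exp (t * Complex.I)) 1
    rw [hn] at htri
    rw [hexp, norm_one] at htri_one
    nlinarith [sq_abs t]

lemma SmoothPer.fcoef_toHper (f : SmoothPer L) (r : ℝ) : fcoef (f.toHper r) = fcoef f :=
  fcoef_congr (f.coeFn_toHper r)

lemma SmoothPer.norm_translate_sub_le (f : SmoothPer L) (h : ℝ) :
    ‖translate h (f.toHper r) - f.toHper r - h • f.deriv.toHper r‖ ≤
      3 * h ^ 2 * ‖f.deriv.deriv.toHper r‖ := by
  have hL : (0 : ℝ) < L := Fact.out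
  refine Hper.norm_le_of_fcoef_le (by positivity) fun κ i => ?_
  have hexponent : (2 * Real.pi * Complex.I * κ * h / L : ℂ) =
      ((2 * Real.pi * κ * h / L : ℝ) : ℂ) * Complex.I := by
    push_cast
    ring
  have hremainder :
      fcoef (translate h (f.toHper r) - f.toHper r - h • f.deriv.toHper r : Hper L r) κ i =
      (Complex.exp (((2 * Real.pi * κ * h / L : ℝ) : ℂ) * Complex.I) - 1 -
        ((2 * Real.pi * κ * h / L : ℝ) : ℂ) * Complex.I) * fcoef f κ i := by
    rw [Hper.fcoef_sub, Hper.fcoef_sub, Hper.fcoef_smul, fcoef_translate_Hper, fcoef_toHper,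
      fcoef_toHper, fcoef_deriv_eq, fourier_coe_apply, ← hexponent]
    ring
  have hderiv : ‖fcoef f.deriv.deriv κ i‖ = (2 * Real.pi * κ / L) ^ 2 * ‖fcoef f κ i‖ := by
    rw [fcoef_deriv_eq, fcoef_deriv_eq, ← mul_assoc, norm_mul, ← pow_two, norm_pow]
    congr 1
    rw [norm_div, norm_mul, norm_mul, norm_mul, Complex.norm_I, Complex.norm_intCast,
      Complex.norm_real, Complex.norm_real, Real.norm_of_nonneg hL.le,
      Real.norm_of_nonneg Real.pi_pos.le, Complex.norm_ofNat, div_pow, div_pow, mul_pow, mul_pow,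
      sq_abs]
    ring
  rw [hremainder, norm_mul, fcoef_toHper, hderiv]
  calc _ ≤ (3 * (2 * Real.pi * κ * h / L) ^ 2) * ‖fcoef f κ i‖ := by
        gcongr
        exact norm_exp_mul_I_sub_le _
    _ = _ := by ring

lemma SmoothPer.hasDerivAt_translate (f : SmoothPer L) (r : ℝ) :
    HasDerivAt (fun h : ℝ => translate h (f.toHper r)) (f.deriv.toHper r) 0 := by
  rw [hasDerivAt_iff_isLittleO]
  simp only [translate_zero, sub_zero]
  refine Asymptotics.IsBigO.trans_isLittleO (g := fun h : ℝ => h ^ 2) ?_ ?_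
  · refine Asymptotics.IsBigO.of_bound (3 * ‖f.deriv.deriv.toHper r‖)
      (Eventually.of_forall fun h => (f.norm_translate_sub_le h).trans (le_of_eq ?_))
    rw [Real.norm_of_nonneg (sq_nonneg h)]
    ring
  · exact Asymptotics.isLittleO_pow_id one_lt_two

lemma SmoothPer.continuous_translate (f : SmoothPer L) (r : ℝ) :
    Continuous fun h : ℝ => translate h (f.toHper r) := by
  rw [continuous_iff_continuousAt]
  intro y
  have hzero := (f.hasDerivAt_translate r).continuousAt.tendsto
  have hshift : Tendsto (fun h : ℝ => h - y) (𝓝 y) (𝓝 0) := by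
    simpa using (continuous_sub_right y).tendsto y
  have hlim := hzero.comp hshift
  rw [tendsto_iff_norm_sub_tendsto_zero] at hlim
  rw [ContinuousAt, tendsto_iff_norm_sub_tendsto_zero]
  refine hlim.congr fun h => ?_
  rw [Function.comp, translate_zero, ← norm_translate y, translate_sub, translate_translate,
    add_sub_cancel]

lemma rho_le (u v : Hper L r) (y : ℝ) : rho u v ≤ ‖u - translate y v‖ :=
  ciInf_le ⟨0, by rintro _ ⟨y, rfl⟩; exact norm_nonneg _⟩ y

lemma continuous_rho (v : Hper L r) : Continuous fun u => rho u v := by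
  refine (LipschitzWith.of_le_add fun u w => ?_ : LipschitzWith 1 fun u => rho u v).continuous
  rw [← sub_le_iff_le_add]
  refine le_ciInf fun y => ?_
  rw [sub_le_iff_le_add, dist_eq_norm]
  refine (rho_le u v y).trans ?_
  have := norm_add_le (w - translate y v) (u - w)
  rwa [sub_add_sub_comm, add_comm w u, add_sub_add_right_eq_sub] at this

lemma SmoothPer.exists_rho_eq (f : SmoothPer L) (u : Hper L r) :
    ∃ y : ℝ, rho u (f.toHper r) = ‖translate y u - f.toHper r‖ ∧
      inner ℝ (f.deriv.toHper r) (translate y u - f.toHper r) = 0 := by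
  have hL : (0 : ℝ) < L := Fact.out
  have hper : Function.Periodic (fun y : ℝ => ‖u - translate y (f.toHper r)‖) L := fun y => by
    change ‖u - translate (y + L) (f.toHper r)‖ = _
    rw [translate_add_period]
  have hcont : Continuous fun y : ℝ => ‖u - translate y (f.toHper r)‖ :=
    (continuous_const.sub (f.continuous_translate r)).norm
  obtain ⟨_, ⟨y, rfl⟩, hy⟩ := (hper.compact_of_continuous hL.ne' hcont).exists_isLeast
    (range_nonempty _)
  have hmin : ∀ z, ‖u - translate y (f.toHper r)‖ ≤ ‖u - translate z (f.toHper r)‖ := fun z =>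
    hy ⟨z, rfl⟩
  refine ⟨-y, ?_, ?_⟩
  · rw [← norm_sub_translate]
    exact le_antisymm (rho_le _ _ _) (le_ciInf hmin)
  · set v := translate (-y) u
    have hd := ((f.hasDerivAt_translate r).const_sub v).norm_sq
    have hloc : IsLocalMin (fun h : ℝ => ‖v - translate h (f.toHper r)‖ ^ 2) 0 := by
      refine Eventually.of_forall fun h => ?_
      have hle := hmin (y + h)
      rw [norm_sub_translate y, norm_sub_translate (y + h), neg_add_rev, ← translate_translate,
        ← norm_sub_translate h] at hle
      simp only [translate_zero]
      gcongr
    have hderiv := hloc.hasDerivAt_eq_zero hd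
    rw [translate_zero, inner_neg_right] at hderiv
    rw [real_inner_comm]
    linarith

end Translation

section Symbol

variable {m : ℤ → Matrix (Fin 2) (Fin 2) ℝ} {s : ℝ}

lemma IsSymbol.exists_quadratic_bounds (hm : IsSymbol m s) : ∃ c₁ c₂ : ℝ, 0 < c₁ ∧ 0 < c₂ ∧
    ∀ (κ : ℤ) (x y : ℝ),
      c₁ * |(κ : ℝ)| ^ s * (x ^ 2 + y ^ 2) ≤
        m κ 0 0 * x ^ 2 + 2 * m κ 0 1 * (x * y) + m κ 1 1 * y ^ 2 ∧
      m κ 0 0 * x ^ 2 + 2 * m κ 0 1 * (x * y) + m κ 1 1 * y ^ 2 ≤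
        c₂ * |(κ : ℝ)| ^ s * (x ^ 2 + y ^ 2) := by
  obtain ⟨c₁, c₂, hc₁, hc₂, hb⟩ := hm.elliptic
  refine ⟨c₁, c₂, hc₁, hc₂, fun κ x y => ?_⟩
  have hsym : m κ 1 0 = m κ 0 1 := (hm.symm κ).apply 0 1
  rcases eq_or_ne (!₂[x, y] : Plane) 0 with hw | hw
  · have hx : x = 0 := congrArg (fun w : Plane => w 0) hw
    have hy : y = 0 := congrArg (fun w : Plane => w 1) hw
    simp [hx, hy]
  · have hn : 0 < ‖(!₂[x, y] : Plane)‖ := norm_pos_iff.2 hw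
    have hsq : ‖(!₂[x, y] : Plane)‖ ^ 2 = x ^ 2 + y ^ 2 := by
      rw [EuclideanSpace.norm_sq_eq, Fin.sum_univ_two]
      simp
    have h := hb κ (‖(!₂[x, y] : Plane)‖⁻¹ • !₂[x, y])
      (by rw [norm_smul, norm_inv, norm_norm, inv_mul_cancel₀ hn.ne'])
    set t := ‖(!₂[x, y] : Plane)‖
    have hform : ∑ i, ∑ j, m κ i j * (t⁻¹ • !₂[x, y] : Plane) j * (t⁻¹ • !₂[x, y] : Plane) i =
        (m κ 0 0 * x ^ 2 + 2 * m κ 0 1 * (x * y) + m κ 1 1 * y ^ 2) / t ^ 2 := by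
      simp only [Fin.sum_univ_two, PiLp.smul_apply, smul_eq_mul, hsym, Matrix.cons_val_zero,
        Matrix.cons_val_one]
      field_simp
      ring
    rw [hform, le_div_iff₀ (by positivity), div_le_iff₀ (by positivity)] at h
    rwa [← hsq]

lemma abs_rpow_eq_sq_rpow_half (x s : ℝ) : |x| ^ s = (x ^ 2) ^ (s / 2) := by
  rw [← sq_abs, ← Real.rpow_natCast, ← Real.rpow_mul (abs_nonneg _)]
  congr 1
  push_cast
  ring

lemma abs_rpow_le_weight (hs : 0 ≤ s) (κ : ℤ) :
    |(κ : ℝ)| ^ s ≤ (1 + (κ : ℝ) ^ 2) ^ (s / 2) := by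
  rw [abs_rpow_eq_sq_rpow_half]
  gcongr
  linarith

lemma weight_le_abs_rpow (hs : 0 < s) (κ : ℤ) :
    (1 + (κ : ℝ) ^ 2) ^ (s / 2) ≤ 2 ^ (s / 2) * |(κ : ℝ)| ^ s + 1 := by
  rcases eq_or_ne κ 0 with rfl | hκ
  · simp [Real.zero_rpow hs.ne']
  · have hsq : (1 : ℝ) ≤ (κ : ℝ) ^ 2 := by
      rw [← sq_abs]
      have : (1 : ℝ) ≤ |(κ : ℝ)| := by exact_mod_cast Int.one_le_abs hκ
      nlinarith
    rw [abs_rpow_eq_sq_rpow_half, ← Real.mul_rpow (by norm_num) (by positivity)]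
    have : (1 + (κ : ℝ) ^ 2) ^ (s / 2) ≤ (2 * (κ : ℝ) ^ 2) ^ (s / 2) := by
      gcongr
      linarith
    linarith

lemma weight_le_abs_rpow_sq (hs : 0 < s) (κ : ℤ) :
    (1 + (κ : ℝ) ^ 2) ^ s ≤ 2 * (2 ^ (s / 2)) ^ 2 * (|(κ : ℝ)| ^ s) ^ 2 + 2 := by
  have hsq : (1 + (κ : ℝ) ^ 2) ^ s = ((1 + (κ : ℝ) ^ 2) ^ (s / 2)) ^ 2 := by
    rw [← Real.rpow_natCast ((1 + (κ : ℝ) ^ 2) ^ (s / 2)) 2, ← Real.rpow_mul (by positivity)]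
    norm_num
  rw [hsq]
  calc ((1 + (κ : ℝ) ^ 2) ^ (s / 2)) ^ 2 ≤ (2 ^ (s / 2) * |(κ : ℝ)| ^ s + 1) ^ 2 := by
        gcongr
        exact weight_le_abs_rpow hs κ
    _ ≤ _ := by nlinarith [sq_nonneg (2 ^ (s / 2) * |(κ : ℝ)| ^ s - 1)]

lemma IsSymbol.symbolBound (hs : 0 ≤ s) (hm : IsSymbol m s) :
    ∃ C, SymbolBound (s / 2) m C := by
  obtain ⟨c₁, c₂, hc₁, hc₂, hb⟩ := hm.exists_quadratic_bounds
  refine ⟨c₂, fun κ i j => ?_⟩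
  have hsym : m κ 1 0 = m κ 0 1 := (hm.symm κ).apply 0 1
  have hP : 0 ≤ c₁ * |(κ : ℝ)| ^ s := by positivity
  have hle : c₂ * |(κ : ℝ)| ^ s ≤ c₂ * (1 + (κ : ℝ) ^ 2) ^ (s / 2) := by
    gcongr
    exact abs_rpow_le_weight hs κ
  refine le_trans ?_ hle
  -- Diagonal entries are values of the form at the basis vectors, the off-diagonal entry is
  -- recovered from `(1, 1)` and `(1, -1)` by polarization.
  fin_cases i <;> fin_cases j <;> simp only [Fin.zero_eta, Fin.mk_one, hsym] <;> rw [abs_le] <;>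
    constructor <;> linarith [hb κ 1 0, hb κ 0 1, hb κ 1 1, hb κ 1 (-1)]

variable {L : ℝ} [Fact (0 < L)]

lemma symbolTerm_self_eq (hm : IsSymbol m s) (f : AddCircle L → Plane) (κ : ℤ) :
    symbolTerm m f f κ =
      (m κ 0 0 * (fcoef f κ 0).re ^ 2 + 2 * m κ 0 1 * ((fcoef f κ 0).re * (fcoef f κ 1).re) +
        m κ 1 1 * (fcoef f κ 1).re ^ 2) +
      (m κ 0 0 * (fcoef f κ 0).im ^ 2 + 2 * m κ 0 1 * ((fcoef f κ 0).im * (fcoef f κ 1).im) +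
        m κ 1 1 * (fcoef f κ 1).im ^ 2) := by
  have hsym : m κ 1 0 = m κ 0 1 := (hm.symm κ).apply 0 1
  simp only [symbolTerm, Fin.sum_univ_two, hsym, Complex.mul_re, Complex.conj_re, Complex.conj_im]
  ring

lemma IsSymbol.exists_symbolTerm_lower_bound (hm : IsSymbol m s) (L : ℝ) [Fact (0 < L)] :
    ∃ c₁ : ℝ, 0 < c₁ ∧ ∀ (f : AddCircle L → Plane) (κ : ℤ),
      c₁ * |(κ : ℝ)| ^ s * ∑ i, ‖fcoef f κ i‖ ^ 2 ≤ symbolTerm m f f κ := by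
  obtain ⟨c₁, _, hc₁, -, hb⟩ := hm.exists_quadratic_bounds
  refine ⟨c₁, hc₁, fun f κ => ?_⟩
  rw [symbolTerm_self_eq hm, Fin.sum_univ_two, ← Complex.normSq_eq_norm_sq,
    ← Complex.normSq_eq_norm_sq, Complex.normSq_apply, Complex.normSq_apply]
  linarith [(hb κ (fcoef f κ 0).re (fcoef f κ 1).re).1,
    (hb κ (fcoef f κ 0).im (fcoef f κ 1).im).1]

lemma IsDispersion.symbolTerm_eq {f g : AddCircle L → Plane} (h : IsDispersion m f g)
    (w : AddCircle L → Plane) (κ : ℤ) :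
    symbolTerm m f w κ = ∑ i, (fcoef g κ i * starRingEnd ℂ (fcoef w κ i)).re := by
  refine Finset.sum_congr rfl fun i _ => ?_
  rw [h, Finset.sum_mul, Complex.re_sum]
  refine Finset.sum_congr rfl fun j _ => ?_
  rw [mul_assoc, Complex.re_ofReal_mul]

lemma IsDispersion.dispersionForm_eq {f g w : AddCircle L → Plane} (h : IsDispersion m f g)
    (hg : MemLp g 2) (hw : MemLp w 2) : dispersionForm m f w = ∫ x, inner ℝ (g x) (w x) := by
  have hL : (0 : ℝ) < L := Fact.out
  rw [← mul_inv_cancel_left₀ hL.ne' (∫ x, inner ℝ (g x) (w x)),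
    ← (hasSum_fcoef_mul_conj hg hw).tsum_eq]
  exact congrArg (L * ·) (tsum_congr (h.symbolTerm_eq w))

lemma dispersionForm_mode (hm : IsSymbol m s) (f : AddCircle L → Plane) (κ : ℤ) (b : Fin 2 → ℂ) :
    dispersionForm m f (mode L κ b) =
      L * ∑ i, ∑ j, m κ i j * (fcoef f κ j * starRingEnd ℂ (b i)).re :=
  congrArg (L * ·) (hasSum_symbolTerm_mode hm.even f κ b).tsum_eq

lemma integral_inner_mode {g : AddCircle L → Plane} (hg : MemLp g 2) (κ : ℤ) (b : Fin 2 → ℂ) :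
    ∫ x, inner ℝ (g x) (mode L κ b x) = L * ∑ i, (fcoef g κ i * starRingEnd ℂ (b i)).re := by
  have hL : (0 : ℝ) < L := Fact.out
  have hterm : symbolTerm (weight 0) g (mode L κ b) =
      fun κ' => ∑ i, (fcoef g κ' i * starRingEnd ℂ (fcoef (mode L κ b) κ' i)).re := by
    funext κ'
    rw [symbolTerm_weight, Real.rpow_zero, one_mul]
  have hsum := hasSum_symbolTerm_mode (weight_neg 0) g κ b
  rw [hterm] at hsum
  rw [← mul_inv_cancel_left₀ hL.ne' (∫ x, inner ℝ (g x) (mode L κ b x)),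
    (hasSum_fcoef_mul_conj hg (mode L κ b).memLp).unique hsum]
  simp [weight, Matrix.one_apply]

lemma isDispersion_of_mode (hm : IsSymbol m s) {f g : AddCircle L → Plane} (hg : MemLp g 2)
    (h : ∀ κ b, dispersionForm m f (mode L κ b) = ∫ x, inner ℝ (g x) (mode L κ b x)) :
    IsDispersion m f g := by
  have hL : (0 : ℝ) < L := Fact.out
  intro κ
  set b : Fin 2 → ℂ := fun i => ∑ j, (m κ i j : ℂ) * fcoef f κ j - fcoef g κ i with hb
  have htest : ∑ i, ∑ j, m κ i j * (fcoef f κ j * starRingEnd ℂ (b i)).re =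
      ∑ i, (fcoef g κ i * starRingEnd ℂ (b i)).re := by
    have := h κ b
    rwa [dispersionForm_mode hm, integral_inner_mode hg, mul_right_inj' hL.ne'] at this
  have hnorm_sq : ∀ i, ‖b i‖ ^ 2 = (∑ j, m κ i j * (fcoef f κ j * starRingEnd ℂ (b i)).re) -
      (fcoef g κ i * starRingEnd ℂ (b i)).re := by
    intro i
    rw [← Complex.normSq_eq_norm_sq, ← Complex.ofReal_re (Complex.normSq (b i)),
      ← Complex.mul_conj]
    nth_rewrite 1 [hb]
    simp only [sub_mul, Complex.sub_re, Finset.sum_mul, Complex.re_sum, mul_assoc,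
      Complex.re_ofReal_mul]
  have hzero : ∑ i, ‖b i‖ ^ 2 = 0 := by
    rw [Finset.sum_congr rfl fun i _ => hnorm_sq i, Finset.sum_sub_distrib, htest, sub_self]
  rw [Finset.sum_eq_zero_iff_of_nonneg fun _ _ => sq_nonneg _] at hzero
  intro i
  have hbi : b i = 0 := by simpa using hzero i (Finset.mem_univ i)
  exact (sub_eq_zero.1 hbi).symm

lemma IsDispersion.sq_mul_sum_norm_fcoef_sq_le {f g : AddCircle L → Plane}
    (h : IsDispersion m f g) {κ : ℤ} {a : ℝ} (ha : 0 ≤ a)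
    (hlow : a * ∑ i, ‖fcoef f κ i‖ ^ 2 ≤ symbolTerm m f f κ) :
    a ^ 2 * ∑ i, ‖fcoef f κ i‖ ^ 2 ≤ ∑ i, ‖fcoef g κ i‖ ^ 2 := by
  have hyoung : 2 * a * symbolTerm m f f κ ≤
      ∑ i, ‖fcoef g κ i‖ ^ 2 + a ^ 2 * ∑ i, ‖fcoef f κ i‖ ^ 2 := by
    rw [h.symbolTerm_eq, Finset.mul_sum, Finset.mul_sum, ← Finset.sum_add_distrib]
    refine Finset.sum_le_sum fun i _ => ?_
    have hcs : (fcoef g κ i * starRingEnd ℂ (fcoef f κ i)).re ≤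
        ‖fcoef g κ i‖ * ‖fcoef f κ i‖ := by
      refine (Complex.re_le_norm _).trans ?_
      rw [norm_mul, RCLike.norm_conj]
    nlinarith [sq_nonneg (‖fcoef g κ i‖ - a * ‖fcoef f κ i‖)]
  nlinarith [mul_le_mul_of_nonneg_left hlow ha]

lemma IsDispersion.inSobolev (hs : 0 < s) (hm : IsSymbol m s) {f g : AddCircle L → Plane}
    (h : IsDispersion m f g) (hf : MemLp f 2) (hg : MemLp g 2) : InSobolev s f := by
  obtain ⟨c₁, hc, hlow⟩ := hm.exists_symbolTerm_lower_bound L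
  have hsum := ((hasSum_norm_fcoef_sq hg).summable.mul_left (2 * (2 ^ (s / 2)) ^ 2 / c₁ ^ 2)).add
    ((hasSum_norm_fcoef_sq hf).summable.mul_left 2)
  refine Summable.of_nonneg_of_le (fun κ => by positivity) (fun κ => ?_) hsum
  have hle := h.sq_mul_sum_norm_fcoef_sq_le (by positivity) (hlow f κ)
  set V := ∑ i, ‖fcoef f κ i‖ ^ 2
  have : 0 ≤ V := Finset.sum_nonneg fun _ _ => sq_nonneg _
  calc (1 + (κ : ℝ) ^ 2) ^ s * V
      ≤ (2 * (2 ^ (s / 2)) ^ 2 * (|(κ : ℝ)| ^ s) ^ 2 + 2) * V := by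
        gcongr
        exact weight_le_abs_rpow_sq hs κ
    _ = 2 * (2 ^ (s / 2)) ^ 2 / c₁ ^ 2 * ((c₁ * |(κ : ℝ)| ^ s) ^ 2 * V) + 2 * V := by
        field_simp
    _ ≤ _ := by gcongr

end Symbol

section Hessian

variable {R : Plane → ℝ}

lemma contDiff_gradient (hR : ContDiff ℝ 2 R) : ContDiff ℝ 1 (gradient R) :=
  (InnerProductSpace.toDual ℝ Plane).symm.contDiff.comp (hR.fderiv_right (by norm_num))

lemma continuous_hessian (hR : ContDiff ℝ 2 R) : Continuous (hessian R) :=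
  (contDiff_gradient hR).continuous_fderiv (by simp)

lemma inner_gradient (R : Plane → ℝ) (p w : Plane) : inner ℝ (gradient R p) w = fderiv ℝ R p w := by
  rw [gradient, InnerProductSpace.toDual_symm_apply]

lemma inner_hessian (hR : ContDiff ℝ 2 R) (p v w : Plane) :
    inner ℝ (hessian R p v) w = fderiv ℝ (fderiv ℝ R) p v w := by
  have hd : DifferentiableAt ℝ (gradient R) p := (contDiff_gradient hR).differentiable (by simp) p
  have hgradient : HasFDerivAt (fun q => inner ℝ (gradient R q) w)
      ((innerSL ℝ w).comp (hessian R p)) p := by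
    have := (innerSL ℝ w).hasFDerivAt.comp p hd.hasFDerivAt
    refine this.congr_of_eventuallyEq (Eventually.of_forall fun q => ?_)
    simp
  have hd2 : DifferentiableAt ℝ (fderiv ℝ R) p :=
    (hR.fderiv_right (m := 1) (by norm_num)).differentiable (by simp) p
  have hfderiv : HasFDerivAt (fun q => fderiv ℝ R q w) ((fderiv ℝ (fderiv ℝ R) p).flip w) p := by
    simpa using hd2.hasFDerivAt.clm_apply (hasFDerivAt_const w p)
  simp only [inner_gradient] at hgradient
  have := congrArg (fun T : Plane →L[ℝ] ℝ => T v) (hgradient.unique hfderiv)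
  simpa [real_inner_comm] using this

lemma inner_hessian_comm (hR : ContDiff ℝ 2 R) (p v w : Plane) :
    inner ℝ (hessian R p v) w = inner ℝ (hessian R p w) v := by
  rw [inner_hessian hR, inner_hessian hR]
  exact (hR.contDiffAt (x := p)).isSymmSndFDerivAt (by simp) v w

end Hessian

section Linearization

variable {L : ℝ} [Fact (0 < L)] {R : Plane → ℝ} {m : ℤ → Matrix (Fin 2) (Fin 2) ℝ} {s : ℝ}

lemma memLp_top_hessian (hR : ContDiff ℝ 2 R) (φ : SmoothPer L) :
    MemLp (fun x => hessian R (φ x)) ⊤ (volume : Measure (AddCircle L)) := by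
  have hc : Continuous fun x => hessian R (φ x) := (continuous_hessian hR).comp φ.continuous
  obtain ⟨C, hC⟩ := isCompact_univ.exists_bound_of_continuousOn hc.continuousOn
  exact memLp_top_of_bound hc.aestronglyMeasurable C
    (Eventually.of_forall fun x => hC x (mem_univ x))

/-- Multiplication by `Hess R(φ)` on `L² × L²`. -/
def hessianL2 (hR : ContDiff ℝ 2 R) (φ : SmoothPer L) : L2per L →L[ℝ] L2per L :=
  (ContinuousLinearMap.id ℝ (Plane →L[ℝ] Plane)).holderL volume ⊤ 2 2
    ((memLp_top_hessian hR φ).toLp _)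

lemma coeFn_hessianL2 (hR : ContDiff ℝ 2 R) (φ : SmoothPer L) (f : L2per L) :
    hessianL2 hR φ f =ᵐ[volume] fun x => hessian R (φ x) (f x) := by
  have h := ContinuousLinearMap.coeFn_holder (r := 2)
    (ContinuousLinearMap.id ℝ (Plane →L[ℝ] Plane)) ((memLp_top_hessian hR φ).toLp _) f
  filter_upwards [h, (memLp_top_hessian hR φ).coeFn_toLp] with x happly hcoe
  rwa [hcoe] at happly

/-- The `L²` inner product as a bounded form on `H^r × H^r`. -/
def massForm (L : ℝ) [Fact (0 < L)] {r : ℝ} (hr : 0 ≤ r) : Hper L r →L[ℝ] Hper L r →L[ℝ] ℝ :=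
  (innerSL ℝ (E := L2per L)).bilinearComp (Hper.toL2L L hr) (Hper.toL2L L hr)

lemma massForm_apply {r : ℝ} (hr : 0 ≤ r) (u v : Hper L r) :
    massForm L hr u v = inner ℝ u.toL2 v.toL2 := rfl

lemma massForm_eq_integral {r : ℝ} (hr : 0 ≤ r) (u v : Hper L r) :
    massForm L hr u v = ∫ x, inner ℝ (u x) (v x) := L2.inner_def _ _

lemma massForm_comm {r : ℝ} (hr : 0 ≤ r) (u v : Hper L r) :
    massForm L hr u v = massForm L hr v u := by
  rw [massForm_apply, massForm_apply, real_inner_comm]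

lemma massForm_self_eq {r : ℝ} (hr : 0 ≤ r) (u : Hper L r) :
    massForm L hr u u = L * ∑' κ : ℤ, ∑ i, ‖fcoef u κ i‖ ^ 2 := by
  have hL : (0 : ℝ) < L := Fact.out
  rw [massForm_eq_integral, (hasSum_norm_fcoef_sq u.memLp).tsum_eq, mul_inv_cancel_left₀ hL.ne']

lemma massForm_pos {r : ℝ} (hr : 0 ≤ r) (u : Hper L r) (hu : u ≠ 0) : 0 < massForm L hr u u := by
  have : u.toL2 ≠ 0 := fun h => hu (Subtype.ext h)
  rw [massForm_apply]
  exact real_inner_self_pos.2 this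

/-- The form `(u,v) ↦ ∫ ⟨Hess R(φ) u, v⟩` on `H^r × H^r`. -/
def hessianForm {r : ℝ} (hr : 0 ≤ r) (hR : ContDiff ℝ 2 R) (φ : SmoothPer L) :
    Hper L r →L[ℝ] Hper L r →L[ℝ] ℝ :=
  (innerSL ℝ (E := L2per L)).bilinearComp ((hessianL2 hR φ).comp (Hper.toL2L L hr))
    (Hper.toL2L L hr)

lemma hessianForm_apply {r : ℝ} (hr : 0 ≤ r) (hR : ContDiff ℝ 2 R) (φ : SmoothPer L)
    (u v : Hper L r) : hessianForm hr hR φ u v = inner ℝ (hessianL2 hR φ u.toL2) v.toL2 := rfl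

lemma hessianForm_eq_integral {r : ℝ} (hr : 0 ≤ r) (hR : ContDiff ℝ 2 R) (φ : SmoothPer L)
    (u v : Hper L r) : hessianForm hr hR φ u v = ∫ x, inner ℝ (hessian R (φ x) (u x)) (v x) := by
  rw [hessianForm_apply, L2.inner_def]
  refine integral_congr_ae ?_
  filter_upwards [coeFn_hessianL2 hR φ u.toL2] with x hx
  rw [hx]

lemma hessianForm_comm {r : ℝ} (hr : 0 ≤ r) (hR : ContDiff ℝ 2 R) (φ : SmoothPer L)
    (u v : Hper L r) : hessianForm hr hR φ u v = hessianForm hr hR φ v u := by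
  rw [hessianForm_eq_integral, hessianForm_eq_integral]
  simp only [inner_hessian_comm hR _ (u _)]

lemma hessianForm_self_le {r : ℝ} (hr : 0 ≤ r) (hR : ContDiff ℝ 2 R) (φ : SmoothPer L)
    (u : Hper L r) : hessianForm hr hR φ u u ≤ ‖hessianL2 hR φ‖ * massForm L hr u u := by
  rw [hessianForm_apply, massForm_apply, real_inner_self_eq_norm_sq, pow_two, ← mul_assoc]
  refine (real_inner_le_norm _ _).trans ?_
  gcongr
  exact (hessianL2 hR φ).le_opNorm _

/-- The linearized operator as a bounded form on the energy space. -/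
def linearizedForm {C : ℝ} (hs : 0 ≤ s / 2) (hm : SymbolBound (s / 2) m C)
    (hR : ContDiff ℝ 2 R) (c : ℝ) (φ : SmoothPer L) : Hper L (s / 2) →L[ℝ] Hper L (s / 2) →L[ℝ] ℝ :=
  L • symbolForm L hm + c • massForm L hs - hessianForm hs hR φ

lemma linearizedForm_apply {C : ℝ} (hs : 0 ≤ s / 2) (hm : SymbolBound (s / 2) m C)
    (hR : ContDiff ℝ 2 R) (c : ℝ) (φ : SmoothPer L) (u v : Hper L (s / 2)) :
    linearizedForm hs hm hR c φ u v =
      dispersionForm m u v + c * massForm L hs u v - hessianForm hs hR φ u v := rfl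

lemma linearizedForm_eq_linForm {C : ℝ} (hs : 0 ≤ s / 2) (hm : SymbolBound (s / 2) m C)
    (hR : ContDiff ℝ 2 R) (c : ℝ) (φ : SmoothPer L) (u v : Hper L (s / 2)) :
    linearizedForm hs hm hR c φ u v = linForm R m c φ u v := by
  rw [linearizedForm_apply, massForm_eq_integral, hessianForm_eq_integral, linForm]

lemma linearizedForm_comm {C : ℝ} (hs : 0 ≤ s / 2) (hm : SymbolBound (s / 2) m C)
    (hsym : ∀ κ, (m κ).IsSymm) (hR : ContDiff ℝ 2 R) (c : ℝ) (φ : SmoothPer L)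
    (u v : Hper L (s / 2)) :
    linearizedForm hs hm hR c φ u v = linearizedForm hs hm hR c φ v u := by
  have h : dispersionForm m u v = dispersionForm m v u := by
    change L * symbolForm L hm u v = L * symbolForm L hm v u
    rw [symbolForm_comm hm hsym]
  rw [linearizedForm_apply, linearizedForm_apply, h, massForm_comm, hessianForm_comm]

lemma coeFn_eigen_rhs (hR : ContDiff ℝ 2 R) (φ : SmoothPer L) (μ c : ℝ) (f : L2per L) :
    (μ • f - c • f + hessianL2 hR φ f : L2per L) =ᵐ[volume]
      fun x => μ • f x - c • f x + hessian R (φ x) (f x) := by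
  filter_upwards [Lp.coeFn_add (μ • f - c • f) (hessianL2 hR φ f), Lp.coeFn_sub (μ • f) (c • f),
    Lp.coeFn_smul μ f, Lp.coeFn_smul c f, coeFn_hessianL2 hR φ f] with x hadd hsub hμ hc hH
  rw [hadd, Pi.add_apply, hsub, Pi.sub_apply, hμ, hc, hH]
  rfl

lemma integral_eigen_rhs (hR : ContDiff ℝ 2 R) (φ : SmoothPer L) (μ c : ℝ) (f w : L2per L) :
    ∫ x, inner ℝ (μ • f x - c • f x + hessian R (φ x) (f x)) (w x) =
      μ * inner ℝ f w - c * inner ℝ f w + inner ℝ (hessianL2 hR φ f) w := by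
  rw [← inner_smul_left_eq_smul (𝕜 := ℝ) f w μ |>.trans (smul_eq_mul _ _),
    ← inner_smul_left_eq_smul (𝕜 := ℝ) f w c |>.trans (smul_eq_mul _ _), ← inner_sub_left,
    ← inner_add_left, L2.inner_def]
  refine integral_congr_ae ?_
  filter_upwards [coeFn_eigen_rhs hR φ μ c f] with x hx
  rw [hx]

lemma memLp_eigen_rhs (hR : ContDiff ℝ 2 R) (φ : SmoothPer L) (μ c : ℝ) (f : L2per L) :
    MemLp (fun x => μ • f x - c • f x + hessian R (φ x) (f x)) 2 :=
  (memLp_congr_ae (coeFn_eigen_rhs hR φ μ c f)).1 (Lp.memLp _)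

lemma SatisfiesEigen.weak {C : ℝ} (hs : 0 ≤ s / 2) (hm : SymbolBound (s / 2) m C)
    (hR : ContDiff ℝ 2 R) {c μ : ℝ} {φ : SmoothPer L} {u : Hper L (s / 2)}
    (h : SatisfiesEigen R m s c φ μ u.toL2) (w : Hper L (s / 2)) :
    linearizedForm hs hm hR c φ u w = μ * massForm L hs u w := by
  rw [linearizedForm_apply, h.2.dispersionForm_eq (memLp_eigen_rhs hR φ μ c u.toL2) w.memLp,
    integral_eigen_rhs hR, massForm_apply, hessianForm_apply]
  ring

lemma satisfiesEigen_of_weak {C : ℝ} (hs : 0 < s) (hsym : IsSymbol m s)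
    (hm : SymbolBound (s / 2) m C) (hR : ContDiff ℝ 2 R) {c μ : ℝ} {φ : SmoothPer L}
    {u : Hper L (s / 2)}
    (h : ∀ w, linearizedForm (half_pos hs).le hm hR c φ u w = μ * massForm L (half_pos hs).le u w) :
    SatisfiesEigen R m s c φ μ u.toL2 := by
  have hdisp : IsDispersion m u fun x => μ • u x - c • u x + hessian R (φ x) (u x) := by
    refine isDispersion_of_mode hsym (memLp_eigen_rhs hR φ μ c u.toL2) fun κ b => ?_
    set w := (mode L κ b).toHper (s / 2)
    have hform : dispersionForm m u w = dispersionForm m u (mode L κ b) := by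
      rw [dispersionForm, dispersionForm, SmoothPer.fcoef_toHper]
    have hintegral : ∫ x, inner ℝ (μ • u x - c • u x + hessian R (φ x) (u x)) (w x) =
        ∫ x, inner ℝ (μ • u x - c • u x + hessian R (φ x) (u x)) (mode L κ b x) := by
      refine integral_congr_ae ?_
      filter_upwards [(mode L κ b).coeFn_toHper (s / 2)] with x hx
      rw [hx]
    have hweak := h w
    rw [linearizedForm_apply, massForm_apply, hessianForm_apply] at hweak
    rw [← hform, ← hintegral, integral_eigen_rhs hR φ μ c u.toL2 w.toL2]
    linarith
  exact ⟨hdisp.inSobolev hs hsym u.memLp (memLp_eigen_rhs hR φ μ c u.toL2), hdisp⟩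

lemma isRelEigenvector_linearizedForm_iff {C : ℝ} (hs : 0 < s) (hsym : IsSymbol m s)
    (hm : SymbolBound (s / 2) m C) (hR : ContDiff ℝ 2 R) {c μ : ℝ} {φ : SmoothPer L}
    {u : Hper L (s / 2)} :
    IsRelEigenvector (linearizedForm (half_pos hs).le hm hR c φ) (massForm L (half_pos hs).le) μ u ↔
      u.toL2 ≠ 0 ∧ SatisfiesEigen R m s c φ μ u.toL2 :=
  ⟨fun h => ⟨fun h0 => h.1 (Subtype.ext h0), satisfiesEigen_of_weak hs hsym hm hR h.2⟩,
    fun h => ⟨fun h0 => h.1 (congrArg Hper.toL2 h0), h.2.weak (half_pos hs).le hm hR⟩⟩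

lemma summable_norm_fcoef_sq (u : L2per L) : Summable fun κ : ℤ => ∑ i, ‖fcoef u κ i‖ ^ 2 :=
  (hasSum_norm_fcoef_sq (Lp.memLp u)).summable

lemma IsSymbol.exists_dispersionForm_lower_bound {C : ℝ} (hs : 0 < s) (hsym : IsSymbol m s)
    (hm : SymbolBound (s / 2) m C) : ∃ β > 0, ∀ u : Hper L (s / 2),
      β * ‖u‖ ^ 2 - β / L * massForm L (half_pos hs).le u u ≤ dispersionForm m u u := by
  have hL : (0 : ℝ) < L := Fact.out
  obtain ⟨c₁, hc, hlow⟩ := hsym.exists_symbolTerm_lower_bound L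
  set β := L * c₁ * (2 ^ (s / 2))⁻¹ with hβ
  refine ⟨β, by positivity, fun u => ?_⟩
  have hnorm := u.summable_norm_sq.mul_left β
  have hmass := (summable_norm_fcoef_sq u.toL2).mul_left β
  change _ ≤ L * ∑' κ, symbolTerm m u u κ
  rw [massForm_self_eq, ← mul_assoc, div_mul_cancel₀ _ hL.ne', Hper.norm_sq, ← tsum_mul_left,
    ← tsum_mul_left, ← tsum_mul_left, ← hnorm.tsum_sub hmass]
  refine Summable.tsum_le_tsum (fun κ => ?_) (hnorm.sub hmass)
    ((hm.summable_symbolTerm u u).mul_left L)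
  have hκ := hlow u κ
  set V := ∑ i, ‖fcoef u κ i‖ ^ 2
  calc β * ((1 + (κ : ℝ) ^ 2) ^ (s / 2) * V) - β * V
      ≤ β * ((2 ^ (s / 2) * |(κ : ℝ)| ^ s + 1) * V) - β * V := by
        gcongr
        exact weight_le_abs_rpow hs κ
    _ = L * (c₁ * |(κ : ℝ)| ^ s * V) := by
        rw [hβ]
        field_simp
        ring
    _ ≤ _ := by gcongr

lemma linearizedForm_lower_bound {C : ℝ} (hs : 0 < s) (hsym : IsSymbol m s)
    (hm : SymbolBound (s / 2) m C) (hR : ContDiff ℝ 2 R) (c : ℝ) (φ : SmoothPer L) :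
    ∃ β > 0, ∃ K > 0, ∀ u : Hper L (s / 2),
      β * ‖u‖ ^ 2 - K * massForm L (half_pos hs).le u u ≤
        linearizedForm (half_pos hs).le hm hR c φ u u := by
  have hL : (0 : ℝ) < L := Fact.out
  obtain ⟨β, hβ, hlow⟩ := hsym.exists_dispersionForm_lower_bound (L := L) hs hm
  refine ⟨β, hβ, β / L + |c| + ‖hessianL2 hR φ‖, by positivity, fun u => ?_⟩
  have hmass : 0 ≤ massForm L (half_pos hs).le u u := by
    rw [massForm_apply]
    exact real_inner_self_nonneg
  rw [linearizedForm_apply]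
  nlinarith [hlow u, hessianForm_self_le (half_pos hs).le hR φ u, neg_abs_le c]

/-- A Fourier coefficient as a bounded functional on `H^r × H^r`. -/
def fcoefL (L : ℝ) [Fact (0 < L)] {r : ℝ} (hr : 0 ≤ r) (κ : ℤ) (i : Fin 2) : Hper L r →L[ℝ] ℂ :=
  LinearMap.mkContinuous
    { toFun := fun u => fcoef u κ i
      map_add' := fun u v => Hper.fcoef_add u v κ i
      map_smul' := fun t u => by simpa using Hper.fcoef_smul t u κ i } 1 (fun u => by
    have hweight : (1 : ℝ) ≤ (1 + (κ : ℝ) ^ 2) ^ (r / 2) :=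
      Real.one_le_rpow (by nlinarith [sq_nonneg (κ : ℝ)]) (by linarith)
    rw [one_mul]
    calc ‖fcoef u κ i‖ ≤ (1 + (κ : ℝ) ^ 2) ^ (r / 2) * ‖fcoef u κ i‖ :=
          le_mul_of_one_le_left (norm_nonneg _) hweight
      _ ≤ ‖Hper.toEll2 L r u κ‖ := u.weight_mul_norm_fcoef_le κ i
      _ ≤ ‖u‖ := lp.norm_apply_le_norm (by norm_num) (Hper.toEll2 L r u) κ)

/-- The Fourier coefficients with frequencies in the finite set `F`, a finite rank operator. -/
def lowModes (L : ℝ) [Fact (0 < L)] {r : ℝ} (hr : 0 ≤ r) (F : Finset ℤ) :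
    Hper L r →L[ℝ] (F → Fin 2 → ℂ) :=
  ContinuousLinearMap.pi fun κ => ContinuousLinearMap.pi fun i => fcoefL L hr κ i

lemma sum_norm_fcoef_sq_le_lowModes {r : ℝ} (hr : 0 ≤ r) (F : Finset ℤ) (u : Hper L r) :
    ∑ κ ∈ F, ∑ i, ‖fcoef u κ i‖ ^ 2 ≤ F.card * (2 * ‖lowModes L hr F u‖ ^ 2) := by
  rw [← nsmul_eq_mul]
  refine Finset.sum_le_card_nsmul _ _ _ fun κ hκ => ?_
  have hle : ∀ i, ‖fcoef u κ i‖ ^ 2 ≤ ‖lowModes L hr F u‖ ^ 2 := fun i => by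
    gcongr
    exact (norm_le_pi_norm (lowModes L hr F u ⟨κ, hκ⟩) i).trans
      (norm_le_pi_norm (lowModes L hr F u) ⟨κ, hκ⟩)
  rw [Fin.sum_univ_two]
  linarith [hle 0, hle 1]

lemma tendsto_weight_atTop {r : ℝ} (hr : 0 < r) :
    Tendsto (fun κ : ℤ => (1 + (κ : ℝ) ^ 2) ^ r) cofinite atTop := by
  refine (tendsto_rpow_atTop hr).comp (tendsto_atTop_mono (fun κ => ?_)
    (tendsto_norm_cocompact_atTop.comp Int.tendsto_coe_cofinite))
  rw [Function.comp_apply, Real.norm_eq_abs, ← sq_abs]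
  nlinarith [sq_nonneg (|(κ : ℝ)| - 1), abs_nonneg (κ : ℝ)]

lemma exists_massForm_le_add_lowModes {r : ℝ} (hr : 0 < r) {ε : ℝ} (hε : 0 < ε) :
    ∃ (F : Finset ℤ) (D : ℝ), ∀ u : Hper L r,
      massForm L hr.le u u ≤ ε * ‖u‖ ^ 2 + D * ‖lowModes L hr.le F u‖ ^ 2 := by
  have hL : (0 : ℝ) < L := Fact.out
  have hfin := (tendsto_weight_atTop hr).eventually_ge_atTop (L / ε)
  rw [eventually_cofinite] at hfin
  set F := hfin.toFinset
  have hF (κ : ℤ) (hκ : κ ∉ F) : L ≤ ε * (1 + (κ : ℝ) ^ 2) ^ r := by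
    rw [mul_comm, ← div_le_iff₀ hε]
    simpa [F] using hκ
  refine ⟨F, L * (F.card * 2), fun u => ?_⟩
  set V : ℤ → ℝ := fun κ => ∑ i, ‖fcoef u κ i‖ ^ 2
  have hV (κ : ℤ) : 0 ≤ V κ := Finset.sum_nonneg fun _ _ => sq_nonneg _
  have hlow : HasSum (fun κ => if κ ∈ F then V κ else 0) (∑ κ ∈ F, V κ) := by
    have := hasSum_sum_of_ne_finset_zero (L := SummationFilter.unconditional ℤ) (s := F)
      (f := fun κ => if κ ∈ F then V κ else 0) fun κ hκ => if_neg hκ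
    rwa [Finset.sum_congr rfl fun κ hκ => if_pos hκ] at this
  have hterm (κ : ℤ) : L * V κ ≤
      ε * ((1 + (κ : ℝ) ^ 2) ^ r * V κ) + L * if κ ∈ F then V κ else 0 := by
    split_ifs with hκ
    · have : 0 ≤ ε * ((1 + (κ : ℝ) ^ 2) ^ r * V κ) :=
        mul_nonneg hε.le (mul_nonneg (by positivity) (hV κ))
      linarith
    · rw [mul_zero, add_zero, ← mul_assoc]
      exact mul_le_mul_of_nonneg_right (hF κ hκ) (hV κ)
  have hsplit : massForm L hr.le u u ≤ ε * ‖u‖ ^ 2 + L * ∑ κ ∈ F, V κ := by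
    rw [massForm_self_eq, Hper.norm_sq]
    exact hasSum_le hterm ((summable_norm_fcoef_sq u.toL2).hasSum.mul_left L)
      ((u.summable_norm_sq.hasSum.mul_left ε).add (hlow.mul_left L))
  have := mul_le_mul_of_nonneg_left (sum_norm_fcoef_sq_le_lowModes hr.le F u) hL.le
  linarith

lemma exists_satisfiesGarding_linearizedForm {C : ℝ} (hs : 0 < s) (hsym : IsSymbol m s)
    (hm : SymbolBound (s / 2) m C) (hR : ContDiff ℝ 2 R) (c : ℝ) (φ : SmoothPer L) :
    ∃ F : Finset ℤ, SatisfiesGarding (linearizedForm (half_pos hs).le hm hR c φ)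
      (lowModes L (half_pos hs).le F) := by
  obtain ⟨β, hβ, K, hK, hlow⟩ := linearizedForm_lower_bound (L := L) hs hsym hm hR c φ
  obtain ⟨F, D, hF⟩ := exists_massForm_le_add_lowModes (L := L) (half_pos hs)
    (ε := β / (2 * K)) (by positivity)
  refine ⟨F, β / 2, half_pos hβ, K * D, fun u => ?_⟩
  have hmass := mul_le_mul_of_nonneg_left (hF u) hK.le
  have hcancel : K * (β / (2 * K) * ‖u‖ ^ 2) = β / 2 * ‖u‖ ^ 2 := by field_simp
  linarith [hlow u]

lemma inSobolev_mono {r r' : ℝ} (h : r ≤ r') {f : AddCircle L → Plane} (hf : InSobolev r' f) :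
    InSobolev r f := by
  refine Summable.of_nonneg_of_le (fun κ => by positivity) (fun κ => ?_) hf
  gcongr
  nlinarith [sq_nonneg (κ : ℝ)]

lemma linearizedForm_self_nonneg_of_orthogonal {C : ℝ} (hs : 0 < s) (hsym : IsSymbol m s)
    (hm : SymbolBound (s / 2) m C) (hR : ContDiff ℝ 2 R) {c : ℝ} {φ : SmoothPer L}
    (hspec : SpectralCondition R m s c φ) {Φ : Hper L (s / 2)} (hΦ : linForm R m c φ Φ Φ < 0)
    {w : Hper L (s / 2)} (hw : linearizedForm (half_pos hs).le hm hR c φ Φ w = 0) :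
    0 ≤ linearizedForm (half_pos hs).le hm hR c φ w w := by
  have hs2 := (half_pos hs).le
  have := Hper.completeSpace (L := L) hs2
  obtain ⟨F, hG⟩ := exists_satisfiesGarding_linearizedForm (L := L) hs hsym hm hR c φ
  obtain ⟨β, hβ, K, -, hlow⟩ := linearizedForm_lower_bound (L := L) hs hsym hm hR c φ
  obtain ⟨⟨μ₀, -, ⟨χ, hχ0, hχ, hsimple⟩, huniq⟩, -⟩ := hspec
  let χ' : Hper L (s / 2) := ⟨χ, inSobolev_mono (half_le_self hs.le) hχ.1⟩
  have hχ' : IsRelEigenvector (linearizedForm hs2 hm hR c φ) (massForm L hs2) μ₀ χ' :=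
    (isRelEigenvector_linearizedForm_iff hs hsym hm hR).2 ⟨hχ0, hχ⟩
  have hground (v : Hper L (s / 2)) (hv : massForm L hs2 χ' v = 0) :
      0 ≤ linearizedForm hs2 hm hR c φ v v := by
    refine apply_self_nonneg_of_orthogonal_ground_state hG
      (linearizedForm_comm hs2 hm hsym.symm hR c φ) (massForm_comm hs2) (massForm_pos hs2) (K := K)
      (fun z => ?_) hχ' (fun μ hμ z hz => ?_) hv
    · have : 0 ≤ β * ‖z‖ ^ 2 := by positivity
      linarith [hlow z]
    · obtain ⟨hz0, hz⟩ := (isRelEigenvector_linearizedForm_iff hs hsym hm hR).1 hz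
      obtain rfl := huniq μ hμ z.toL2 hz0 hz
      obtain ⟨a, ha⟩ := hsimple _ hz
      exact ⟨a, Subtype.ext ha⟩
  exact apply_self_nonneg_of_orthogonal_of_neg (B := (linearizedForm hs2 hm hR c φ).toBilinForm)
    (l := (massForm L hs2 χ' : Hper L (s / 2) →ₗ[ℝ] ℝ))
    (linearizedForm_comm hs2 hm hsym.symm hR c φ) hground
    (by rwa [← linearizedForm_eq_linForm hs2 hm hR] at hΦ) hw

lemma exists_linearizedForm_coercive {C : ℝ} (hs : 0 < s) (hsym : IsSymbol m s)
    (hm : SymbolBound (s / 2) m C) (hR : ContDiff ℝ 2 R) {c : ℝ} {φ : SmoothPer L}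
    (hspec : SpectralCondition R m s c φ) {Φ : Hper L (s / 2)} (hΦ : linForm R m c φ Φ Φ < 0) :
    ∃ N δ : ℝ, 0 < δ ∧ ∀ v : Hper L (s / 2), inner ℝ (φ.deriv.toHper (s / 2)) v = 0 →
      δ * ‖v‖ ^ 2 ≤ linearizedForm (half_pos hs).le hm hR c φ v v +
        N * (linearizedForm (half_pos hs).le hm hR c φ Φ v) ^ 2 := by
  have := Hper.completeSpace (L := L) (half_pos hs).le
  obtain ⟨F, hG⟩ := exists_satisfiesGarding_linearizedForm (L := L) hs hsym hm hR c φ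
  have hψ : φ.deriv.toHper (s / 2) ≠ 0 := fun h => hspec.2.1 (congrArg Hper.toL2 h)
  refine exists_coercive_penalization (ψ := φ.deriv.toHper (s / 2))
    (l := innerSL ℝ (φ.deriv.toHper (s / 2))) hG
    (linearizedForm_comm _ hm hsym.symm hR c φ) (by rwa [linearizedForm_eq_linForm])
    (fun w => linearizedForm_self_nonneg_of_orthogonal hs hsym hm hR hspec hΦ) (fun v hv => ?_)
    (real_inner_self_pos.2 hψ).ne'
  obtain ⟨a, ha⟩ := hspec.2.2.2 _
    (satisfiesEigen_of_weak (μ := 0) hs hsym hm hR fun w => by rw [hv, zero_mul])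
  exact ⟨a, Subtype.ext ha⟩

end Linearization

section Nonlinearity

variable {L : ℝ} [Fact (0 < L)] {R : Plane → ℝ} {r : ℝ}

lemma memLp_gradient (hR : ContDiff ℝ 2 R) (φ : SmoothPer L) :
    MemLp (fun x => gradient R (φ x)) 2 (volume : Measure (AddCircle L)) := by
  have hc : Continuous fun x => gradient R (φ x) :=
    (contDiff_gradient hR).continuous.comp φ.continuous
  obtain ⟨C, hC⟩ := isCompact_univ.exists_bound_of_continuousOn hc.continuousOn
  exact MemLp.of_bound hc.aestronglyMeasurable C (Eventually.of_forall fun x => hC x (mem_univ x))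

/-- The functional `v ↦ ∫ ⟨∇R(φ), v⟩`. -/
def gradientFunctional (hr : 0 ≤ r) (hR : ContDiff ℝ 2 R) (φ : SmoothPer L) : Hper L r →L[ℝ] ℝ :=
  (innerSL ℝ ((memLp_gradient hR φ).toLp _)).comp (Hper.toL2L L hr)

lemma gradientFunctional_apply (hr : 0 ≤ r) (hR : ContDiff ℝ 2 R) (φ : SmoothPer L)
    (v : Hper L r) :
    gradientFunctional hr hR φ v = inner ℝ ((memLp_gradient hR φ).toLp _) v.toL2 := rfl

lemma gradientFunctional_eq_integral (hr : 0 ≤ r) (hR : ContDiff ℝ 2 R) (φ : SmoothPer L)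
    (v : Hper L r) :
    gradientFunctional hr hR φ v = ∫ x, inner ℝ (gradient R (φ x)) (v x) := by
  rw [gradientFunctional_apply, L2.inner_def]
  refine integral_congr_ae ?_
  filter_upwards [(memLp_gradient hR φ).coeFn_toLp] with x hx
  rw [hx]

lemma integrable_inner_gradient (hR : ContDiff ℝ 2 R) (φ : SmoothPer L) (v : L2per L) :
    Integrable fun x => inner ℝ (gradient R (φ x)) (v x) := by
  refine (L2.integrable_inner ((memLp_gradient hR φ).toLp _) v (𝕜 := ℝ)).congr ?_
  filter_upwards [(memLp_gradient hR φ).coeFn_toLp] with x hx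
  rw [hx]

lemma integrable_inner_hessian (hR : ContDiff ℝ 2 R) (φ : SmoothPer L) (v : L2per L) :
    Integrable fun x => inner ℝ (hessian R (φ x) (v x)) (v x) := by
  refine (L2.integrable_inner (hessianL2 hR φ v) v (𝕜 := ℝ)).congr ?_
  filter_upwards [coeFn_hessianL2 hR φ v] with x hx
  rw [hx]

lemma integrable_comp_toHper (hR : Continuous R) (φ : SmoothPer L) :
    Integrable fun x => R (φ.toHper r x) := by
  have hc : Continuous fun x => R (φ x) := hR.comp φ.continuous
  refine (hc.integrable_of_hasCompactSupport (HasCompactSupport.of_compactSpace _)).congr ?_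
  filter_upwards [φ.coeFn_toHper r] with x hx
  rw [hx]

/-- The pointwise second-order Taylor remainder of `R` at `φ` in the direction `v`. -/
def taylorRemainder (R : Plane → ℝ) (φ : SmoothPer L) (v : Hper L r) (x : AddCircle L) : ℝ :=
  R ((φ.toHper r + v : Hper L r) x) - R (φ.toHper r x) - inner ℝ (gradient R (φ x)) (v x) -
    1 / 2 * inner ℝ (hessian R (φ x) (v x)) (v x)

lemma exists_norm_taylorRemainder_le (hR : ContDiff ℝ 2 R) (φ : SmoothPer L) {ε : ℝ}
    (hε : 0 < ε) : ∃ δ > 0, ∀ v : Hper L r, (∀ᵐ x, ‖v x‖ < δ) →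
      ∀ᵐ x, ‖taylorRemainder R φ v x‖ ≤ ε * inner ℝ (v x) (v x) := by
  obtain ⟨δ, hδ, htaylor⟩ := taylor_two_uniform_of_contDiff hR (isCompact_range φ.continuous) hε
  refine ⟨δ, hδ, fun v hv => ?_⟩
  filter_upwards [hv, φ.coeFn_toHper r, Hper.coeFn_add (φ.toHper r) v] with x hvx hφx hadd
  rw [taylorRemainder, hadd, Pi.add_apply, hφx, inner_gradient, inner_hessian hR,
    real_inner_self_eq_norm_sq]
  exact htaylor (φ x) (mem_range_self x) (v x) hvx

lemma aestronglyMeasurable_taylorRemainder (hR : ContDiff ℝ 2 R) (φ : SmoothPer L)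
    (v : Hper L r) : AEStronglyMeasurable (taylorRemainder R φ v) volume :=
  (((hR.continuous.comp_aestronglyMeasurable (Lp.aestronglyMeasurable _)).sub
    (integrable_comp_toHper hR.continuous φ).1).sub (integrable_inner_gradient hR φ v.toL2).1).sub
    ((integrable_inner_hessian hR φ v.toL2).const_mul _).1

lemma integral_taylorRemainder (hr : 0 ≤ r) (hR : ContDiff ℝ 2 R) (φ : SmoothPer L)
    {v : Hper L r} (hv : Integrable (taylorRemainder R φ v)) :
    ∫ x, taylorRemainder R φ v x = (∫ x, R ((φ.toHper r + v : Hper L r) x)) -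
      (∫ x, R (φ.toHper r x)) - gradientFunctional hr hR φ v -
        1 / 2 * hessianForm hr hR φ v v := by
  have hbase := integrable_comp_toHper (r := r) hR.continuous φ
  have hgrad := integrable_inner_gradient hR φ v.toL2
  have hhess := (integrable_inner_hessian hR φ v.toL2).const_mul (1 / 2)
  have hpert : Integrable fun x => R ((φ.toHper r + v : Hper L r) x) := by
    refine (((hv.add hhess).add hgrad).add hbase).congr (Eventually.of_forall fun x => ?_)
    simp only [Pi.add_apply, taylorRemainder]
    ring
  rw [gradientFunctional_eq_integral, hessianForm_eq_integral, ← integral_const_mul,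
    ← integral_sub hpert hbase, ← integral_sub (hpert.sub' hbase) hgrad,
    ← integral_sub ((hpert.sub' hbase).sub' hgrad) hhess]
  rfl

/-- Smallness in `L^∞` is what the pointwise expansion of `R` needs; the remainder is then `o(‖v‖²)`
even in the weaker `L²` norm. -/
lemma nonlinearity_isLittleO_massForm {ι : Type*} {l : Filter ι} (hr : 0 ≤ r)
    (hR : ContDiff ℝ 2 R) (φ : SmoothPer L) {v : ι → Hper L r}
    (hv : ∀ δ > 0, ∀ᶠ i in l, ∀ᵐ x, ‖v i x‖ < δ) :
    (fun i => (∫ x, R ((φ.toHper r + v i : Hper L r) x)) - (∫ x, R (φ.toHper r x)) -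
      gradientFunctional hr hR φ (v i) - 1 / 2 * hessianForm hr hR φ (v i) (v i))
      =o[l] fun i => massForm L hr (v i) (v i) := by
  refine Asymptotics.isLittleO_iff.2 fun ε hε => ?_
  obtain ⟨δ, hδ, hrem⟩ := exists_norm_taylorRemainder_le (r := r) hR φ hε
  filter_upwards [hv δ hδ] with i hi
  have hsq := (L2.integrable_inner (v i).toL2 (v i).toL2 (𝕜 := ℝ)).const_mul ε
  have hint := hsq.mono' (aestronglyMeasurable_taylorRemainder hR φ (v i)) (hrem _ hi)
  rw [← integral_taylorRemainder hr hR φ hint]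
  refine (norm_integral_le_of_norm_le hsq (hrem _ hi)).trans ?_
  rw [integral_const_mul, ← L2.inner_def, ← massForm_apply hr]
  gcongr
  exact le_abs_self _

lemma hasTaylorTwo_nonlinearity_of_one_lt (hr : 0 ≤ r) (hr1 : 1 < 2 * r) (hR : ContDiff ℝ 2 R)
    (φ : SmoothPer L) :
    HasTaylorTwo (fun u : Hper L r => ∫ x, R (u x)) (gradientFunctional hr hR φ)
      (hessianForm hr hR φ) (φ.toHper r) := by
  obtain ⟨M, hM⟩ := exists_sup_norm_le (L := L) hr1
  refine (nonlinearity_isLittleO_massForm (v := id) hr hR φ fun δ hδ => ?_).trans_isBigO ?_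
  · have hball : ∀ᶠ v : Hper L r in 𝓝 0, M * ‖v‖ < δ := by
      have : Continuous fun v : Hper L r => M * ‖v‖ := by fun_prop
      exact this.tendsto 0 |>.eventually_lt_const (by simpa using hδ)
    filter_upwards [hball] with v hv
    filter_upwards [hM v] with x hx
    exact hx.trans_lt hv
  · refine Asymptotics.IsBigO.of_bound ‖massForm L hr‖ (Eventually.of_forall fun v => ?_)
    rw [norm_pow, norm_norm, sq, ← mul_assoc]
    exact (massForm L hr).le_opNorm₂ v v

/-- The `C²` hypothesis provides some second-order jet; along bounded functions, which are dense, it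
has to agree with the pointwise one. -/
lemma hasTaylorTwo_nonlinearity_of_contDiffAt (hr : 0 ≤ r) (hR : ContDiff ℝ 2 R) (φ : SmoothPer L)
    (hreg : ContDiffAt ℝ 2 (fun u : Hper L r => ∫ x, R (u x)) (φ.toHper r)) :
    HasTaylorTwo (fun u : Hper L r => ∫ x, R (u x)) (gradientFunctional hr hR φ)
      (hessianForm hr hR φ) (φ.toHper r) := by
  refine (hasTaylorTwo_fderiv hreg).of_dense (dense_essBounded hr) fun v hv => ?_
  obtain ⟨M, hM⟩ := hv
  refine (nonlinearity_isLittleO_massForm (v := fun t : ℝ => t • v) hr hR φ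
    fun δ hδ => ?_).trans_isBigO ?_
  · have hball : ∀ᶠ t : ℝ in 𝓝 0, |t| * M < δ := by
      have : Continuous fun t : ℝ => |t| * M := by fun_prop
      exact this.tendsto 0 |>.eventually_lt_const (by simpa using hδ)
    filter_upwards [hball] with t ht
    filter_upwards [hM, Hper.coeFn_smul t v] with x hx hsmul
    rw [hsmul, Pi.smul_apply, norm_smul, Real.norm_eq_abs]
    exact (mul_le_mul_of_nonneg_left hx (abs_nonneg t)).trans_lt ht
  · refine ((Asymptotics.isBigO_refl (fun t : ℝ => t ^ 2) _).const_mul_left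
      (massForm L hr v v)).congr_left fun t => ?_
    simp only [map_smul, smul_apply, smul_eq_mul]
    ring

lemma hasTaylorTwo_nonlinearity (hr : 0 ≤ r) (hR : ContDiff ℝ 2 R) (φ : SmoothPer L)
    (hreg : 2 * r ≤ 1 → ContDiffAt ℝ 2 (fun u : Hper L r => ∫ x, R (u x)) (φ.toHper r)) :
    HasTaylorTwo (fun u : Hper L r => ∫ x, R (u x)) (gradientFunctional hr hR φ)
      (hessianForm hr hR φ) (φ.toHper r) :=
  (le_or_gt (2 * r) 1).elim
    (fun hle => hasTaylorTwo_nonlinearity_of_contDiffAt hr hR φ (hreg hle))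
    fun hlt => hasTaylorTwo_nonlinearity_of_one_lt hr hlt hR φ

end Nonlinearity

section Action

/-- The constant function `A`; testing the equation against it gives conservation of the mean. -/
def constPer (L : ℝ) (A : Plane) : SmoothPer L where
  toFun _ := A
  smooth := contDiff_const

lemma constPer_deriv {L : ℝ} (A : Plane) (x : AddCircle L) : (constPer L A).deriv x = 0 := by
  change deriv (fun _ : ℝ => A) 0 = 0
  simp

variable {L : ℝ} [Fact (0 < L)] {R : Plane → ℝ} {m : ℤ → Matrix (Fin 2) (Fin 2) ℝ} {s : ℝ}

/-- The mean functional `u ↦ ∫ ⟨u, A⟩`. -/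
def meanFunctional (A : Plane) (u : AddCircle L → Plane) : ℝ := ∫ x, inner ℝ (u x) A

/-- The action functional `E + cF + ∫ ⟨u, A⟩`, of which the wave is a critical point. -/
def action (R : Plane → ℝ) (m : ℤ → Matrix (Fin 2) (Fin 2) ℝ) (c : ℝ) (A : Plane)
    (u : AddCircle L → Plane) : ℝ :=
  energy R m u + c * momentum u + meanFunctional A u

lemma integral_translate (g : Plane → ℝ) {r : ℝ} (y : ℝ) (u : Hper L r) :
    ∫ x, g (translate y u x) = ∫ x, g (u x) := by
  rw [← integral_add_right_eq_self (fun x => g (u x)) (y : AddCircle L)]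
  refine integral_congr_ae ?_
  filter_upwards [translate_coeFn y u] with x hx
  rw [hx]

lemma dispersionForm_translate (m : ℤ → Matrix (Fin 2) (Fin 2) ℝ) {r : ℝ} (y : ℝ)
    (u : Hper L r) : dispersionForm m (translate y u) (translate y u) = dispersionForm m u u := by
  unfold dispersionForm
  congr 2
  funext κ
  refine Finset.sum_congr rfl fun i _ => Finset.sum_congr rfl fun j _ => ?_
  have hphase : fourier κ (y : AddCircle L) * starRingEnd ℂ (fourier κ (y : AddCircle L)) = 1 := by
    rw [Complex.mul_conj, Complex.normSq_eq_norm_sq, fourier_apply, Circle.norm_coe]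
    simp
  rw [fcoef_translate_Hper, fcoef_translate_Hper, map_mul, mul_mul_mul_comm, hphase, one_mul]

lemma action_translate (c : ℝ) (A : Plane) {r : ℝ} (y : ℝ) (u : Hper L r) :
    action R m c A (translate y u) = action R m c A u := by
  unfold action energy momentum meanFunctional
  rw [dispersionForm_translate, integral_translate R, integral_translate fun p => inner ℝ p p,
    integral_translate fun p => inner ℝ p A]

lemma IsGlobalSolution.meanFunctional_eq {u : ℝ → Hper L (s / 2)} (hu : IsGlobalSolution R m u)
    (A : Plane) {t : ℝ} (ht : 0 ≤ t) : meanFunctional A (u t) = meanFunctional A (u 0) := by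
  have hweak := hu.weak (constPer L A) t ht
  have hcoef (κ : ℤ) (i : Fin 2) :
      fcoef ((constPer L A).deriv : AddCircle L → Plane) κ i = 0 := by
    simp [fcoef, fourierCoeff, constPer_deriv]
  simp only [dispersionForm, hcoef, constPer_deriv] at hweak
  simp only [map_zero, mul_zero, Complex.zero_re, Finset.sum_const_zero, tsum_zero,
    inner_zero_right, integral_zero, sub_self, intervalIntegral.integral_zero] at hweak
  exact sub_eq_zero.1 hweak

lemma action_conserved (S : GlobalFlow R m L s) (hE : S.Conserves fun u => energy R m u)
    (hF : S.Conserves fun u => momentum u) (c : ℝ) (A : Plane) :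
    S.Conserves fun u => action R m c A u := by
  intro u₀ t ht
  have hmean := (S.solution u₀).meanFunctional_eq A ht
  rw [S.initial] at hmean
  exact congrArg₂ (· + ·) (congrArg₂ (· + ·) (hE u₀ t ht) (congrArg (c * ·) (hF u₀ t ht))) hmean

lemma meanFunctional_eq_massForm {r : ℝ} (hr : 0 ≤ r) (A : Plane) (u : Hper L r) :
    meanFunctional A u = massForm L hr ((constPer L A).toHper r) u := by
  rw [massForm_comm, massForm_eq_integral]
  refine integral_congr_ae ?_
  filter_upwards [(constPer L A).coeFn_toHper r] with x hx
  rw [hx]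
  rfl

lemma action_eq {C : ℝ} (hs : 0 ≤ s / 2) (hm : SymbolBound (s / 2) m C) (c : ℝ) (A : Plane)
    (u : Hper L (s / 2)) :
    action R m c A u = 1 / 2 * (L • symbolForm L hm + c • massForm L hs) u u +
      massForm L hs ((constPer L A).toHper (s / 2)) u - ∫ x, R (u x) := by
  have hquad : (L • symbolForm L hm + c • massForm L hs) u u =
      dispersionForm m u u + c * ∫ x, inner ℝ (u x) (u x) := by
    rw [← massForm_eq_integral hs]
    rfl
  rw [hquad, ← meanFunctional_eq_massForm, action, energy, momentum]
  ring

lemma IsTravellingWave.critical {C : ℝ} (hs : 0 ≤ s / 2) (hm : SymbolBound (s / 2) m C)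
    (hR : ContDiff ℝ 2 R) {c : ℝ} {A : Plane} {φ : SmoothPer L}
    (hwave : IsTravellingWave R m c A φ) :
    (L • symbolForm L hm + c • massForm L hs) (φ.toHper (s / 2)) +
      massForm L hs ((constPer L A).toHper (s / 2)) = gradientFunctional hs hR φ := by
  ext v
  set G := (memLp_gradient hR φ).toLp _
  set p := φ.toHper (s / 2)
  set a := (constPer L A).toHper (s / 2)
  have hg : (G - c • p.toL2 - a.toL2 : L2per L) =ᵐ[volume]
      fun x => gradient R (φ x) - c • φ x - A := by
    filter_upwards [Lp.coeFn_sub (G - c • p.toL2) a.toL2, Lp.coeFn_sub G (c • p.toL2),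
      Lp.coeFn_smul c p.toL2, φ.coeFn_toHper (s / 2), (memLp_gradient hR φ).coeFn_toLp,
      (constPer L A).coeFn_toHper (s / 2)] with x hsub hsub' hsmul hφ hG ha
    rw [hsub, Pi.sub_apply, hsub', Pi.sub_apply, hsmul, Pi.smul_apply, hφ, hG, ha]
    rfl
  have hdisp : L * symbolForm L hm p v = inner ℝ (G - c • p.toL2 - a.toL2) v.toL2 := by
    calc L * symbolForm L hm p v = dispersionForm m φ v := by
          rw [dispersionForm, ← SmoothPer.fcoef_toHper φ (s / 2)]
          rfl
      _ = ∫ x, inner ℝ (gradient R (φ x) - c • φ x - A) (v x) :=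
          hwave.dispersionForm_eq ((memLp_congr_ae hg).1 (Lp.memLp _)) v.memLp
      _ = inner ℝ (G - c • p.toL2 - a.toL2) v.toL2 := by
          rw [L2.inner_def]
          exact integral_congr_ae (hg.mono fun x hx => by simp only [hx])
  simp only [add_apply, smul_apply, smul_eq_mul, hdisp, massForm_apply, gradientFunctional_apply,
    inner_sub_left, real_inner_smul_left]
  ring

lemma IsTravellingWave.hasTaylorTwo_action {C : ℝ} (hs : 0 ≤ s / 2) (hsym : IsSymbol m s)
    (hm : SymbolBound (s / 2) m C) (hR : ContDiff ℝ 2 R) {c : ℝ} {A : Plane} {φ : SmoothPer L}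
    (hwave : IsTravellingWave R m c A φ)
    (hreg : s ≤ 1 → ContDiffAt ℝ 2 (fun u : Hper L (s / 2) => ∫ x, R (u x)) (φ.toHper (s / 2))) :
    HasTaylorTwo (fun u : Hper L (s / 2) => action R m c A u) 0 (linearizedForm hs hm hR c φ)
      (φ.toHper (s / 2)) := by
  have hcomm (v w : Hper L (s / 2)) : (L • symbolForm L hm + c • massForm L hs) v w =
      (L • symbolForm L hm + c • massForm L hs) w v := by
    simp only [add_apply, smul_apply, symbolForm_comm hm hsym.symm v w, massForm_comm hs v w]
  have h := (hasTaylorTwo_nonlinearity hs hR φ fun h => hreg (by linarith)).quadratic_sub hcomm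
    (massForm L hs ((constPer L A).toHper (s / 2)))
  rw [hwave.critical hs hm hR, sub_self] at h
  simp only [action_eq hs hm]
  exact h

end Action

section Stability

variable {L : ℝ} [Fact (0 < L)] {R : Plane → ℝ} {m : ℤ → Matrix (Fin 2) (Fin 2) ℝ} {s : ℝ}

lemma forall_lt_of_forall_ne {ρ : ℝ → ℝ} (hρ : ContinuousOn ρ (Ici 0)) {ε : ℝ} (h0 : ρ 0 < ε)
    (hne : ∀ t, 0 ≤ t → ρ t ≠ ε) {t : ℝ} (ht : 0 ≤ t) : ρ t < ε := by
  by_contra! hge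
  obtain ⟨τ, hτ, hτε⟩ := intermediate_value_Icc ht (hρ.mono Icc_subset_Ici_self)
    (⟨h0.le, hge⟩ : ε ∈ Icc (ρ 0) (ρ t))
  exact hne τ hτ.1 hτε

lemma GlobalFlow.orbitallyStable_of_lyapunov (S : GlobalFlow R m L s) (φ : SmoothPer L)
    {V : Hper L (s / 2) → ℝ} (hV : S.Conserves V) (hinv : ∀ y u, V (translate y u) = V u)
    (hcont : ContinuousAt V (φ.toHper (s / 2))) {a η : ℝ} (ha : 0 < a) (hη : 0 < η)
    (hlow : ∀ v, inner ℝ (φ.deriv.toHper (s / 2)) v = 0 → ‖v‖ < η →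
      a * ‖v‖ ^ 2 ≤ V (φ.toHper (s / 2) + v) - V (φ.toHper (s / 2))) :
    S.OrbitallyStable (φ.toHper (s / 2)) := by
  intro ε hε
  set p := φ.toHper (s / 2)
  set ε' := min ε (η / 2)
  have hε'η : ε' < η := (min_le_right _ _).trans_lt (half_lt_self hη)
  obtain ⟨δ, hδ, hclose⟩ := Metric.continuousAt_iff.1 hcont (a * ε' ^ 2) (by positivity)
  refine ⟨min δ ε', by positivity, fun u₀ hu₀ => ⟨S.solution u₀, S.initial u₀, fun t ht => ?_⟩⟩
  have hV₀ : V u₀ - V p < a * ε' ^ 2 :=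
    (le_abs_self _).trans_lt (hclose (by simpa [dist_eq_norm] using hu₀.trans_le (min_le_left _ _)))
  have hρcont : ContinuousOn (fun t => rho (S.toFun t u₀) p) (Ici 0) :=
    (continuous_rho p).comp_continuousOn (S.solution u₀).continuousOn
  have hρ₀ : rho (S.toFun 0 u₀) p < ε' := by
    have hle := rho_le u₀ p 0
    rw [translate_zero] at hle
    rw [S.initial]
    exact hle.trans_lt (hu₀.trans_le (min_le_right _ _))
  refine (forall_lt_of_forall_ne hρcont hρ₀ (fun τ hτ hρτ => ?_) ht).trans_le (min_le_left _ _)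
  obtain ⟨y, hy, horth⟩ := φ.exists_rho_eq (S.toFun τ u₀)
  have hnorm : ‖translate y (S.toFun τ u₀) - p‖ = ε' := hy.symm.trans hρτ
  have hbarrier := hlow _ horth (hnorm.trans_lt hε'η)
  rw [add_sub_cancel, hinv, hV u₀ τ hτ, hnorm] at hbarrier
  exact hV₀.not_ge hbarrier

end Stability

end DispersiveSystem

end

theorem theorem1p1_general (L : ℝ) [Fact (0 < L)] (s : ℝ) (hs : 0 < s)
    (m : ℤ → Matrix (Fin 2) (Fin 2) ℝ) (hm : DispersiveSystem.IsSymbol m s)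
    (R : DispersiveSystem.Plane → ℝ) (hR : ContDiff ℝ 2 R) (φ : DispersiveSystem.SmoothPer L)
    (_hint : s ≤ 1 →
      ∀ u : DispersiveSystem.Hper L (s / 2), MeasureTheory.Integrable fun x => R (u x))
    (hreg : s ≤ 1 → ContDiffAt ℝ 2
      (fun u : DispersiveSystem.Hper L (s / 2) => ∫ x, R (u x)) (φ.toHper (s / 2)))
    (S : DispersiveSystem.GlobalFlow R m L s)
    (hE : S.Conserves fun u => DispersiveSystem.energy R m u)
    (hF : S.Conserves fun u => DispersiveSystem.momentum u)
    (c : ℝ) (A : DispersiveSystem.Plane) (hwave : DispersiveSystem.IsTravellingWave R m c A φ)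
    (hspec : DispersiveSystem.SpectralCondition R m s c φ)
    (Φ : DispersiveSystem.Hper L (s / 2)) (hneg : DispersiveSystem.linForm R m c φ Φ Φ < 0)
    (Q : DispersiveSystem.Hper L (s / 2) → ℝ) (hQ : S.Conserves Q)
    (hQinv : ∀ (y : ℝ) (u : DispersiveSystem.Hper L (s / 2)),
      Q (DispersiveSystem.translate y u) = Q u)
    (hQdiff : DifferentiableAt ℝ Q (φ.toHper (s / 2)))
    (hQder : ∀ v : DispersiveSystem.Hper L (s / 2),
      fderiv ℝ Q (φ.toHper (s / 2)) v = DispersiveSystem.linForm R m c φ Φ v) :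
    S.OrbitallyStable (φ.toHper (s / 2)) := by
  have hs2 := (half_pos hs).le
  obtain ⟨C, hC⟩ := hm.symbolBound hs.le
  obtain ⟨N, δ, hδ, hcoercive⟩ :=
    DispersiveSystem.exists_linearizedForm_coercive hs hm hC hR hspec hneg
  have hQ' : HasFDerivAt Q (DispersiveSystem.linearizedForm hs2 hC hR c φ Φ) (φ.toHper (s / 2)) :=
    hQdiff.hasFDerivAt.congr_fderiv <| ContinuousLinearMap.ext fun v => by
      rw [hQder, DispersiveSystem.linearizedForm_eq_linForm]
  have hexpand := (hwave.hasTaylorTwo_action hs2 hm hC hR hreg).add_sq hQ' N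
  obtain ⟨η, hη, hlow⟩ := hexpand.exists_quadratic_lower_bound hδ
    (S := {v | inner ℝ (φ.deriv.toHper (s / 2)) v = 0}) fun v hv =>
      (hcoercive v hv).trans_eq (congrArg (_ + N * ·) (sq _))
  have hconserved := DispersiveSystem.action_conserved S hE hF c A
  refine S.orbitallyStable_of_lyapunov φ (fun u₀ t ht => ?_) (fun y u => ?_) hexpand.continuousAt
    (by positivity : 0 < δ / 4) hη hlow
  · exact congrArg₂ (fun a q => a + N / 2 * (q - Q (φ.toHper (s / 2))) ^ 2)
      (hconserved u₀ t ht) (hQ u₀ t ht)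
  · simp only [DispersiveSystem.action_translate, hQinv]

theorem theorem1p1 (L : ℝ) [Fact (0 < L)] (s : ℝ) (hs : 0 < s)
    (m : ℤ → Matrix (Fin 2) (Fin 2) ℝ) (hm : DispersiveSystem.IsSymbol m s)
    (R : DispersiveSystem.Plane → ℝ) (hR : ContDiff ℝ 2 R)
    -- for `s ≤ 1` the energy is well defined on the energy space and of class `C²` near `φ`
    (φ : DispersiveSystem.SmoothPer L)
    (hint : s ≤ 1 → ∀ u : DispersiveSystem.Hper L (s / 2), MeasureTheory.Integrable fun x => R (u x))
    (hreg : s ≤ 1 → ContDiffAt ℝ 2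
      (fun u : DispersiveSystem.Hper L (s / 2) => ∫ x, R (u x)) (φ.toHper (s / 2)))
    -- the flow, and conservation of energy and momentum
    (S : DispersiveSystem.GlobalFlow R m L s)
    (hE : S.Conserves fun u => DispersiveSystem.energy R m u)
    (hF : S.Conserves fun u => DispersiveSystem.momentum u)
    -- the wave, with minimal period `L`, and the spectral assumption
    (c : ℝ) (A : DispersiveSystem.Plane)
    (hwave : DispersiveSystem.IsTravellingWave R m c A φ)
    (hmin : ∀ p : ℝ, 0 < p → p < L → ∃ x : AddCircle L, φ (x + (p : AddCircle L)) ≠ φ x)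
    (hspec : DispersiveSystem.SpectralCondition R m s c φ)
    -- the function `Φ` and the conserved functional `Q`
    (Φ : DispersiveSystem.Hper L (s / 2))
    (hneg : DispersiveSystem.linForm R m c φ Φ Φ < 0)
    (horth : DispersiveSystem.linForm R m c φ Φ φ.deriv = 0)
    (Q : DispersiveSystem.Hper L (s / 2) → ℝ) (hQ : S.Conserves Q)
    (hQinv : ∀ (y : ℝ) (u : DispersiveSystem.Hper L (s / 2)),
      Q (DispersiveSystem.translate y u) = Q u)
    (hQdiff : DifferentiableAt ℝ Q (φ.toHper (s / 2)))
    (hQder : ∀ v : DispersiveSystem.Hper L (s / 2),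
      fderiv ℝ Q (φ.toHper (s / 2)) v = DispersiveSystem.linForm R m c φ Φ v) :
    S.OrbitallyStable (φ.toHper (s / 2)) :=
  theorem1p1_general L s hs m hm R hR φ hint hreg S hE hF c A hwave hspec Φ hneg Q hQ hQinv hQdiff
    hQder
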